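/- \textbf{Setting.} Functions of the times $t=(t^{(1)},t^{(2)})$, $t^{(a)}=(t^{(a)}_1,t^{(a)}_2,\dots)$, are formal power series over $\mathbb{C}$. A function $f(s,t)$, $s\in\mathbb{Z}$, is called invertible if every $f(s,\cdot)$ has nonzero constant term. Put $\xi(t,z)=\sum_{n\ge1}t_nz^n$, $[z]=(z,z^2/2,z^3/3,\dots)$, and let $t\pm[z]_a$ be $t$ with $\pm[z]$ added to $t^{(a)}$. Let $\Lambda f(s)=f(s+1)$, $\Delta=\Lambda-1$, $\iota_{\Lambda^+}\Delta^{-1}=-\sum_{i\ge0}\Lambda^i$, $\iota_{\Lambda^-}\Delta^{-1}=\sum_{i\ge1}\Lambda^{-i}$, $(\sum_i a_i\Lambda^i)^*=\sum_i\Lambda^{-i}a_i$, $(\sum_i a_i\Lambda^i)_{\ge0}=\sum_{i\ge0}a_i\Lambda^i$ and $(\sum_i a_i\Lambda^i)_{<0}=\sum_{i<0}a_i\Lambda^i$. A \emph{Toda tau function} is an invertible $\tau(s,t)$ such that for all $s,s'\in\mathbb{Z}$ $$\oint_{z=\infty}\frac{dz}{2\pi i}\,\tau(s,t-[z^{-1}]_1)\,\tau(s',t'+[z^{-1}]_1)\,z^{s-s'}e^{\xi(t^{(1)}-t'^{(1)},z)}=\oint_{z=0}\frac{dz}{2\pi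 i}\,\tau(s+1,t-[z]_2)\,\tau(s'-1,t'+[z]_2)\,z^{s-s'}e^{\xi(t^{(2)}-t'^{(2)},z^{-1})},$$ where both sides denote the coefficient of $z^{-1}$ of the integrand expanded at $z=\infty$, respectively $z=0$. Its wave and adjoint wave functions are $$\psi_1=\tfrac{\tau(s,t-[z^{-1}]_1)}{\tau(s,t)}z^se^{\xi(t^{(1)},z)},\qquad \psi_2=\tfrac{\tau(s+1,t-[z]_2)}{\tau(s,t)}z^se^{\xi(t^{(2)},z^{-1})},$$ $$\psi_1^*=\tfrac{\tau(s+1,t+[z^{-1}]_1)}{\tau(s+1,t)}z^{-s}e^{-\xi(t^{(1)},z)},\qquad \psi_2^*=\tfrac{\tau(s,t+[z]_2)}{\tau(s+1,t)}z^{-s}e^{-\xi(t^{(2)},z^{-1})}.$$ Its wave operators $S_1=1+\sum_{i\ge1}f_i\Lambda^{-i}$ and $S_2=\sum_{i\ge0}g_i\Lambda^i$ are defined by $\psi_1=S_1(z^s)e^{\xi(t^{(1)},z)}$ and $\psi_2=S_2(z^s)e^{\xi(t^{(2)},z^{-1})}$, and its Lax operators are $L_1=S_1\Lambda S_1^{-1}$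 and $L_2=S_2\Lambda^{-1}S_2^{-1}$. A function $q(s,t)$ is an \emph{eigenfunction} of $\tau$ if $\partial_{t^{(1)}_p}q=(L_1^p)_{\ge0}(q)$ and $\partial_{t^{(2)}_p}q=(L_2^p)_{<0}(q)$ for all $p\ge1$; a function $r(s,t)$ is an \emph{adjoint eigenfunction} of $\tau$ if $\partial_{t^{(1)}_p}r=-((L_1^p)_{\ge0})^*(r)$ and $\partial_{t^{(2)}_p}r=-((L_2^p)_{<0})^*(r)$ for all $p\ge1$. Put $$T_+(q)=\Lambda(q)\cdot\Delta\cdot q^{-1},\qquad T_-(r)=\Lambda^{-1}(r)^{-1}\cdot\Delta^{-1}\cdot r ;$$ the prefixes $\iota_{\Lambda^\pm}$ indicate the expansion used for $\Delta^{-1}$ or, for adjoint operators, for $(\Delta^*)^{-1}$: $\iota_{\Lambda^\pm}(\Delta^*)^{-1}=(\iota_{\Lambda^\mp}\Delta^{-1})^*$. \textbf{Statement.} Let $\tau$ be a Toda tau function. (1) Let $q$ be an invertible eigenfunction of $\tau$ and $T_1=T_+(q)$. Then $\tau^{[1]}(s)=(-1)^sq(s)\tau(s)$ is a Toda tau function,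 and its wave operators, wave functions and adjoint wave functions are $$S_1^{[1]}=T_1S_1\Lambda^{-1},\quad S_2^{[1]}=T_1S_2,\quad \psi_1^{[1]}=z^{-1}T_1(\psi_1),\quad \psi_2^{[1]}=T_1(\psi_2),$$ $$\psi_1^{*[1]}=z\,\iota_{\Lambda^+}(T_1^{-1})^*(\psi_1^*),\qquad \psi_2^{*[1]}=\iota_{\Lambda^-}(T_1^{-1})^*(\psi_2^*).$$ If $\tilde q$ is an eigenfunction of $\tau$, then $\tilde q^{[1]}=T_1(\tilde q)$ is an eigenfunction of $\tau^{[1]}$. If $\tilde r$ is an adjoint eigenfunction of $\tau$, then $\tilde r^{[1]}=(T_1^{-1})^*(\tilde r)=\Lambda(q)^{-1}\Omega$, with $\Omega=(\Delta^*)^{-1}(q\tilde r)$, is an adjoint eigenfunction of $\tau^{[1]}$ for a suitable choice of the $s$-independent summation constant in $\Omega$, that is, of the solution of $\Omega(s-1)-\Omega(s)=q(s)\tilde r(s)$; the suitable choices of $\Omega$ are exactly those that differ from one of them by an element of $\mathbb{C}$. (2) Let $r$ be an invertible adjoint eigenfunction of $\tau$ and $T_2=T_-(r)$. Then $\tau^{[1]}(s)=(-1)^sr(s-1)\tau(s)$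 is a Toda tau function, and its wave operators, wave functions and adjoint wave functions are $$S_1^{[1]}=\iota_{\Lambda^-}T_2\,S_1\Lambda,\quad S_2^{[1]}=\iota_{\Lambda^+}T_2\,S_2,\quad \psi_1^{[1]}=z\,\iota_{\Lambda^-}T_2(\psi_1),\quad \psi_2^{[1]}=\iota_{\Lambda^+}T_2(\psi_2),$$ $$\psi_1^{*[1]}=z^{-1}(T_2^{-1})^*(\psi_1^*),\qquad \psi_2^{*[1]}=(T_2^{-1})^*(\psi_2^*).$$ If $\tilde q$ is an eigenfunction of $\tau$, then $\tilde q^{[1]}=T_2(\tilde q)=\Lambda^{-1}(r)^{-1}\Omega$, with $\Omega=\Delta^{-1}(r\tilde q)$, is an eigenfunction of $\tau^{[1]}$ for a suitable choice of the $s$-independent summation constant in $\Omega$, that is, of the solution of $\Omega(s+1)-\Omega(s)=r(s)\tilde q(s)$; the suitable choices of $\Omega$ are exactly those that differ from one of them by an element of $\mathbb{C}$. If $\tilde r$ is an adjoint eigenfunction of $\tau$, then $\tilde r^{[1]}=(T_2^{-1})^*(\tilde r)$ is an adjoint eigenfunction of $\tau^{[1]}$. -/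

import Mathlib

noncomputable section

namespace Toda

/-! ### Functions of the time variables -/

/-- Index set of the times: `(0, p)` stands for `t_p^{(1)}` and `(1, p)` for `t_p^{(2)}`, `p ≥ 1`. -/
abbrev TimeIdx : Type := Fin 2 × ℕ+

/-- Functions of `t = (t^{(1)}, t^{(2)})`: formal power series in all the times. -/
abbrev Times : Type := MvPowerSeries TimeIdx ℂ

/-- Functions of two independent sets of times, `t` (left) and `t'` (right). -/
abbrev Times₂ : Type := MvPowerSeries (TimeIdx ⊕ TimeIdx) ℂ

instance : Filter.TendstoCofinite (Sum.inl : TimeIdx → TimeIdx ⊕ TimeIdx) :=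
  Filter.tendstoCofinite_of_injective Sum.inl_injective

instance : Filter.TendstoCofinite (Sum.inr : TimeIdx → TimeIdx ⊕ TimeIdx) :=
  Filter.tendstoCofinite_of_injective Sum.inr_injective

/-- `f(t)` as a function of `(t, t')`. -/
def atLeft (f : Times) : Times₂ := MvPowerSeries.rename Sum.inl f

/-- `f(t')` as a function of `(t, t')`. -/
def atRight (f : Times) : Times₂ := MvPowerSeries.rename Sum.inr f

/-- The coefficient of `w ^ k` in `exp (∑_{n ≥ 1} x_n w ^ n)`, where the `x_n` commute with each
other: `E = exp x` is the solution of `w E' = (w x') E`, `E(0) = 1`. -/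
def expCoeff {B : Type} [Ring B] [Algebra ℂ B] (x : ℕ+ → B) : ℕ → B
  | 0 => 1
  | k + 1 => ((k : ℂ) + 1)⁻¹ •
      ∑ j : Fin (k + 1), ((j : ℂ) + 1) • (x (Nat.succPNat j) * expCoeff x (k - j))
termination_by k => k
decreasing_by omega

/-- The coefficient of `w ^ k` in `f(t + σ [w]_a)`, where `[w] = (w, w²/2, w³/3, …)` is added to
the `a`-th set of times. By Taylor's formula
`f(t + σ [w]_a) = exp (∑_{n ≥ 1} σ (w ^ n / n) ∂/∂t_n^{(a)}) f`. -/
def timeShift (a : Fin 2) (σ : ℂ) (k : ℕ) (f : Times) : Times :=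
  expCoeff (B := Module.End ℂ Times)
    (fun n => (σ / (n : ℂ)) • (MvPowerSeries.pderiv ℂ (a, n)).toLinearMap) k f

/-- The coefficient of `w ^ k` in `exp (ξ(t^{(a)} - t'^{(a)}, w))`, `ξ(t, w) = ∑_{n ≥ 1} t_n w ^ n`. -/
def expXiDiff (a : Fin 2) (k : ℕ) : Times₂ :=
  expCoeff (fun n => MvPowerSeries.X (Sum.inl (a, n)) - MvPowerSeries.X (Sum.inr (a, n))) k

/-! ### Toda tau functions -/

/-- The residue (the coefficient of `z⁻¹`) of
`τ(s, t - [z⁻¹]_1) τ(s', t' + [z⁻¹]_1) z^{s - s'} e^{ξ(t^{(1)} - t'^{(1)}, z)}` expanded at `z = ∞`.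
Every coefficient of this power series in `(t, t')` is a finite sum. -/
def residueInfty (τ : ℤ → Times) (s s' : ℤ) : Times₂ := fun μ =>
  ∑ᶠ (e : ℕ × ℕ × ℕ) (_ : s - s' - e.1 - e.2.1 + e.2.2 = -1),
    MvPowerSeries.coeff μ (atLeft (timeShift 0 (-1) e.1 (τ s)) *
      atRight (timeShift 0 1 e.2.1 (τ s')) * expXiDiff 0 e.2.2)

/-- The residue (the coefficient of `z⁻¹`) of
`τ(s+1, t - [z]_2) τ(s'-1, t' + [z]_2) z^{s - s'} e^{ξ(t^{(2)} - t'^{(2)}, z⁻¹)}` expanded at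
`z = 0`. Every coefficient of this power series in `(t, t')` is a finite sum. -/
def residueZero (τ : ℤ → Times) (s s' : ℤ) : Times₂ := fun μ =>
  ∑ᶠ (e : ℕ × ℕ × ℕ) (_ : s - s' + e.1 + e.2.1 - e.2.2 = -1),
    MvPowerSeries.coeff μ (atLeft (timeShift 1 (-1) e.1 (τ (s + 1))) *
      atRight (timeShift 1 1 e.2.1 (τ (s' - 1))) * expXiDiff 1 e.2.2)

/-- A function of `(s, t)` that can be divided by: every `f(s, ·)` is an invertible
power series, that is, nonzero at `t = 0`. -/
def NonvanishingAtZero (f : ℤ → Times) : Prop := ∀ s, MvPowerSeries.constantCoeff (f s) ≠ 0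

/-- Tau functions of the (2-)Toda hierarchy: the bilinear equation. -/
structure IsTau (τ : ℤ → Times) : Prop where
  nonvanishing : NonvanishingAtZero τ
  bilinear : ∀ s s' : ℤ, residueInfty τ s s' = residueZero τ s s'

/-! ### Difference operators -/

/-- A formal difference operator `∑_{n ∈ ℤ} a_n(s, t) Λ ^ n` with `coeff n s = a_n(s, ·)`,
where `Λ f(s) = f(s + 1)`. -/
@[ext]
structure DiffOp where
  coeff : ℤ → ℤ → Times

namespace DiffOp

/-- `(a Λ ^ i) (b Λ ^ j) = a(s) b(s + i) Λ ^ (i + j)`. The sums are finite when one of the factors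
has finitely many terms, or when both are bounded above, or both bounded below, in `Λ`; products
are only formed in these cases. -/
instance : Mul DiffOp :=
  ⟨fun A B => ⟨fun n s => ∑ᶠ i : ℤ, A.coeff i s * B.coeff (n - i) (s + i)⟩⟩

/-- Multiplication by a function. -/
def ofFun (f : ℤ → Times) : DiffOp := ⟨fun n s => if n = 0 then f s else 0⟩

instance : One DiffOp := ⟨ofFun 1⟩

/-- `Λ ^ k`. -/
def shift (k : ℤ) : DiffOp := ⟨fun n _ => if n = k then 1 else 0⟩

/-- `Δ = Λ - 1`. -/
def delta : DiffOp := ⟨fun n _ => if n = 1 then 1 else if n = 0 then -1 else 0⟩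

/-- `ι_{Λ⁺} Δ⁻¹ = - ∑_{i ≥ 0} Λ ^ i`. -/
def deltaInvPlus : DiffOp := ⟨fun n _ => if 0 ≤ n then -1 else 0⟩

/-- `ι_{Λ⁻} Δ⁻¹ = ∑_{i ≥ 1} Λ ^ (-i)`. -/
def deltaInvMinus : DiffOp := ⟨fun n _ => if n < 0 then 1 else 0⟩

/-- Powers `A ^ p`. -/
def pow (A : DiffOp) : ℕ → DiffOp
  | 0 => 1
  | p + 1 => pow A p * A

/-- The formal adjoint `(∑ a_i Λ ^ i)^* = ∑ Λ ^ (-i) a_i`. -/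
def adjoint (A : DiffOp) : DiffOp := ⟨fun n s => A.coeff (-n) (s + n)⟩

/-- `A_{≥ 0}`. -/
def nonnegPart (A : DiffOp) : DiffOp := ⟨fun n s => if 0 ≤ n then A.coeff n s else 0⟩

/-- `A_{< 0}`. -/
def negPart (A : DiffOp) : DiffOp := ⟨fun n s => if n < 0 then A.coeff n s else 0⟩

/-- The action `A(f)` of a difference operator with finitely many terms on a function. -/
def act (A : DiffOp) (f : ℤ → Times) : ℤ → Times :=
  fun s => ∑ᶠ i : ℤ, A.coeff i s * f (s + i)

/-- The coefficients `x_n` of the inverse `∑_{n ≥ 0} x_n Λ ^ (ε n)` of `A = ∑_{n ≥ 0} a_n Λ ^ (ε n)`,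
`ε = ± 1`: the solution of `a_0(s) x_0(s) = 1` and `∑_{i ≤ n} a_i(s) x_{n-i}(s + ε i) = 0` for
`n ≥ 1`. -/
def invCoeff (ε : ℤ) (A : DiffOp) : ℕ → ℤ → Times
  | 0 => fun s => (A.coeff 0 s)⁻¹
  | n + 1 => fun s => -(A.coeff 0 s)⁻¹ *
      ∑ i : Fin (n + 1), A.coeff (ε * (i + 1)) s * invCoeff ε A (n - i) (s + ε * (i + 1))
termination_by n => n
decreasing_by omega

/-- `A⁻¹` for `A = ∑_{n ≥ 0} a_n Λ ^ (-n)` with `a_0` invertible. -/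
def invMinus (A : DiffOp) : DiffOp :=
  ⟨fun n s => if n ≤ 0 then invCoeff (-1) A (-n).toNat s else 0⟩

/-- `A⁻¹` for `A = ∑_{n ≥ 0} a_n Λ ^ n` with `a_0` invertible. -/
def invPlus (A : DiffOp) : DiffOp :=
  ⟨fun n s => if 0 ≤ n then invCoeff 1 A n.toNat s else 0⟩

end DiffOp

/-! ### Oscillating functions, wave functions and wave operators -/

/-- An oscillating function `(∑_n amp s n z ^ n) · exp (∑_n expo n z ^ n)` of `(s, t, z)`; the
exponential factor does not depend on `s`. -/
@[ext]
structure Osc where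
  amp : ℤ → ℤ → Times
  expo : ℤ → Times

/-- The action of a difference operator (in `s`) on an oscillating function. -/
def DiffOp.actOsc (A : DiffOp) (ψ : Osc) : Osc where
  amp := fun s n => ∑ᶠ i : ℤ, A.coeff i s * ψ.amp (s + i) n
  expo := ψ.expo

/-- Multiplication of an oscillating function by `z ^ k`. -/
def Osc.zMul (k : ℤ) (ψ : Osc) : Osc where
  amp := fun s n => ψ.amp s (n - k)
  expo := ψ.expo

/-- `ξ(t^{(a)}, z)` as a series in `z`. -/
def xi (a : Fin 2) : ℤ → Times := fun n =>
  if h : 0 < n then MvPowerSeries.X (a, ⟨n.toNat, by omega⟩) else 0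

/-- `z ^ d · ∑_{j ≥ 0} c_j z ^ (-j)`. -/
def descending (d : ℤ) (c : ℕ → Times) : ℤ → Times :=
  fun n => if n ≤ d then c (d - n).toNat else 0

/-- `z ^ d · ∑_{j ≥ 0} c_j z ^ j`. -/
def ascending (d : ℤ) (c : ℕ → Times) : ℤ → Times :=
  fun n => if d ≤ n then c (n - d).toNat else 0

/-- `ψ_1(s, t, z) = τ(s, t - [z⁻¹]_1) / τ(s, t) · z ^ s e^{ξ(t^{(1)}, z)}`. -/
def psi₁ (τ : ℤ → Times) : Osc where
  amp := fun s => descending s (fun j => timeShift 0 (-1) j (τ s) * (τ s)⁻¹)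
  expo := xi 0

/-- `ψ_2(s, t, z) = τ(s+1, t - [z]_2) / τ(s, t) · z ^ s e^{ξ(t^{(2)}, z⁻¹)}`. -/
def psi₂ (τ : ℤ → Times) : Osc where
  amp := fun s => ascending s (fun j => timeShift 1 (-1) j (τ (s + 1)) * (τ s)⁻¹)
  expo := fun n => xi 1 (-n)

/-- `ψ_1^*(s, t, z) = τ(s+1, t + [z⁻¹]_1) / τ(s+1, t) · z ^ (-s) e^{-ξ(t^{(1)}, z)}`. -/
def psiStar₁ (τ : ℤ → Times) : Osc where
  amp := fun s => descending (-s) (fun j => timeShift 0 1 j (τ (s + 1)) * (τ (s + 1))⁻¹)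
  expo := fun n => -xi 0 n

/-- `ψ_2^*(s, t, z) = τ(s, t + [z]_2) / τ(s+1, t) · z ^ (-s) e^{-ξ(t^{(2)}, z⁻¹)}`. -/
def psiStar₂ (τ : ℤ → Times) : Osc where
  amp := fun s => ascending (-s) (fun j => timeShift 1 1 j (τ s) * (τ (s + 1))⁻¹)
  expo := fun n => -xi 1 (-n)

/-- The difference operator `S` with `ψ = S(z ^ s) · exp(…)`. -/
def waveOp (ψ : Osc) : DiffOp := ⟨fun n s => ψ.amp s (s + n)⟩

/-- `waveOp ψ` is determined by the requirement `ψ = S(z ^ s) · exp(…)`. -/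
theorem actOsc_zpow_eq_iff (S : DiffOp) (ψ : Osc) :
    S.actOsc ⟨fun s n => if n = s then 1 else 0, ψ.expo⟩ = ψ ↔ S = waveOp ψ := by
  have key : ∀ s n : ℤ, (∑ᶠ i : ℤ, S.coeff i s * (if n = s + i then (1 : Times) else 0))
      = S.coeff (n - s) s := by
    intro s n
    rw [finsum_eq_single _ (n - s)]
    · simp
    · intro i hi
      rw [if_neg (by omega), mul_zero]
  constructor
  · intro h
    ext n s : 3
    have h' := congrFun (congrFun (congrArg Osc.amp h) s) (s + n)
    have h'' := key s (s + n)
    rw [add_sub_cancel_left] at h''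
    exact h''.symm.trans h'
  · rintro rfl
    ext s n : 3
    · refine (key s n).trans ?_
      simp only [waveOp, add_sub_cancel]
    · rfl

/-- The wave operator `S_1 = 1 + ∑_{i ≥ 1} f_i Λ ^ (-i)`. -/
def waveOp₁ (τ : ℤ → Times) : DiffOp := waveOp (psi₁ τ)

/-- The wave operator `S_2 = ∑_{i ≥ 0} g_i Λ ^ i`. -/
def waveOp₂ (τ : ℤ → Times) : DiffOp := waveOp (psi₂ τ)

/-- The Lax operator `L_1 = S_1 Λ S_1⁻¹`. -/
def lax₁ (τ : ℤ → Times) : DiffOp :=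
  waveOp₁ τ * DiffOp.shift 1 * (waveOp₁ τ).invMinus

/-- The Lax operator `L_2 = S_2 Λ⁻¹ S_2⁻¹`. -/
def lax₂ (τ : ℤ → Times) : DiffOp :=
  waveOp₂ τ * DiffOp.shift (-1) * (waveOp₂ τ).invPlus

/-! ### Eigenfunctions and adjoint eigenfunctions -/

/-- Toda eigenfunctions: `∂q/∂t_p^{(1)} = (L_1^p)_{≥0}(q)` and `∂q/∂t_p^{(2)} = (L_2^p)_{<0}(q)`. -/
def IsEigenfunction (τ q : ℤ → Times) : Prop :=
  ∀ (p : ℕ+) (s : ℤ),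
    MvPowerSeries.pderiv ℂ (0, p) (q s) = ((lax₁ τ).pow p).nonnegPart.act q s ∧
    MvPowerSeries.pderiv ℂ (1, p) (q s) = ((lax₂ τ).pow p).negPart.act q s

/-- Toda adjoint eigenfunctions: `∂r/∂t_p^{(1)} = -((L_1^p)_{≥0})^*(r)` and
`∂r/∂t_p^{(2)} = -((L_2^p)_{<0})^*(r)`. -/
def IsAdjointEigenfunction (τ r : ℤ → Times) : Prop :=
  ∀ (p : ℕ+) (s : ℤ),
    MvPowerSeries.pderiv ℂ (0, p) (r s) = -((lax₁ τ).pow p).nonnegPart.adjoint.act r s ∧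
    MvPowerSeries.pderiv ℂ (1, p) (r s) = -((lax₂ τ).pow p).negPart.adjoint.act r s

/-! ### The elementary Darboux transformation operators -/

/-- `T_+(q) = Λ(q) · Δ · q⁻¹`. -/
def TPlus (q : ℤ → Times) : DiffOp :=
  DiffOp.ofFun (fun s => q (s + 1)) * DiffOp.delta * DiffOp.ofFun (fun s => (q s)⁻¹)

/-- `T_+(q)⁻¹ = q · Δ⁻¹ · Λ(q)⁻¹`, where `D` is one of the two expansions of `Δ⁻¹`. -/
def TPlusInv (D : DiffOp) (q : ℤ → Times) : DiffOp :=
  DiffOp.ofFun q * D * DiffOp.ofFun (fun s => (q (s + 1))⁻¹)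

/-- `T_-(r) = Λ⁻¹(r)⁻¹ · Δ⁻¹ · r`, where `D` is one of the two expansions of `Δ⁻¹`. -/
def TMinus (D : DiffOp) (r : ℤ → Times) : DiffOp :=
  DiffOp.ofFun (fun s => (r (s - 1))⁻¹) * D * DiffOp.ofFun r

/-- `T_-(r)⁻¹ = r⁻¹ · Δ · Λ⁻¹(r)`. -/
def TMinusInv (r : ℤ → Times) : DiffOp :=
  DiffOp.ofFun (fun s => (r s)⁻¹) * DiffOp.delta * DiffOp.ofFun (fun s => r (s - 1))

/-- `Ω = Δ⁻¹(f)` for functions of `(s, t)`: a solution of `Ω(s+1) - Ω(s) = f(s)`. -/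
def IsDeltaInv (f Ω : ℤ → Times) : Prop := ∀ s, Ω (s + 1) - Ω s = f s

/-- `Ω = (Δ^*)⁻¹(f)` for functions of `(s, t)`: a solution of `Ω(s-1) - Ω(s) = f(s)`. -/
def IsDeltaStarInv (f Ω : ℤ → Times) : Prop := ∀ s, Ω (s - 1) - Ω s = f s

/-- The transformed tau function under `T_+(q)`: `(-1)^s q(s) τ(s)`. -/
def tauPlus (q τ : ℤ → Times) : ℤ → Times := fun s => ((-1 : ℂ) ^ s) • (q s * τ s)

/-- The transformed tau function under `T_-(r)`: `(-1)^s r(s-1) τ(s)`. -/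
def tauMinus (r τ : ℤ → Times) : ℤ → Times := fun s => ((-1 : ℂ) ^ s) • (r (s - 1) * τ s)

end Toda

end

open Toda

noncomputable section

namespace Toda

/-! ### Formal exponentials as solutions of `w E' = (w x') E` -/

section EulerODE

variable {B : Type} [Ring B] [Algebra ℂ B]

/-! Each wave function is an array of amplitudes indexed by `s` and the power of `z`, with rows
bounded on one side; wave rows pair with adjoint wave rows by taking residues. A Taylor expansion
about `t' = t` turns the bilinear equation into equality of the pairings for `j = 0` and `j = 1`
after any number of time derivatives. Without derivatives, the supports give the pairing for `j = 0`
when `s ≤ S` and for `j = 1` when `S < s`; equality then makes the adjoint array inverse to the wave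
array for both `j`. The same support argument annihilates the defects of the evolution by truncated
Lax powers. So tau functions are exactly the functions carrying a `TodaSys` with `ε = 1`
(`IsTau.exists_todaSys`, `TodaSys.isTau`), and its evolution operators are unique
(`TodaSys.unique`).

For `T_+(q)`, the shift `t ↦ t - [w]` acts on both waves and on all eigenfunctions by one common
difference operator (`TodaSys.exists_band_timeShift`). One wave bounds this operator from above, the
other from below, and only two explicit terms survive. The shifted `q` is thereby expressed through
`q` at two neighbouring sites and `τ`; cleared of denominators, this says that `T_+(q)` maps the
waves of `τ` to those of `(-1)^s q τ` (`TodaSys.wave_tauPlus`). Substituting `t + [w]` for `t` gives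
the relation for the adjoint waves (`TodaSys.dual_tauPlus`).

Since `∂q = A q`, conjugating `∂ - A` by `q` gives an operator `∂ - K Δ`, and `Δ (∂ - K Δ) = (∂ - Δ
K) Δ`: the transformed evolution exchanges the two factors (`IsGauge.intertwine`,
`TodaSys.darboux`). An adjoint eigenfunction `r` satisfies `∂(q r) = -Δ^* K^*(q r)`, so `Ω =
(Δ^*)⁻¹(q r)` has to satisfy `∂Ω = -K^*(q r)`. Flatness of the evolution makes this system closed,
and the Poincaré lemma solves it uniquely up to a complex constant (`TodaSys.exists_deltaStarInv`).

`T_-(r)` needs no second computation: reversing the sign of the times and reflecting `s` to `-s - 1`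
exchanges waves with adjoint waves and `T_-(r)` with the adjoint inverse of a `T_+`
(`TodaSys.dagger`). -/

/-- The Euler operator `w d/dw`. -/
def euler (F : PowerSeries B) : PowerSeries B :=
  PowerSeries.mk fun k => (k : ℂ) • PowerSeries.coeff k F

theorem coeff_euler (F : PowerSeries B) (k : ℕ) :
    PowerSeries.coeff k (euler F) = (k : ℂ) • PowerSeries.coeff k F :=
  PowerSeries.coeff_mk _ _

theorem euler_sub (F G : PowerSeries B) : euler (F - G) = euler F - euler G := by
  ext k; simp [coeff_euler, smul_sub]

theorem euler_mul (F G : PowerSeries B) : euler (F * G) = euler F * G + F * euler G := by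
  ext k
  simp only [coeff_euler, PowerSeries.coeff_mul, map_add, Finset.smul_sum,
    ← Finset.sum_add_distrib]
  refine Finset.sum_congr rfl fun p hp => ?_
  rw [Finset.HasAntidiagonal.mem_antidiagonal] at hp
  rw [← hp, smul_mul_assoc, mul_smul_comm, ← add_smul]
  push_cast; rfl

theorem euler_C (b : B) : euler (PowerSeries.C b) = 0 := by
  ext k
  rcases k with _ | k <;> simp [coeff_euler, PowerSeries.coeff_C]

/-- Uniqueness for `w F' = d F` when `d(0) = 0`. -/
theorem eq_zero_of_euler_eq {d F : PowerSeries B} (hd : PowerSeries.coeff 0 d = 0)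
    (h0 : PowerSeries.coeff 0 F = 0) (h : euler F = d * F) : F = 0 := by
  ext k
  rw [map_zero]
  induction k using Nat.strong_induction_on with
  | _ k ih =>
    rcases k with _ | k
    · exact h0
    -- Since `d` has no constant term, the right side involves only coefficients of `F` of index
    -- below `k + 1`, which vanish by induction.
    have h1 := congrArg (PowerSeries.coeff (k + 1)) h
    rw [coeff_euler, PowerSeries.coeff_mul, Finset.sum_eq_zero] at h1
    · exact (smul_eq_zero.mp h1).resolve_left (by exact_mod_cast Nat.succ_ne_zero k)
    · rintro ⟨i, j⟩ hp
      rw [Finset.HasAntidiagonal.mem_antidiagonal] at hp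
      rcases i with _ | i
      · simp only [hd, zero_mul]
      · simp only at hp ⊢
        rw [ih j (by omega), mul_zero]

theorem eq_of_euler_eq {d F G : PowerSeries B} (hd : PowerSeries.coeff 0 d = 0)
    (h0 : PowerSeries.coeff 0 F = PowerSeries.coeff 0 G) (hF : euler F = d * F)
    (hG : euler G = d * G) : F = G :=
  sub_eq_zero.mp <| eq_zero_of_euler_eq hd (by rw [map_sub, h0, sub_self])
    (by rw [euler_sub, hF, hG, mul_sub])

/-- `∑_{n ≥ 1} n x_n w ^ n`. -/
def logDeriv (x : ℕ+ → B) : PowerSeries B :=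
  PowerSeries.mk fun k => if h : 0 < k then (k : ℂ) • x ⟨k, h⟩ else 0

/-- `exp (∑_{n ≥ 1} x_n w ^ n)`. -/
def expSeries (x : ℕ+ → B) : PowerSeries B := PowerSeries.mk (expCoeff x)

theorem coeff_expSeries (x : ℕ+ → B) (k : ℕ) :
    PowerSeries.coeff k (expSeries x) = expCoeff x k := PowerSeries.coeff_mk _ _

theorem coeff_zero_logDeriv (x : ℕ+ → B) : PowerSeries.coeff 0 (logDeriv x) = 0 := by
  simp [logDeriv]

theorem coeff_succ_logDeriv (x : ℕ+ → B) (k : ℕ) :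
    PowerSeries.coeff (k + 1) (logDeriv x) = ((k : ℂ) + 1) • x (Nat.succPNat k) := by
  simp [logDeriv, Nat.succPNat]

theorem expCoeff_zero (x : ℕ+ → B) : expCoeff x 0 = 1 := by rw [expCoeff]

theorem coeff_zero_expSeries (x : ℕ+ → B) : PowerSeries.coeff 0 (expSeries x) = 1 := by
  rw [coeff_expSeries, expCoeff_zero]

theorem expCoeff_succ (x : ℕ+ → B) (k : ℕ) : ((k : ℂ) + 1) • expCoeff x (k + 1) =
    ∑ j ∈ Finset.range (k + 1), ((j : ℂ) + 1) • (x (Nat.succPNat j) * expCoeff x (k - j)) := by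
  rw [expCoeff, smul_smul, mul_inv_cancel₀ (by exact_mod_cast Nat.succ_ne_zero k), one_smul,
    Fin.sum_univ_eq_sum_range fun j => ((j : ℂ) + 1) • (x (Nat.succPNat j) * expCoeff x (k - j))]

theorem euler_expSeries (x : ℕ+ → B) : euler (expSeries x) = logDeriv x * expSeries x := by
  ext k
  rw [coeff_euler, PowerSeries.coeff_mul]
  rcases k with _ | k
  · simp [coeff_zero_logDeriv]
  · rw [Finset.Nat.antidiagonal_succ, Finset.sum_cons]
    simp only [coeff_zero_logDeriv, zero_mul, zero_add, Finset.sum_map, coeff_expSeries,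
      Function.Embedding.prodMap, Function.Embedding.coeFn_mk, Prod.map,
      Function.Embedding.refl_apply, Nat.succ_eq_add_one, coeff_succ_logDeriv]
    push_cast
    rw [expCoeff_succ, Finset.Nat.sum_antidiagonal_eq_sum_range_succ
      fun i j => ((i : ℂ) + 1) • x (Nat.succPNat i) * expCoeff x j]
    simp only [smul_mul_assoc]

theorem commute_expCoeff (x : ℕ+ → B) (b : B) (h : ∀ n, Commute (x n) b) (k : ℕ) :
    Commute (expCoeff x k) b := by
  induction k using Nat.strong_induction_on with
  | _ k ih =>
    rcases k with _ | k
    · rw [expCoeff]; exact Commute.one_left b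
    · rw [expCoeff]
      refine Commute.smul_left (Commute.sum_left _ _ _ fun j _ => Commute.smul_left ?_ _) _
      exact (h _).mul_left (ih _ (by omega))

/-- Once `logDeriv y` is moved past `expSeries x`, both sides solve the same Euler equation with the
same initial value. -/
theorem expSeries_mul_expSeries (x y : ℕ+ → B) (h : ∀ m n, Commute (x m) (y n)) :
    expSeries x * expSeries y = expSeries fun n => x n + y n := by
  refine eq_of_euler_eq (coeff_zero_logDeriv fun n => x n + y n) ?_ ?_ (euler_expSeries _)
  · rw [PowerSeries.coeff_mul]
    simp [coeff_zero_expSeries]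
  · have hc : expSeries x * logDeriv y = logDeriv y * expSeries x := by
      ext k
      rw [PowerSeries.coeff_mul, PowerSeries.coeff_mul, ← Finset.Nat.sum_antidiagonal_swap]
      refine Finset.sum_congr rfl fun p _ => ?_
      simp only [Prod.fst_swap, Prod.snd_swap, coeff_expSeries]
      refine commute_expCoeff x _ (fun n => ?_) _
      rcases p.1 with _ | m
      · rw [coeff_zero_logDeriv]; exact Commute.zero_right _
      · rw [coeff_succ_logDeriv]; exact (h _ _).smul_right _
    have hl : logDeriv (fun n => x n + y n) = logDeriv x + logDeriv y := by
      ext k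
      rcases k with _ | k
      · simp only [map_add, coeff_zero_logDeriv, add_zero]
      · simp only [map_add, coeff_succ_logDeriv, smul_add]
    rw [euler_mul, euler_expSeries, euler_expSeries, ← mul_assoc (expSeries x), hc, hl]
    simp only [add_mul, mul_assoc]

theorem expSeries_zero : expSeries (fun _ => (0 : B)) = 1 := by
  refine eq_of_euler_eq (coeff_zero_logDeriv fun _ => (0 : B)) ?_ (euler_expSeries _) ?_
  · rw [coeff_zero_expSeries]; simp
  · have : logDeriv (fun _ => (0 : B)) = 0 := by ext k; simp [logDeriv]
    rw [this, zero_mul, ← map_one (PowerSeries.C (R := B)), euler_C]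

end EulerODE

/-! ### Shifts of the times -/

/-- The exponent of the shift `t ↦ t + σ [w]_a`. -/
def shiftExponent (a : Fin 2) (σ : ℂ) (n : ℕ+) : Module.End ℂ Times :=
  (σ / (n : ℂ)) • (MvPowerSeries.pderiv ℂ (a, n)).toLinearMap

/-- `f ↦ f(t + σ [w]_a)` as a series of operators. -/
def shiftSeries (a : Fin 2) (σ : ℂ) : PowerSeries (Module.End ℂ Times) :=
  expSeries (shiftExponent a σ)

/-- `timeShift a σ k` as a linear map. -/
def timeShiftLin (a : Fin 2) (σ : ℂ) (k : ℕ) : Times →ₗ[ℂ] Times := expCoeff (shiftExponent a σ) k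

theorem timeShift_eq (a : Fin 2) (σ : ℂ) (k : ℕ) (f : Times) :
    timeShift a σ k f = timeShiftLin a σ k f := rfl

theorem coeff_shiftSeries (a : Fin 2) (σ : ℂ) (k : ℕ) :
    PowerSeries.coeff k (shiftSeries a σ) = timeShiftLin a σ k := coeff_expSeries _ _

theorem pderiv_comm (α β : TimeIdx) (f : Times) :
    MvPowerSeries.pderiv ℂ α (MvPowerSeries.pderiv ℂ β f) =
      MvPowerSeries.pderiv ℂ β (MvPowerSeries.pderiv ℂ α f) := by
  classical
  ext d
  by_cases h : α = β
  · rw [h]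
  · simp only [MvPowerSeries.coeff_pderiv, Finsupp.add_apply, Finsupp.single_apply, if_neg h,
      if_neg (Ne.symm h), add_zero, add_right_comm d (Finsupp.single β 1)]
    ring

theorem shiftExponent_commute (a : Fin 2) (σ σ' : ℂ) (m n : ℕ+) :
    Commute (shiftExponent a σ m) (shiftExponent a σ' n) := by
  refine Commute.smul_left (Commute.smul_right ?_ _) _
  ext f : 1
  exact pderiv_comm _ _ f

theorem shiftSeries_neg_mul (a : Fin 2) (σ : ℂ) : shiftSeries a (-σ) * shiftSeries a σ = 1 := by
  rw [shiftSeries, shiftSeries, expSeries_mul_expSeries _ _ (shiftExponent_commute a _ _),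
    ← expSeries_zero]
  congr 1
  funext n
  rw [shiftExponent, shiftExponent, ← add_smul, ← add_div, neg_add_cancel, zero_div, zero_smul]

theorem timeShift_zero (a : Fin 2) (σ : ℂ) (f : Times) : timeShift a σ 0 f = f := by
  rw [timeShift, expCoeff_zero]; rfl

theorem timeShift_smul (a : Fin 2) (σ : ℂ) (k : ℕ) (c : ℂ) (f : Times) :
    timeShift a σ k (c • f) = c • timeShift a σ k f := by
  simp only [timeShift_eq, map_smul]

/-- The factor `n` produced by `w d/dw` cancels the `1/n` in `[w]`, so all derivatives enter with
the same coefficient `σ`. This is the form used for inductions on the order of the shift. -/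
theorem timeShift_succ (a : Fin 2) (σ : ℂ) (k : ℕ) (f : Times) :
    ((k : ℂ) + 1) • timeShift a σ (k + 1) f = ∑ j ∈ Finset.range (k + 1),
      σ • MvPowerSeries.pderiv ℂ (a, Nat.succPNat j) (timeShift a σ (k - j) f) := by
  have h := LinearMap.congr_fun (expCoeff_succ (shiftExponent a σ) k) f
  refine h.trans ?_
  rw [LinearMap.sum_apply]
  refine Finset.sum_congr rfl fun j _ => ?_
  have hj : ((j : ℂ) + 1) ≠ 0 := by exact_mod_cast Nat.succ_ne_zero j
  simp only [LinearMap.smul_apply, Module.End.mul_apply, shiftExponent, smul_smul,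
    Nat.succPNat_coe, Nat.succ_eq_add_one, Nat.cast_add, Nat.cast_one]
  rw [mul_div_cancel₀ _ hj]
  rfl

/-! ### Multiplicativity of the shifts of the times. -/

theorem lmul_apply_apply (f g : Times) : Algebra.lmul ℂ Times f g = f * g := rfl

/-- Multiplication operators by the coefficients of a power series. -/
def mulSeries (F : PowerSeries Times) : PowerSeries (Module.End ℂ Times) :=
  PowerSeries.map (Algebra.lmul ℂ Times).toRingHom F

theorem coeff_mulSeries (F : PowerSeries Times) (k : ℕ) :
    PowerSeries.coeff k (mulSeries F) = Algebra.lmul ℂ Times (PowerSeries.coeff k F) := by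
  simp [mulSeries]

/-- `f(t + σ [w]_a)` as a power series in `w`. -/
def shifted (a : Fin 2) (σ : ℂ) (f : Times) : PowerSeries Times :=
  PowerSeries.mk fun k => timeShift a σ k f

theorem coeff_shifted (a : Fin 2) (σ : ℂ) (f : Times) (k : ℕ) :
    PowerSeries.coeff k (shifted a σ f) = timeShift a σ k f := PowerSeries.coeff_mk _ _

/-- Commuting a derivation past multiplication by a function gives multiplication by the derivative.
The shifted function therefore obeys a Heisenberg equation `w M' = [D, M]`. -/
theorem euler_mulSeries_shifted (a : Fin 2) (σ : ℂ) (f : Times) :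
    euler (mulSeries (shifted a σ f)) = logDeriv (shiftExponent a σ) * mulSeries (shifted a σ f) -
      mulSeries (shifted a σ f) * logDeriv (shiftExponent a σ) := by
  ext k : 1
  rw [coeff_euler, map_sub, PowerSeries.coeff_mul, PowerSeries.coeff_mul,
    ← Finset.Nat.sum_antidiagonal_swap (f := fun p =>
      PowerSeries.coeff p.1 (mulSeries (shifted a σ f)) * _), ← Finset.sum_sub_distrib]
  have h := congrArg (fun X => X f)
    (congrArg (PowerSeries.coeff k) (euler_expSeries (shiftExponent a σ)))
  simp only [coeff_euler, PowerSeries.coeff_mul, coeff_expSeries] at h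
  ext g : 1
  rw [LinearMap.smul_apply, coeff_mulSeries, coeff_shifted, timeShift_eq, lmul_apply_apply,
    ← smul_mul_assoc]
  refine (congrArg (· * g) h).trans ?_
  rw [LinearMap.sum_apply, LinearMap.sum_apply, Finset.sum_mul]
  refine Finset.sum_congr rfl fun p _ => ?_
  simp only [LinearMap.sub_apply, Module.End.mul_apply, Prod.fst_swap, Prod.snd_swap,
    coeff_mulSeries, coeff_shifted, lmul_apply_apply, timeShift_eq, timeShiftLin]
  rcases p.1 with _ | m
  · simp [coeff_zero_logDeriv]
  · rw [coeff_succ_logDeriv]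
    simp only [LinearMap.smul_apply, shiftExponent, Derivation.coeFn_coe, Derivation.leibniz,
      smul_eq_mul, smul_add, mul_smul_comm, mul_comm]
    ring

/-- Conjugation by the shift turns multiplication by `f` into multiplication by the shifted `f`:
both sides solve `w F' = D F`, the right one by the Heisenberg equation. -/
theorem shiftSeries_mul_lmul (a : Fin 2) (σ : ℂ) (f : Times) :
    shiftSeries a σ * PowerSeries.C (Algebra.lmul ℂ Times f) =
      mulSeries (shifted a σ f) * shiftSeries a σ := by
  refine eq_of_euler_eq (coeff_zero_logDeriv (shiftExponent a σ)) ?_ ?_ ?_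
  · ext g : 1
    simp [PowerSeries.coeff_mul, coeff_shiftSeries, coeff_mulSeries, coeff_shifted,
      timeShiftLin, expCoeff_zero, timeShift_zero, PowerSeries.coeff_C]
  · rw [euler_mul, euler_C, mul_zero, add_zero, shiftSeries, euler_expSeries, mul_assoc]
  · rw [euler_mul, euler_mulSeries_shifted, shiftSeries, euler_expSeries, sub_mul]
    simp only [mul_assoc]
    abel

/-- `(f g)(t + σ [w]_a) = f(t + σ [w]_a) g(t + σ [w]_a)`. -/
theorem shifted_mul (a : Fin 2) (σ : ℂ) (f g : Times) :
    shifted a σ (f * g) = shifted a σ f * shifted a σ g := by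
  ext k : 1
  have h := congrArg (fun X => (PowerSeries.coeff k X : Module.End ℂ Times) g)
    (shiftSeries_mul_lmul a σ f)
  simp only [PowerSeries.coeff_mul_C] at h
  simp only [PowerSeries.coeff_mul, LinearMap.sum_apply,
    coeff_shiftSeries, coeff_mulSeries, coeff_shifted, Module.End.mul_apply,
    lmul_apply_apply] at h
  rw [PowerSeries.coeff_mul, coeff_shifted, timeShift_eq, h]
  simp only [coeff_shifted, timeShift_eq]

/-- Substituting `t + σ [w]_a` for `t` in `f(t) g(t - σ [w]_a)`. -/
theorem sum_timeShift_mul_timeShift_neg (a : Fin 2) (σ : ℂ) (f g : Times) (k : ℕ) :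
    ∑ p ∈ Finset.HasAntidiagonal.antidiagonal k, timeShift a σ p.1 (f * timeShift a (-σ) p.2 g) =
      timeShift a σ k f * g := by
  have h : shiftSeries a σ * PowerSeries.C (Algebra.lmul ℂ Times f) * shiftSeries a (-σ) =
      mulSeries (shifted a σ f) := by
    have h1 := shiftSeries_neg_mul a (-σ)
    rw [neg_neg] at h1
    rw [shiftSeries_mul_lmul, mul_assoc, h1, mul_one]
  have h := congrArg (fun X => (PowerSeries.coeff k X : Module.End ℂ Times) g) h
  rw [PowerSeries.coeff_mul] at h
  simpa only [PowerSeries.coeff_mul_C, LinearMap.sum_apply,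
    coeff_shiftSeries, coeff_mulSeries, coeff_shifted, Module.End.mul_apply,
    lmul_apply_apply, timeShift_eq] using h

theorem timeShift_one (a : Fin 2) (σ : ℂ) (k : ℕ) :
    timeShift a σ k 1 = if k = 0 then 1 else 0 := by
  induction k using Nat.strong_induction_on with
  | _ k ih =>
    rcases k with _ | k
    · simp [timeShift_zero]
    · have h := timeShift_succ a σ k 1
      rw [if_neg (Nat.succ_ne_zero k)]
      rw [Finset.sum_eq_zero] at h
      · exact (smul_eq_zero.mp h).resolve_left (by exact_mod_cast Nat.succ_ne_zero k)
      · intro j hj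
        rw [ih (k - j) (by omega)]
        split_ifs
        · rw [MvPowerSeries.pderiv_one, smul_zero]
        · rw [map_zero, smul_zero]

end Toda
end

noncomputable section

namespace Toda

/-! ### Difference operators with finitely many terms, as linear maps -/

/-- Functions of `(s, t)`. -/
abbrev Fn : Type := ℤ → Times

/-- Linear operators on functions of `(s, t)`. -/
abbrev FnEnd : Type := Module.End ℂ Fn

/-- Multiplication by a function. -/
def mulOp : Fn →+ FnEnd := (Algebra.lmul ℂ Fn).toLinearMap.toAddMonoidHom

/-- `Λ ^ k`. -/
def shiftOp (k : ℤ) : FnEnd := LinearMap.funLeft ℂ Times fun s => s + k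

/-- `ε ∂_α`. -/
def derivOp (ε : ℂ) (α : TimeIdx) : FnEnd where
  toFun f s := ε • MvPowerSeries.pderiv ℂ α (f s)
  map_add' f g := by funext s; simp
  map_smul' c f := by funext s; simp [smul_comm c ε]

@[simp] theorem mulOp_apply (c f : Fn) (s : ℤ) : mulOp c f s = c s * f s := rfl
@[simp] theorem shiftOp_apply (k : ℤ) (f : Fn) (s : ℤ) : shiftOp k f s = f (s + k) := rfl
@[simp] theorem derivOp_apply (ε : ℂ) (α : TimeIdx) (f : Fn) (s : ℤ) :
    derivOp ε α f s = ε • MvPowerSeries.pderiv ℂ α (f s) := rfl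

/-- `∑ a_i Λ ^ i`. -/
def bandOp : (ℤ →₀ Fn) →+ FnEnd :=
  Finsupp.liftAddHom fun i => (AddMonoidHom.mulRight (shiftOp i)).comp mulOp

/-- `∑ Λ ^ (-i) a_i`. -/
def bandAdj : (ℤ →₀ Fn) →+ FnEnd :=
  Finsupp.liftAddHom fun i => (AddMonoidHom.mulLeft (shiftOp (-i))).comp mulOp

@[simp] theorem bandOp_single (i : ℤ) (c : Fn) :
    bandOp (Finsupp.single i c) = mulOp c * shiftOp i := by simp [bandOp]

@[simp] theorem bandAdj_single (i : ℤ) (c : Fn) :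
    bandAdj (Finsupp.single i c) = shiftOp (-i) * mulOp c := by simp [bandAdj]

theorem bandOp_apply (a : ℤ →₀ Fn) (f : Fn) (s : ℤ) :
    bandOp a f s = ∑ i ∈ a.support, a i s * f (s + i) := by
  rw [bandOp, Finsupp.liftAddHom_apply, Finsupp.sum, LinearMap.sum_apply, Finset.sum_apply]
  rfl

theorem bandAdj_apply (a : ℤ →₀ Fn) (f : Fn) (s : ℤ) :
    bandAdj a f s = ∑ i ∈ a.support, a i (s - i) * f (s - i) := by
  rw [bandAdj, Finsupp.liftAddHom_apply, Finsupp.sum, LinearMap.sum_apply, Finset.sum_apply]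
  rfl

/-- `A` is a difference operator with finitely many terms, and `A'` is its formal adjoint. -/
def IsBand (A A' : FnEnd) : Prop := ∃ a : ℤ →₀ Fn, A = bandOp a ∧ A' = bandAdj a

namespace IsBand

variable {A A' B B' : FnEnd}

theorem add (hA : IsBand A A') (hB : IsBand B B') : IsBand (A + B) (A' + B') := by
  obtain ⟨a, rfl, rfl⟩ := hA
  obtain ⟨b, rfl, rfl⟩ := hB
  exact ⟨a + b, (map_add _ _ _).symm, (map_add _ _ _).symm⟩

theorem neg (hA : IsBand A A') : IsBand (-A) (-A') := by
  obtain ⟨a, rfl, rfl⟩ := hA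
  exact ⟨-a, (map_neg _ _).symm, (map_neg _ _).symm⟩

theorem sub (hA : IsBand A A') (hB : IsBand B B') : IsBand (A - B) (A' - B') := by
  simpa only [sub_eq_add_neg] using hA.add hB.neg

theorem zero : IsBand 0 0 := ⟨0, (map_zero _).symm, (map_zero _).symm⟩

theorem mulOp (c : Fn) : IsBand (mulOp c) (Toda.mulOp c) :=
  ⟨Finsupp.single 0 c, by ext f s; simp, by ext f s; simp⟩

theorem shiftOp (k : ℤ) : IsBand (shiftOp k) (Toda.shiftOp (-k)) :=
  ⟨Finsupp.single k 1, by ext f s; simp, by ext f s; simp⟩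

theorem one : IsBand 1 1 := ⟨Finsupp.single 0 1, by ext f s; simp, by ext f s; simp⟩

theorem sum {ι : Type*} (t : Finset ι) {F F' : ι → FnEnd} (h : ∀ i ∈ t, IsBand (F i) (F' i)) :
    IsBand (∑ i ∈ t, F i) (∑ i ∈ t, F' i) := by
  classical
  induction t using Finset.induction_on with
  | empty => exact zero
  | insert i t hi ih =>
    rw [Finset.sum_insert hi, Finset.sum_insert hi]
    exact (h i (by simp)).add (ih fun j hj => h j (by simp [hj]))

/-- An additive property of banded operators that holds for all `c Λ ^ i` holds for all of them. -/
theorem induction {p : FnEnd → FnEnd → Prop} (h0 : p 0 0)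
    (hadd : ∀ A A' B B', p A A' → p B B' → p (A + B) (A' + B'))
    (hsingle : ∀ (i : ℤ) (c : Fn),
      p (Toda.mulOp c * Toda.shiftOp i) (Toda.shiftOp (-i) * Toda.mulOp c))
    (hA : IsBand A A') : p A A' := by
  obtain ⟨a, rfl, rfl⟩ := hA
  induction a using Finsupp.induction_linear with
  | zero => simpa only [map_zero] using h0
  | add a b ha hb => rw [map_add, map_add]; exact hadd _ _ _ _ ha hb
  | single i c => rw [bandOp_single, bandAdj_single]; exact hsingle i c

theorem mul (hA : IsBand A A') (hB : IsBand B B') : IsBand (A * B) (B' * A') := by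
  refine induction (p := fun A A' => IsBand (A * B) (B' * A')) ?_ ?_ ?_ hA
  · simpa using zero
  · intro A A' C C' h h'
    rw [add_mul, mul_add]
    exact h.add h'
  intro i c
  refine induction (p := fun B B' => IsBand (Toda.mulOp c * Toda.shiftOp i * B)
    (B' * (Toda.shiftOp (-i) * Toda.mulOp c))) ?_ ?_ ?_ hB
  · simpa using zero
  · intro A A' C C' h h'
    rw [add_mul, mul_add]
    exact h.add h'
  intro j d
  refine ⟨Finsupp.single (i + j) (c * fun s => d (s + i)), ?_, ?_⟩
  · ext f s : 2
    rw [bandOp_single]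
    simp [mul_assoc, add_assoc]
  · ext f s : 2
    simp only [bandAdj_single, Module.End.mul_apply, shiftOp_apply, mulOp_apply, Pi.mul_apply]
    rw [show s + -j + -i = s + -(i + j) by ring, show s + -(i + j) + i = s + -j by ring]
    ring

/-- Derivations commute with `Λ`, so the commutator only differentiates the coefficients; this is
why it is again banded and why passing to the adjoint produces no sign. -/
theorem commutator_derivOp (ε : ℂ) (α : TimeIdx) (hA : IsBand A A') :
    IsBand (derivOp ε α * A - A * derivOp ε α) (derivOp ε α * A' - A' * derivOp ε α) := by
  refine induction (p := fun A A' => IsBand (derivOp ε α * A - A * derivOp ε α)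
    (derivOp ε α * A' - A' * derivOp ε α)) ?_ ?_ ?_ hA
  · simpa using zero
  · intro A A' C C' h h'
    convert h.add h' using 1 <;> noncomm_ring
  intro i c
  refine ⟨Finsupp.single i (derivOp ε α c), ?_, ?_⟩
  · ext f s : 2
    simp [smul_add, mul_comm]
  · ext f s : 2
    simp [smul_add, mul_comm]

/-- A delta function at `s + i` isolates the coefficient `a i s`. Hence the linear map determines
the coefficients, and with them the formal adjoint. -/
theorem coeff_eq_zero {a : ℤ →₀ Fn} (h : bandOp a = 0) : a = 0 := by
  ext i s : 2
  have h1 := congrFun (LinearMap.congr_fun h (Pi.single (s + i) 1)) s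
  rw [bandOp_apply, Finset.sum_eq_single i] at h1
  · simpa using h1
  · intro j _ hj
    rw [Pi.single_eq_of_ne (by omega), mul_zero]
  · intro hi
    rw [Finsupp.notMem_support_iff.mp hi, Pi.zero_apply, zero_mul]

theorem adj_eq_zero (hA : IsBand A A') (h : A = 0) : A' = 0 := by
  obtain ⟨a, rfl, rfl⟩ := hA
  rw [coeff_eq_zero h, map_zero]

theorem adj_unique {A'' : FnEnd} (h : IsBand A A') (h' : IsBand A A'') : A' = A'' :=
  sub_eq_zero.mp ((h.sub h').adj_eq_zero (sub_self A))

end IsBand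

/-! ### The difference operator `Δ` -/

/-- `Δ = Λ - 1`. -/
def deltaOp : FnEnd := shiftOp 1 - 1

/-- `Δ^* = Λ⁻¹ - 1`. -/
def deltaStarOp : FnEnd := shiftOp (-1) - 1

@[simp] theorem deltaOp_apply (f : Fn) (s : ℤ) : deltaOp f s = f (s + 1) - f s := rfl
@[simp] theorem deltaStarOp_apply (f : Fn) (s : ℤ) : deltaStarOp f s = f (s + -1) - f s := rfl

theorem isBand_deltaOp : IsBand deltaOp deltaStarOp := (IsBand.shiftOp 1).sub IsBand.one

/-- Every function is a difference, with prescribed value of the primitive at `0`. -/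
theorem exists_sub_eq {M : Type*} [AddCommGroup M] (g : ℤ → M) (c : M) :
    ∃ f : ℤ → M, f 0 = c ∧ ∀ s, f (s + 1) - f s = g s := by
  refine ⟨fun s => Int.inductionOn' (motive := fun _ => M) s 0 c
    (fun k _ x => x + g k) (fun k _ x => x - g (k - 1)), Int.inductionOn'_self, fun s => ?_⟩
  rcases le_or_gt 0 s with hs | hs
  · dsimp only
    rw [Int.inductionOn'_add_one hs, add_sub_cancel_left]
  · have h := Int.inductionOn'_sub_one (motive := fun _ => M) (b := 0) (z := s + 1)
      (zero := c) (succ := fun k _ x => x + g k) (pred := fun k _ x => x - g (k - 1)) (by omega)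
    simp only [add_sub_cancel_right] at h
    dsimp only
    rw [h, sub_sub_cancel]

theorem deltaOp_surjective (g : Fn) : ∃ f, deltaOp f = g := by
  obtain ⟨f, -, hf⟩ := exists_sub_eq g 0
  exact ⟨f, funext hf⟩

/-- `Δ` can be cancelled on the right because every function is a difference; it could not be
cancelled on the left, since it kills functions constant in `s`. -/
theorem eq_zero_of_mul_deltaOp {K : FnEnd} (h : K * deltaOp = 0) : K = 0 := by
  ext g : 1
  obtain ⟨f, rfl⟩ := deltaOp_surjective g
  exact LinearMap.congr_fun h f

theorem eq_const_of_deltaStar {f : Fn} (h : ∀ s, f (s - 1) - f s = 0) (s : ℤ) : f s = f 0 := by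
  induction s using Int.induction_on with
  | zero => rfl
  | succ i ih => rw [← ih, ← sub_eq_zero, ← neg_sub, neg_eq_zero]; simpa using h (i + 1)
  | pred i ih => rw [← ih]; exact sub_eq_zero.mp (h _)

/-- A difference operator that kills the constant function `1` is divisible by `Δ`. -/
theorem exists_mul_deltaOp {A A' : FnEnd} (hA : IsBand A A') :
    ∃ K K', IsBand K K' ∧ A = mulOp (A 1) + K * deltaOp := by
  -- `Λ ^ i - 1` is divisible by `Λ - 1` also for negative `i`; the general case then follows by
  -- additivity, with remainder the sum of the coefficients, which is the value at `1`.
  have hs : ∀ i : ℤ, ∃ K K', IsBand K K' ∧ shiftOp i - 1 = K * deltaOp := by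
    intro i
    induction i using Int.induction_on with
    | zero => exact ⟨0, 0, IsBand.zero, by ext f s : 2; simp⟩
    | succ i ih =>
      obtain ⟨K, K', hK, h⟩ := ih
      refine ⟨shiftOp 1 * K + 1, _, ((IsBand.shiftOp 1).mul hK).add IsBand.one, ?_⟩
      rw [add_mul, mul_assoc, ← h]
      ext f s : 2
      simp [show s + 1 + (i : ℤ) = s + (i + 1) by ring]
    | pred i ih =>
      obtain ⟨K, K', hK, h⟩ := ih
      refine ⟨shiftOp (-1) * K - shiftOp (-1), _,
        ((IsBand.shiftOp (-1)).mul hK).sub (IsBand.shiftOp (-1)), ?_⟩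
      rw [sub_mul, mul_assoc, ← h]
      ext f s : 2
      simp [show s + -1 + (-i : ℤ) = s + (-i - 1) by ring]
  refine IsBand.induction (p := fun A _ => ∃ K K', IsBand K K' ∧ A = mulOp (A 1) + K * deltaOp)
    ⟨0, 0, IsBand.zero, by simp⟩ ?_ ?_ hA
  · rintro A A' B B' ⟨K, K', hK, h⟩ ⟨L, L', hL, h'⟩
    refine ⟨K + L, _, hK.add hL, ?_⟩
    rw [LinearMap.add_apply, map_add, add_mul]
    nth_rw 1 [h, h']
    abel
  · intro i c
    obtain ⟨K, K', hK, h⟩ := hs i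
    refine ⟨mulOp c * K, _, (IsBand.mulOp c).mul hK, ?_⟩
    rw [mul_assoc, ← h]
    ext f s : 2
    simp [mul_sub]

/-! ### Commutation rules -/

theorem derivOp_mul_mulOp (ε : ℂ) (α : TimeIdx) (c : Fn) :
    derivOp ε α * mulOp c = mulOp (derivOp ε α c) + mulOp c * derivOp ε α := by
  ext f s : 2
  simp [smul_add, mul_comm, add_comm]

theorem derivOp_mul_shiftOp (ε : ℂ) (α : TimeIdx) (k : ℤ) :
    derivOp ε α * shiftOp k = shiftOp k * derivOp ε α := rfl

theorem derivOp_mul_deltaOp (ε : ℂ) (α : TimeIdx) :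
    derivOp ε α * deltaOp = deltaOp * derivOp ε α := by
  rw [deltaOp, mul_sub, sub_mul, derivOp_mul_shiftOp, mul_one, one_mul]

theorem derivOp_mul_deltaStarOp (ε : ℂ) (α : TimeIdx) :
    derivOp ε α * deltaStarOp = deltaStarOp * derivOp ε α := by
  rw [deltaStarOp, mul_sub, sub_mul, derivOp_mul_shiftOp, mul_one, one_mul]

theorem derivOp_comm (ε : ℂ) (α β : TimeIdx) :
    derivOp ε α * derivOp ε β = derivOp ε β * derivOp ε α := by
  ext f s : 2
  simp [pderiv_comm α β]

theorem mulOp_mul (c d : Fn) : mulOp (c * d) = mulOp c * mulOp d := by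
  ext f s : 2
  simp [mul_assoc]

theorem mulOp_one : mulOp 1 = 1 := by
  ext f s : 2
  simp

end Toda
end

noncomputable section

namespace Toda

/-! ### Series with one-sided support and their pairing -/

/-- `v n = 0` for all large `η n`. -/
def BddSide (η : ℤ) (v : Fn) : Prop := ∃ N : ℤ, ∀ n, N < η * n → v n = 0

namespace BddSide

variable {η : ℤ} {v w : Fn}

theorem zero : BddSide η 0 := ⟨0, fun _ _ => rfl⟩

theorem add (hv : BddSide η v) (hw : BddSide η w) : BddSide η (v + w) := by
  obtain ⟨N, hN⟩ := hv
  obtain ⟨M, hM⟩ := hw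
  exact ⟨max N M, fun n hn => by
    rw [Pi.add_apply, hN n (by omega), hM n (by omega), add_zero]⟩

theorem smul (c : Times) (hv : BddSide η v) : BddSide η (c • v) := by
  obtain ⟨N, hN⟩ := hv
  exact ⟨N, fun n hn => by rw [Pi.smul_apply, hN n hn, smul_zero]⟩

theorem neg (hv : BddSide η v) : BddSide η (-v) := by
  obtain ⟨N, hN⟩ := hv
  exact ⟨N, fun n hn => by rw [Pi.neg_apply, hN n hn, neg_zero]⟩

theorem sub (hv : BddSide η v) (hw : BddSide η w) : BddSide η (v - w) := by
  rw [sub_eq_add_neg]; exact hv.add hw.neg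

theorem sum {ι : Type*} (t : Finset ι) {F : ι → Fn} (h : ∀ i ∈ t, BddSide η (F i)) :
    BddSide η (∑ i ∈ t, F i) := by
  classical
  induction t using Finset.induction_on with
  | empty => exact zero
  | insert i t hi ih =>
    rw [Finset.sum_insert hi]
    exact (h i (by simp)).add (ih fun j hj => h j (by simp [hj]))

theorem derivOp (ε : ℂ) (α : TimeIdx) (hv : BddSide η v) : BddSide η (derivOp ε α v) := by
  obtain ⟨N, hN⟩ := hv
  exact ⟨N, fun n hn => by rw [derivOp_apply, hN n hn, map_zero, smul_zero]⟩

theorem shiftOp (k : ℤ) (hv : BddSide η v) : BddSide η (shiftOp k v) := by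
  obtain ⟨N, hN⟩ := hv
  exact ⟨N - η * k, fun n hn => by rw [shiftOp_apply, hN _ (by rw [mul_add]; omega)]⟩

theorem finite_support (hη : η = 1 ∨ η = -1) (hv : BddSide η v) (hw : BddSide (-η) w) :
    (Function.support fun n => v n * w n).Finite := by
  obtain ⟨N, hN⟩ := hv
  obtain ⟨M, hM⟩ := hw
  refine (Set.finite_Icc (min (-M) (-N)) (max M N)).subset fun n hn => ?_
  by_contra h
  refine hn ?_
  rw [Set.mem_Icc] at h
  by_cases h1 : N < η * n
  · simp only [hN n h1, zero_mul]
  · have h2 : M < -η * n := by rcases hη with rfl | rfl <;> omega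
    simp only [hM n h2, mul_zero]

end BddSide

/-- `∑_n v_n w_n`. -/
def pair (v w : Fn) : Times := ∑ᶠ n : ℤ, v n * w n

theorem pair_add_left {η : ℤ} (hη : η = 1 ∨ η = -1)
    {v v' w : Fn} (hv : BddSide η v) (hv' : BddSide η v')
    (hw : BddSide (-η) w) : pair (v + v') w = pair v w + pair v' w := by
  rw [pair, pair, pair, ← finsum_add_distrib (hv.finite_support hη hw) (hv'.finite_support hη hw)]
  simp only [Pi.add_apply, add_mul]

theorem pair_add_right {η : ℤ} (hη : η = 1 ∨ η = -1)
    {v w w' : Fn} (hv : BddSide η v) (hw : BddSide (-η) w)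
    (hw' : BddSide (-η) w') : pair v (w + w') = pair v w + pair v w' := by
  rw [pair, pair, pair, ← finsum_add_distrib (hv.finite_support hη hw) (hv.finite_support hη hw')]
  simp only [Pi.add_apply, mul_add]

theorem pair_smul_left (c : Times) (v w : Fn) : pair (c • v) w = c * pair v w := by
  rw [pair, pair, mul_finsum]
  simp only [Pi.smul_apply, smul_eq_mul, mul_assoc]

theorem pair_comm (v w : Fn) : pair v w = pair w v := by
  simp only [pair, mul_comm]

theorem pair_smul_right (c : Times) (v w : Fn) : pair v (c • w) = c * pair v w := by
  rw [pair_comm, pair_smul_left, pair_comm]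

theorem pair_zero_left (w : Fn) : pair 0 w = 0 := by simp [pair]

theorem pair_zero_right (w : Fn) : pair w 0 = 0 := by simp [pair]

theorem pair_neg_left (v w : Fn) : pair (-v) w = -pair v w := by
  rw [← neg_one_smul Times v, pair_smul_left, neg_one_mul]

theorem pair_sub_left {η : ℤ} (hη : η = 1 ∨ η = -1)
    {v v' w : Fn} (hv : BddSide η v) (hv' : BddSide η v')
    (hw : BddSide (-η) w) : pair (v - v') w = pair v w - pair v' w := by
  rw [sub_eq_add_neg, pair_add_left hη hv hv'.neg hw, pair_neg_left, sub_eq_add_neg]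

theorem pair_sum_left {η : ℤ} (hη : η = 1 ∨ η = -1)
    {ι : Type*} (t : Finset ι) {F : ι → Fn} {w : Fn}
    (h : ∀ i ∈ t, BddSide η (F i)) (hw : BddSide (-η) w) :
    pair (∑ i ∈ t, F i) w = ∑ i ∈ t, pair (F i) w := by
  classical
  induction t using Finset.induction_on with
  | empty => exact pair_zero_left w
  | insert i t hi ih =>
    have h' : ∀ j ∈ t, BddSide η (F j) := fun j hj => h j (by simp [hj])
    rw [Finset.sum_insert hi, Finset.sum_insert hi,
      pair_add_left hη (h i (by simp)) (BddSide.sum t h') hw, ih h']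

theorem pair_shiftOp_left (k : ℤ) (v w : Fn) : pair (shiftOp k v) w = pair v (shiftOp (-k) w) := by
  rw [pair, pair, ← finsum_comp_equiv (Equiv.addRight (-k))]
  simp

theorem derivOp_pair {η : ℤ} (hη : η = 1 ∨ η = -1)
    (ε : ℂ) (α : TimeIdx) {v w : Fn} (hv : BddSide η v) (hw : BddSide (-η) w) :
    ε • MvPowerSeries.pderiv ℂ α (pair v w) =
      pair (derivOp ε α v) w + pair v (derivOp ε α w) := by
  rw [pair, map_finsum _ (hv.finite_support hη hw), smul_finsum, pair, pair,
    ← finsum_add_distrib ((hv.derivOp ε α).finite_support hη hw)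
      (hv.finite_support hη (hw.derivOp ε α))]
  refine finsum_congr fun n => ?_
  simp only [derivOp_apply, Derivation.leibniz, smul_eq_mul, smul_add, mul_comm,
    mul_smul_comm]
  rw [add_comm]

/-- Evaluation of a pairing of two series with complementary one-sided supports. -/
theorem pair_eq_single {η : ℤ} (hη : η = 1 ∨ η = -1) {v w : Fn} {N M : ℤ}
    (hv : ∀ n, 0 < η * (n - N) → v n = 0) (hw : ∀ n, 0 < η * (M - n) → w n = 0)
    (h : 0 ≤ η * (M - N)) : pair v w = v N * w N := by
  refine finsum_eq_single _ N fun n hn => ?_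
  by_cases h1 : 0 < η * (n - N)
  · rw [hv n h1, zero_mul]
  · rw [hw n (by rcases hη with rfl | rfl <;> omega), mul_zero]

theorem pair_eq_zero {η : ℤ} (hη : η = 1 ∨ η = -1) {v w : Fn} {N M : ℤ}
    (hv : ∀ n, 0 < η * (n - N) → v n = 0) (hw : ∀ n, 0 < η * (M - n) → w n = 0)
    (h : 0 < η * (M - N)) : pair v w = 0 := by
  rw [pair_eq_single hη hv hw h.le, hw N h, mul_zero]

/-! ### Triangular arrays -/

/-- The action of an operator on an array, column by column. -/
def colAct (A : FnEnd) (P : ℤ → Fn) : ℤ → Fn := fun s n => A (fun s => P s n) s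

theorem colAct_bandOp (a : ℤ →₀ Fn) (P : ℤ → Fn) (s : ℤ) :
    colAct (bandOp a) P s = ∑ i ∈ a.support, a i s • P (s + i) := by
  funext n
  rw [colAct, bandOp_apply, Finset.sum_apply]
  rfl

theorem colAct_mul (A B : FnEnd) (P : ℤ → Fn) : colAct (A * B) P = colAct A (colAct B P) := rfl

theorem colAct_add (A B : FnEnd) (P : ℤ → Fn) : colAct (A + B) P = colAct A P + colAct B P := rfl

theorem colAct_sub (A B : FnEnd) (P : ℤ → Fn) : colAct (A - B) P = colAct A P - colAct B P := rfl

/-- Triangular arrays with nonzero diagonal. -/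
structure IsTriangular (η : ℤ) (P : ℤ → Fn) : Prop where
  eq_zero : ∀ s n, 0 < η * (n - s) → P s n = 0
  diag : ∀ s, P s s ≠ 0

theorem IsTriangular.bddSide {η : ℤ} {P : ℤ → Fn} (hP : IsTriangular η P) (s : ℤ) :
    BddSide η (P s) := ⟨η * s, fun n hn => hP.eq_zero s n (by rw [mul_sub]; omega)⟩

theorem bddSide_colAct {η : ℤ} {A A' : FnEnd} (hA : IsBand A A') {P : ℤ → Fn}
    (hP : ∀ s, BddSide η (P s)) (s : ℤ) : BddSide η (colAct A P s) := by
  obtain ⟨a, rfl, rfl⟩ := hA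
  rw [colAct_bandOp]
  exact BddSide.sum _ fun i _ => (hP _).smul _

/-- The extremal coefficients of a banded operator are determined by its action on a triangular
array. -/
theorem coeff_eq_zero_of_colAct {η : ℤ} (hη : η = 1 ∨ η = -1) {P : ℤ → Fn}
    (hP : IsTriangular η P) (a : ℤ →₀ Fn) (d s : ℤ)
    (h : ∀ n, 0 < η * (n - s - d) → colAct (bandOp a) P s n = 0) (i : ℤ) (hi : 0 < η * (i - d)) :
    a i s = 0 := by
  classical
  by_contra hne
  obtain ⟨k, hk, hmax⟩ := Finset.exists_max_image
    (a.support.filter fun i => 0 < η * (i - d) ∧ a i s ≠ 0) (fun i => η * i)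
    ⟨i, by
      rw [Finset.mem_filter, Finsupp.mem_support_iff]
      exact ⟨fun h0 => hne (by rw [h0]; rfl), hi, hne⟩⟩
  rw [Finset.mem_filter] at hk
  have h1 := h (s + k) (by rw [show s + k - s - d = k - d by ring]; exact hk.2.1)
  rw [colAct_bandOp, Finset.sum_apply, Finset.sum_eq_single k] at h1
  · exact (mul_ne_zero hk.2.2 (hP.diag _)) h1
  · intro j hj hjk
    rw [Pi.smul_apply, smul_eq_mul]
    by_cases hjk' : 0 < η * (j - k)
    · have : a j s = 0 := by
        by_contra hj0
        have := hmax j (by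
          rw [Finset.mem_filter]
          exact ⟨hj, by rcases hη with rfl | rfl <;> omega, hj0⟩)
        rcases hη with rfl | rfl <;> omega
      rw [this, zero_mul]
    · rw [hP.eq_zero _ _ (by rcases hη with rfl | rfl <;> omega), mul_zero]
  · exact fun hk' => absurd hk.1 hk'

/-- In column `s + d` the terms beyond `d` have zero coefficients and the terms before `d` meet the
zero part of the array, so the extremal coefficient can be read off. -/
theorem coeff_mul_diag_of_colAct {η : ℤ} (hη : η = 1 ∨ η = -1) {P : ℤ → Fn}
    (hP : IsTriangular η P) (a : ℤ →₀ Fn) (d s : ℤ)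
    (h : ∀ n, 0 < η * (n - s - d) → colAct (bandOp a) P s n = 0) :
    a d s * P (s + d) (s + d) = colAct (bandOp a) P s (s + d) := by
  rw [colAct_bandOp, Finset.sum_apply, Finset.sum_eq_single d]
  · rfl
  · intro j hj hjd
    rw [Pi.smul_apply, smul_eq_mul]
    by_cases hjk' : 0 < η * (j - d)
    · rw [coeff_eq_zero_of_colAct hη hP a d s h j hjk', zero_mul]
    · rw [hP.eq_zero _ _ (by rcases hη with rfl | rfl <;> omega), mul_zero]
  · intro hd
    rw [Finsupp.notMem_support_iff.mp hd]
    simp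

/-- When the whole action vanishes, the bound in `coeff_eq_zero_of_colAct` may be placed just short
of any index. Thus a single wave array determines a banded operator. -/
theorem IsBand.eq_zero_of_colAct {η : ℤ} (hη : η = 1 ∨ η = -1) {P : ℤ → Fn}
    (hP : IsTriangular η P) {A A' : FnEnd} (hA : IsBand A A') (h : colAct A P = 0) : A = 0 := by
  obtain ⟨a, rfl, rfl⟩ := hA
  have : a = 0 := by
    ext i s : 2
    refine coeff_eq_zero_of_colAct hη hP a (i - η) s (fun n _ => by rw [h]; rfl) i ?_
    rcases hη with rfl | rfl <;> omega
  rw [this, map_zero]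

theorem IsBand.eq_of_colAct {η : ℤ} (hη : η = 1 ∨ η = -1) {P : ℤ → Fn}
    (hP : IsTriangular η P) {A A' B B' : FnEnd} (hA : IsBand A A') (hB : IsBand B B')
    (h : colAct A P = colAct B P) : A = B :=
  sub_eq_zero.mp ((hA.sub hB).eq_zero_of_colAct hη hP (by rw [colAct_sub, h, sub_self]))

/-- A series that pairs to zero with all rows of a triangular array vanishes. -/
theorem eq_zero_of_pair {η : ℤ} (hη : η = 1 ∨ η = -1) {P : ℤ → Fn} (hP : IsTriangular η P)
    {w : Fn} (hw : BddSide (-η) w) (h : ∀ s, pair (P s) w = 0) : w = 0 := by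
  obtain ⟨N, hN⟩ := hw
  -- The triangular system is solved from the extreme column inwards: row `n` of the array reaches
  -- `w n` and otherwise only entries already known to vanish.
  have key : ∀ k : ℕ, ∀ n, -(η * n) = N - k → w n = 0 := by
    intro k
    induction k using Nat.strong_induction_on with
    | _ k ih =>
      intro n hn
      have h1 := h n
      rw [pair_eq_single hη (hP.eq_zero n) (M := n) ?_ (by simp)] at h1
      · exact (mul_eq_zero.mp h1).resolve_left (hP.diag n)
      · intro m hm
        by_cases hmN : N < -η * m
        · exact hN m hmN
        · refine ih (N + η * m).toNat ?_ m ?_ <;> rcases hη with rfl | rfl <;> omega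
  funext n
  by_cases hn : N < -η * n
  · exact hN n hn
  · refine key (N + η * n).toNat n ?_
    rw [neg_mul] at hn
    omega

end Toda
end

noncomputable section

namespace Toda

/-! ### Wave amplitudes and their evolution -/

/-- The direction of expansion of the `j`-th wave function. -/
def sgn (j : Fin 2) : ℤ := if j = 0 then 1 else -1

theorem sgn_or (j : Fin 2) : sgn j = 1 ∨ sgn j = -1 := by
  unfold sgn; split_ifs <;> simp

theorem neg_sgn_or (j : Fin 2) : -sgn j = 1 ∨ -sgn j = -1 := by
  unfold sgn; split_ifs <;> simp

/-- The amplitude of the `j`-th wave function, for times of sign `ε`: the coefficient of `z ^ n`. -/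
def wave (ε : ℂ) (τ : Fn) (j : Fin 2) (s : ℤ) : Fn := fun n =>
  if 0 ≤ sgn j * (s - n) then
    timeShift j (-ε) (sgn j * (s - n)).toNat (τ (s + (j : ℕ))) * (τ s)⁻¹
  else 0

/-- The amplitude of the `j`-th adjoint wave function: the coefficient of `z ^ (-n)`. -/
def dual (ε : ℂ) (τ : Fn) (j : Fin 2) (s : ℤ) : Fn := fun n =>
  wave (-ε) (fun s => τ (-s)) j (-s - 1) (-n - 1)

/-- `ε ∂_α` on the amplitudes of the `j`-th wave function. -/
def nabla (ε : ℂ) (j : Fin 2) (α : TimeIdx) : FnEnd :=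
  derivOp ε α + if α.1 = j then shiftOp (-(sgn j * (α.2 : ℕ))) else 0

theorem NonvanishingAtZero.mul_inv {f : Fn} (hf : NonvanishingAtZero f) (s : ℤ) :
    f s * (f s)⁻¹ = 1 := MvPowerSeries.mul_inv_cancel _ (hf s)

theorem NonvanishingAtZero.inv_mul {f : Fn} (hf : NonvanishingAtZero f) (s : ℤ) :
    (f s)⁻¹ * f s = 1 := MvPowerSeries.inv_mul_cancel _ (hf s)

theorem NonvanishingAtZero.ne_zero {f : Fn} (hf : NonvanishingAtZero f) (s : ℤ) : f s ≠ 0 :=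
  fun h => hf s (by rw [h, map_zero])

theorem NonvanishingAtZero.inv_ne_zero {f : Fn} (hf : NonvanishingAtZero f) (s : ℤ) :
    (f s)⁻¹ ≠ 0 := fun h => by
  have := hf.mul_inv s
  rw [h, mul_zero] at this
  exact zero_ne_one this

theorem NonvanishingAtZero.comp_neg {f : Fn} (hf : NonvanishingAtZero f) :
    NonvanishingAtZero fun s => f (-s) := fun s => hf (-s)

theorem wave_self (ε : ℂ) (τ : Fn) (j : Fin 2) (s : ℤ) :
    wave ε τ j s s = τ (s + (j : ℕ)) * (τ s)⁻¹ := by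
  simp [wave, timeShift_zero]

theorem isTriangular_wave (ε : ℂ) {τ : Fn} (hτ : NonvanishingAtZero τ) (j : Fin 2) :
    IsTriangular (sgn j) (wave ε τ j) where
  eq_zero s n h := if_neg (by rcases sgn_or j with h' | h' <;> rw [h'] at h ⊢ <;> omega)
  diag s := by
    rw [wave_self]
    exact mul_ne_zero (hτ.ne_zero _) (hτ.inv_ne_zero _)

theorem isTriangular_dual (ε : ℂ) {τ : Fn} (hτ : NonvanishingAtZero τ) (j : Fin 2) :
    IsTriangular (-sgn j) (dual ε τ j) where
  eq_zero s n h := (isTriangular_wave (-ε) hτ.comp_neg j).eq_zero _ _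
    (by rcases sgn_or j with h' | h' <;> rw [h'] at h ⊢ <;> omega)
  diag s := (isTriangular_wave (-ε) hτ.comp_neg j).diag _

theorem dual_self (ε : ℂ) (τ : Fn) (j : Fin 2) (s : ℤ) :
    dual ε τ j s s = τ (s + 1 - (j : ℕ)) * (τ (s + 1))⁻¹ := by
  rw [dual, wave_self, show -(-s - 1) = s + 1 by ring,
    show -(-s - 1 + ((j : ℕ) : ℤ)) = s + 1 - (j : ℕ) by ring]

theorem bddSide_nabla {η : ℤ} {v : Fn} (ε : ℂ) (j : Fin 2) (α : TimeIdx) (hv : BddSide η v) :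
    BddSide η (nabla ε j α v) := by
  rw [nabla, LinearMap.add_apply]
  refine (hv.derivOp ε α).add ?_
  split_ifs
  · exact hv.shiftOp _
  · exact BddSide.zero

/-- A solution of the Toda hierarchy in the time directions of sign `ε`: the wave amplitudes
evolve by difference operators, and the adjoint wave amplitudes are the inverse arrays. -/
structure TodaSys (ε : ℂ) (τ : Fn) (A A' : TimeIdx → FnEnd) : Prop where
  nonvanishing : NonvanishingAtZero τ
  band : ∀ α, IsBand (A α) (A' α)
  evol : ∀ j α s, nabla ε j α (wave ε τ j s) = colAct (A α) (wave ε τ j) s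
  orth : ∀ j s s', pair (wave ε τ j s) (dual ε τ j s') = if s = s' then 1 else 0

/-- Solutions of the linear problem. -/
def IsEig (ε : ℂ) (A : TimeIdx → FnEnd) (q : Fn) : Prop := ∀ α, derivOp ε α q = A α q

/-! ### The adjoint symmetry -/

/-- `(J f)(s) = f(-s-1)`. -/
def flipOp : FnEnd := LinearMap.funLeft ℂ Times fun s => -s - 1

@[simp] theorem flipOp_apply (f : Fn) (s : ℤ) : flipOp f s = f (-s - 1) := rfl

theorem flipOp_mul_flipOp : flipOp * flipOp = 1 := by
  ext f s : 2
  simp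

theorem flipOp_flipOp (f : Fn) : flipOp (flipOp f) = f := LinearMap.congr_fun flipOp_mul_flipOp f

/-- The reflection inverts `Λ` and so does the adjoint; the two together again give a banded
operator with its adjoint. -/
theorem IsBand.flip {A A' : FnEnd} (h : IsBand A A') :
    IsBand (flipOp * A' * flipOp) (flipOp * A * flipOp) := by
  refine IsBand.induction (p := fun A A' => IsBand (flipOp * A' * flipOp) (flipOp * A * flipOp))
    ?_ ?_ ?_ h
  · simpa using IsBand.zero
  · intro A A' B B' h h'
    convert h.add h' using 1 <;> noncomm_ring
  · intro i c
    refine ⟨Finsupp.single i fun s => c (-s - 1 - i), ?_, ?_⟩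
    · ext f s : 2
      simp only [bandOp_single, Module.End.mul_apply, flipOp_apply, shiftOp_apply, mulOp_apply]
      rw [show -(-s - 1 + -i) - 1 = s + i by ring, sub_eq_add_neg (-s - 1)]
    · ext f s : 2
      simp only [bandAdj_single, Module.End.mul_apply, flipOp_apply, shiftOp_apply, mulOp_apply]
      rw [show -(-s - 1 + i) - 1 = s + -i by ring, show -(s + -i) - 1 - i = -s - 1 by ring]

theorem pair_flipOp (v w : Fn) : pair (flipOp v) (flipOp w) = pair v w := by
  rw [pair, pair, ← finsum_comp_equiv (Equiv.subLeft (-1 : ℤ))]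
  refine finsum_congr fun n => ?_
  simp only [flipOp_apply, Equiv.subLeft_apply]
  rw [show -(-1 - n) - 1 = n by ring]

theorem dual_eq_flipOp (ε : ℂ) (τ : Fn) (j : Fin 2) (s : ℤ) :
    dual ε τ j s = flipOp (wave (-ε) (fun s => τ (-s)) j (-s - 1)) := rfl

theorem derivOp_neg (ε : ℂ) (α : TimeIdx) : derivOp (-ε) α = -derivOp ε α := by
  ext f s : 2
  simp

theorem bddSide_colAct_adj {η : ℤ} {A A' : FnEnd} (hA : IsBand A A') {Q : ℤ → Fn}
    (hQ : ∀ s, BddSide η (Q s)) (s : ℤ) : BddSide η (colAct A' Q s) := by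
  obtain ⟨a, -, rfl⟩ := hA
  have : colAct (bandAdj a) Q s = ∑ i ∈ a.support, a i (s - i) • Q (s - i) := by
    funext n
    rw [colAct, bandAdj_apply, Finset.sum_apply]
    rfl
  rw [this]
  exact BddSide.sum _ fun i _ => (hQ _).smul _

/-- For `c Λ ^ i` both sides are nonzero only if `s + i = s'`, and there both equal `c s`;
biorthogonality replaces any summation by parts. -/
theorem IsBand.pair_colAct {A A' : FnEnd} (hA : IsBand A A') {η : ℤ} (hη : η = 1 ∨ η = -1)
    {P Q : ℤ → Fn} (hP : ∀ s, BddSide η (P s)) (hQ : ∀ s, BddSide (-η) (Q s))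
    (h : ∀ s s', pair (P s) (Q s') = if s = s' then 1 else 0) (s s' : ℤ) :
    pair (colAct A P s) (Q s') = pair (P s) (colAct A' Q s') := by
  refine IsBand.induction (p := fun A A' => IsBand A A' ∧
    pair (colAct A P s) (Q s') = pair (P s) (colAct A' Q s')) ?_ ?_ ?_ hA |>.2
  · exact ⟨IsBand.zero, (pair_zero_left _).trans (pair_zero_right _).symm⟩
  · rintro A A' B B' ⟨hA, h1⟩ ⟨hB, h2⟩
    refine ⟨hA.add hB, ?_⟩
    have hA' := bddSide_colAct_adj hA hQ s'
    have hB' := bddSide_colAct_adj hB hQ s'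
    rw [colAct_add, colAct_add, Pi.add_apply, Pi.add_apply,
      pair_add_left hη (bddSide_colAct hA hP s) (bddSide_colAct hB hP s) (hQ s'),
      pair_add_right hη (hP s) hA' hB', h1, h2]
  · intro i c
    refine ⟨(IsBand.mulOp c).mul (IsBand.shiftOp i), ?_⟩
    have h1 : colAct (Toda.mulOp c * Toda.shiftOp i) P s = c s • P (s + i) := rfl
    have h2 : colAct (Toda.shiftOp (-i) * Toda.mulOp c) Q s' = c (s' + -i) • Q (s' + -i) := rfl
    rw [h1, h2, pair_smul_left, pair_smul_right, h, h]
    by_cases hs : s + i = s'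
    · rw [if_pos hs, if_pos (by omega), show s = s' + -i by omega]
    · rw [if_neg hs, if_neg (by omega), mul_zero, mul_zero]

/-- Orthogonality is symmetric under the exchange of waves and adjoint waves. Differentiating it
determines the evolution of the adjoint rows by `-A^*`, and the reversed sign of `ε` makes this an
evolution of waves again. -/
theorem TodaSys.dagger {ε : ℂ} {τ : Fn} {A A' : TimeIdx → FnEnd} (h : TodaSys ε τ A A') :
    TodaSys (-ε) (fun s => τ (-s)) (fun α => flipOp * A' α * flipOp)
      (fun α => flipOp * A α * flipOp) where
  nonvanishing := h.nonvanishing.comp_neg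
  band α := (h.band α).flip
  orth j s s' := by
    have h1 : dual (-ε) (fun s => τ (-s)) j s' = flipOp (wave ε τ j (-s' - 1)) := by
      rw [dual_eq_flipOp]
      simp only [neg_neg]
    have h2 : wave (-ε) (fun s => τ (-s)) j s = flipOp (dual ε τ j (-s - 1)) := by
      rw [dual_eq_flipOp, flipOp_flipOp]
      simp
    rw [h1, h2, pair_flipOp, pair_comm, h.orth]
    by_cases hs : s = s'
    · rw [if_pos hs, if_pos (by omega)]
    · rw [if_neg hs, if_neg (by omega)]
  evol j α s := by
    have hη := sgn_or j
    have hP := fun s => (isTriangular_wave ε h.nonvanishing j).bddSide s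
    have hQ := fun s => (isTriangular_dual ε h.nonvanishing j).bddSide s
    set σ : FnEnd := if α.1 = j then shiftOp (-(sgn j * (α.2 : ℕ))) else 0 with hσ
    set σ' : FnEnd := if α.1 = j then shiftOp (sgn j * (α.2 : ℕ)) else 0 with hσ'
    have hQA := bddSide_colAct_adj (h.band α) hQ
    have hσQ : ∀ s', BddSide (-sgn j) (σ' (dual ε τ j s')) := fun s' => by
      rw [hσ']; split_ifs
      · exact (hQ s').shiftOp _
      · exact BddSide.zero
    have hσP : ∀ s, BddSide (sgn j) (σ (wave ε τ j s)) := fun s => by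
      rw [hσ]; split_ifs
      · exact (hP s).shiftOp _
      · exact BddSide.zero
    -- The left side pairs to zero with every wave row, by the derivative of the orthogonality
    -- relation, so it vanishes by triangularity. `σ'` is the transpose of the multiplication by a
    -- power of `z` contained in `nabla`.
    have key : ∀ s', derivOp ε α (dual ε τ j s') + colAct (A' α) (dual ε τ j) s'
        - σ' (dual ε τ j s') = 0 := by
      intro s'
      refine eq_zero_of_pair hη (isTriangular_wave ε h.nonvanishing j)
        ((((hQ s').derivOp ε α).add (hQA s')).sub (hσQ s')) fun s => ?_
      have h1 := derivOp_pair hη ε α (hP s) (hQ s')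
      have h2 : pair (σ (wave ε τ j s)) (dual ε τ j s') =
          pair (wave ε τ j s) (σ' (dual ε τ j s')) := by
        rw [hσ, hσ']
        split_ifs
        · rw [pair_shiftOp_left, neg_neg]
        · rw [LinearMap.zero_apply, LinearMap.zero_apply, pair_zero_left, pair_zero_right]
      have h3 : derivOp ε α (wave ε τ j s) =
          colAct (A α) (wave ε τ j) s - σ (wave ε τ j s) := by
        rw [← h.evol j α s, nabla, LinearMap.add_apply, add_sub_cancel_right]
      rw [h.orth, h3, pair_sub_left hη (bddSide_colAct (h.band α) hP s) (hσP s) (hQ s'), h2,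
        (h.band α).pair_colAct hη hP hQ (h.orth j)] at h1
      rw [sub_eq_add_neg, pair_add_right hη (hP s) (((hQ s').derivOp ε α).add (hQA s'))
        (hσQ s').neg, pair_add_right hη (hP s) ((hQ s').derivOp ε α) (hQA s'),
        pair_comm _ (-_), pair_neg_left, pair_comm (σ' _)]
      have h4 : ε • MvPowerSeries.pderiv ℂ α (if s = s' then (1 : Times) else 0) = 0 := by
        split_ifs
        · rw [MvPowerSeries.pderiv_one, smul_zero]
        · rw [map_zero, smul_zero]
      rw [h4] at h1
      rw [h1]
      ring
    have hw : ∀ s, wave (-ε) (fun s => τ (-s)) j s = flipOp (dual ε τ j (-s - 1)) := by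
      intro s
      rw [dual_eq_flipOp, flipOp_flipOp]
      simp
    have hc : colAct (flipOp * A' α * flipOp) (wave (-ε) (fun s => τ (-s)) j) s =
        flipOp (colAct (A' α) (dual ε τ j) (-s - 1)) := by
      funext n
      have h1 : flipOp (fun s => wave (-ε) (fun s => τ (-s)) j s n) =
          fun s => dual ε τ j s (-n - 1) := by
        funext s
        rw [flipOp_apply, hw, flipOp_apply]
        ring_nf
      simp only [colAct, Module.End.mul_apply, flipOp_apply, h1]
    have hn : nabla (-ε) j α (wave (-ε) (fun s => τ (-s)) j s) =
        flipOp (-derivOp ε α (dual ε τ j (-s - 1)) + σ' (dual ε τ j (-s - 1))) := by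
      rw [nabla, hw, LinearMap.add_apply, map_add, derivOp_neg, hσ']
      congr 1
      split_ifs
      · ext1 n
        simp only [shiftOp_apply, flipOp_apply]
        rw [show -(n + -(sgn j * ((α.2 : ℕ) : ℤ))) - 1 = -n - 1 + sgn j * ((α.2 : ℕ) : ℤ) by ring]
      · rfl
    rw [hn, hc]
    rw [← sub_eq_zero, ← map_sub, ← neg_eq_zero, ← map_neg, ← map_zero flipOp, ← key (-s - 1)]
    congr 1
    abel

/-! ### Discrete shifts of the times on wave amplitudes and eigenfunctions -/

/-- The coefficient of `w ^ k` of the shift by `[w]_a` on the amplitudes of the `j`-th wave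
function; the exponential contributes the factor `1 - w z ^ (± 1)` if `a = j`. -/
def rowShift (ε : ℂ) (j a : Fin 2) (k : ℕ) (v : Fn) : Fn := fun n =>
  timeShift a (-ε) k (v n) -
    if a = j ∧ k ≠ 0 then timeShift a (-ε) (k - 1) (v (n - sgn j)) else 0

theorem sum_range_sub_ite {M : Type*} [AddCommGroup M] (X : ℕ → M) (k : ℕ) :
    ∑ i ∈ Finset.range (k + 1), (X i - if k - i ≠ 0 then X (i + 1) else 0) = X 0 := by
  rw [Finset.sum_range_succ, Finset.sum_congr rfl (g := fun i => X i - X (i + 1)),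
    Finset.sum_range_sub']
  · simp
  · intro i hi
    rw [Finset.mem_range] at hi
    rw [if_pos (by omega)]

/-- The generating series in `w` is a shift operator times `1 - w z ^ (± 1)` when `a = j`. The
logarithmic derivative of this factor is `-∑ w ^ n z ^ (± n)`, which supplies exactly the powers of
`z` in `nabla`. -/
theorem rowShift_succ (ε : ℂ) (j a : Fin 2) (k : ℕ) (v : Fn) :
    ((k : ℂ) + 1) • rowShift ε j a (k + 1) v =
      -∑ i ∈ Finset.range (k + 1), nabla ε j (a, Nat.succPNat i) (rowShift ε j a (k - i) v) := by
  funext n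
  have h1 : ∀ u, ((k : ℂ) + 1) • timeShift a (-ε) (k + 1) u = -∑ i ∈ Finset.range (k + 1),
      ε • MvPowerSeries.pderiv ℂ (a, Nat.succPNat i) (timeShift a (-ε) (k - i) u) := by
    intro u
    rw [timeShift_succ]
    simp only [neg_smul, Finset.sum_neg_distrib]
  simp only [Pi.smul_apply, Pi.neg_apply, Finset.sum_apply, nabla, LinearMap.add_apply,
    Pi.add_apply, derivOp_apply]
  by_cases haj : a = j
  · subst haj
    have h2 : ∀ u, (k : ℂ) • timeShift a (-ε) k u = -∑ i ∈ Finset.range (k + 1),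
        if k - i ≠ 0 then ε • MvPowerSeries.pderiv ℂ (a, Nat.succPNat i)
          (timeShift a (-ε) (k - i - 1) u) else 0 := by
      intro u
      rw [Finset.sum_range_succ, if_neg (by simp), add_zero]
      rcases k with _ | k
      · simp
      · push_cast
        rw [timeShift_succ, ← Finset.sum_neg_distrib]
        refine Finset.sum_congr rfl fun i hi => ?_
        rw [Finset.mem_range] at hi
        rw [if_pos (by omega), neg_smul, show k + 1 - i - 1 = k - i by omega]
    -- The powers of `z` coming from `nabla` and from the factor `1 - w z ^ (± 1)` telescope; one
    -- term remains, and it completes the second half of `rowShift`.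
    have h3 := sum_range_sub_ite
      (fun i => timeShift a (-ε) (k - i) (v (n - sgn a * ((i : ℤ) + 1)))) k
    have h4 : ∀ i ∈ Finset.range (k + 1),
        ε • MvPowerSeries.pderiv ℂ (a, Nat.succPNat i) (rowShift ε a a (k - i) v n) +
          (if (a, Nat.succPNat i).1 = a then
            shiftOp (-(sgn a * ((a, Nat.succPNat i).2 : ℕ))) else 0)
              (rowShift ε a a (k - i) v) n =
        ε • MvPowerSeries.pderiv ℂ (a, Nat.succPNat i) (timeShift a (-ε) (k - i) (v n)) -
        (if k - i ≠ 0 then ε • MvPowerSeries.pderiv ℂ (a, Nat.succPNat i)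
          (timeShift a (-ε) (k - i - 1) (v (n - sgn a))) else 0) +
        (timeShift a (-ε) (k - i) (v (n - sgn a * ((i : ℤ) + 1))) -
          if k - i ≠ 0 then
            timeShift a (-ε) (k - (i + 1)) (v (n - sgn a * (((i + 1 : ℕ) : ℤ) + 1))) else 0) := by
      intro i _
      rw [if_pos rfl, shiftOp_apply]
      congr 1
      · simp only [rowShift, true_and]
        split_ifs
        · rw [map_sub, smul_sub]
        · rw [sub_zero, sub_zero]
      · simp only [rowShift, true_and, Nat.succPNat_coe, Nat.succ_eq_add_one]
        congr 3
        · push_cast; ring_nf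
    rw [Finset.sum_congr rfl h4, Finset.sum_add_distrib, Finset.sum_sub_distrib, h3]
    rw [rowShift, if_pos ⟨rfl, Nat.succ_ne_zero k⟩, smul_sub, h1, Nat.add_sub_cancel, add_smul,
      h2, one_smul]
    simp only [Nat.sub_zero, Nat.cast_zero, zero_add, mul_one]
    abel
  · simp only [rowShift, haj, false_and, if_false, sub_zero, LinearMap.zero_apply,
      Pi.zero_apply, add_zero]
    exact h1 _

section Core

variable {ε : ℂ} {τ : Fn} {A A' : TimeIdx → FnEnd}

/-- Multiplication by a power of `z` acts on columns and commutes with operators in `s`; only the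
derivative contributes a commutator. -/
theorem nabla_colAct (ε : ℂ) (j : Fin 2) (α : TimeIdx) (G : FnEnd) (P : ℤ → Fn) (s : ℤ) :
    nabla ε j α (colAct G P s) =
      colAct (derivOp ε α * G - G * derivOp ε α) P s + colAct G (fun s => nabla ε j α (P s)) s := by
  funext n
  have h : (fun s => nabla ε j α (P s) n) = derivOp ε α (fun s => P s n) +
      if α.1 = j then (fun s => P s (n + -(sgn j * (α.2 : ℕ)))) else 0 := by
    funext s
    rw [nabla, LinearMap.add_apply]
    split_ifs <;> rfl
  rw [Pi.add_apply]
  simp only [colAct]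
  rw [h, map_add, nabla, LinearMap.add_apply, Pi.add_apply, LinearMap.sub_apply, Pi.sub_apply,
    Pi.add_apply, Module.End.mul_apply, Module.End.mul_apply]
  split_ifs
  · simp only [derivOp_apply, shiftOp_apply]
    abel
  · simp only [derivOp_apply, map_zero, LinearMap.zero_apply, Pi.zero_apply]
    abel

theorem TodaSys.nabla_colAct_wave (h : TodaSys ε τ A A') (j : Fin 2) (α : TimeIdx) (G : FnEnd)
    (s : ℤ) : nabla ε j α (colAct G (wave ε τ j) s) =
      colAct (derivOp ε α * G - G * derivOp ε α + G * A α) (wave ε τ j) s := by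
  rw [nabla_colAct, colAct_add, Pi.add_apply, colAct_mul]
  simp only [h.evol]

/-- The same operator occurs as for waves in `nabla_colAct_wave`. The shifts of eigenfunctions and
of waves therefore obey one operator recursion. -/
theorem IsEig.derivOp_apply_band {q : Fn} (hq : IsEig ε A q) (α : TimeIdx) (G : FnEnd) :
    derivOp ε α (G q) = (derivOp ε α * G - G * derivOp ε α + G * A α) q := by
  simp only [LinearMap.add_apply, LinearMap.sub_apply, Module.End.mul_apply, hq α]
  abel

/-- A shift of the times acts on the wave amplitudes and on eigenfunctions by one and the same
difference operator. -/
theorem TodaSys.exists_band_timeShift (h : TodaSys ε τ A A') (a : Fin 2) (k : ℕ) :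
    ∃ G G', IsBand G G' ∧
      (∀ j s, colAct G (wave ε τ j) s = rowShift ε j a k (wave ε τ j s)) ∧
      ∀ q, IsEig ε A q → ∀ s, timeShift a (-ε) k (q s) = G q s := by
  induction k using Nat.strong_induction_on with
  | _ k ih =>
    rcases k with _ | k
    · refine ⟨1, 1, IsBand.one, fun j s => ?_, fun q _ s => ?_⟩
      · funext n
        simp [colAct, rowShift, timeShift_zero]
      · simp [timeShift_zero]
    · have hk : ((k : ℂ) + 1) ≠ 0 := by exact_mod_cast Nat.succ_ne_zero k
      choose! G G' hG hP hq using ih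
      set α : ℕ → TimeIdx := fun i => (a, Nat.succPNat i) with hα
      -- `H i` represents the derivative of the shift of order `k - i`; the recursion then forces
      -- the next operator to be `-(k + 1)⁻¹ ∑ H i`.
      set H : ℕ → FnEnd := fun i => derivOp ε (α i) * G (k - i) - G (k - i) * derivOp ε (α i) +
        G (k - i) * A (α i) with hH
      have hband : IsBand (mulOp (fun _ => MvPowerSeries.C (-((k : ℂ) + 1)⁻¹)) *
          ∑ i ∈ Finset.range (k + 1), H i) _ :=
        (IsBand.mulOp _).mul (IsBand.sum _ fun i _ =>
          ((hG (k - i) (by omega)).commutator_derivOp ε (α i)).add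
            ((hG (k - i) (by omega)).mul (h.band (α i))))
      refine ⟨_, _, hband, fun j s => ?_, fun q hqe s => ?_⟩
      · have h1 := rowShift_succ ε j a k (wave ε τ j s)
        have h2 : ∀ i ∈ Finset.range (k + 1),
            nabla ε j (α i) (rowShift ε j a (k - i) (wave ε τ j s)) =
              colAct (H i) (wave ε τ j) s := by
          intro i _
          rw [← hP (k - i) (by omega), h.nabla_colAct_wave]
        rw [Finset.sum_congr rfl h2] at h1
        funext n
        have h3 := congrFun h1 n
        rw [Pi.smul_apply, Pi.neg_apply, Finset.sum_apply] at h3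
        rw [← inv_smul_smul₀ hk (rowShift ε j a (k + 1) (wave ε τ j s) n), h3]
        simp only [colAct, Module.End.mul_apply, mulOp_apply, LinearMap.sum_apply,
          Finset.sum_apply]
        rw [← MvPowerSeries.smul_eq_C_mul, neg_smul, smul_neg]
      · have h1 := timeShift_succ a (-ε) k (q s)
        have h2 : ∀ i ∈ Finset.range (k + 1),
            (-ε) • MvPowerSeries.pderiv ℂ (a, Nat.succPNat i) (timeShift a (-ε) (k - i) (q s)) =
              -(H i q s) := by
          intro i _
          have h3 := congrFun (hqe.derivOp_apply_band (α i) (G (k - i))) s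
          rw [derivOp_apply, ← hq (k - i) (by omega) q hqe s] at h3
          rw [neg_smul, h3]
        rw [Finset.sum_congr rfl h2] at h1
        rw [← inv_smul_smul₀ hk (timeShift a (-ε) (k + 1) (q s)), h1]
        simp only [Module.End.mul_apply, mulOp_apply, LinearMap.sum_apply, Finset.sum_apply]
        rw [← MvPowerSeries.smul_eq_C_mul, Finset.sum_neg_distrib, neg_smul, smul_neg]

end Core

end Toda
end

noncomputable section

namespace Toda

/-! ### Closed one-forms in infinitely many times -/

theorem exists_coeff_eq {σ : Type} (F : (σ →₀ ℕ) → ℂ) :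
    ∃ f : MvPowerSeries σ ℂ, ∀ d, MvPowerSeries.coeff d f = F d := ⟨F, fun _ => rfl⟩

/-- The Poincaré lemma for formal power series. -/
theorem exists_pderiv_eq {σ : Type} (F : σ → MvPowerSeries σ ℂ)
    (hF : ∀ i j, MvPowerSeries.pderiv ℂ i (F j) = MvPowerSeries.pderiv ℂ j (F i)) :
    ∃ Ω : MvPowerSeries σ ℂ, ∀ i, MvPowerSeries.pderiv ℂ i Ω = F i := by
  classical
  have hne : ∀ d : σ →₀ ℕ, d ≠ 0 → ∃ i, d i ≠ 0 := fun d hd => by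
    by_contra h
    exact hd (Finsupp.ext fun i => by_contra fun hi => h ⟨i, hi⟩)
  rcases isEmpty_or_nonempty σ with _ | _
  · exact ⟨0, isEmptyElim⟩
  -- Each coefficient of the potential is obtained by integrating in one chosen variable of its
  -- monomial. Closedness, used in `key`, makes the choice irrelevant.
  choose! c hc using hne
  obtain ⟨Ω, hΩ⟩ := exists_coeff_eq fun d => if d = 0 then 0 else
    MvPowerSeries.coeff (d - Finsupp.single (c d) 1) (F (c d)) / (d (c d) : ℂ)
  have key : ∀ (e : σ →₀ ℕ) (i : σ), e i ≠ 0 →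
      MvPowerSeries.coeff e Ω * (e i : ℂ) = MvPowerSeries.coeff (e - Finsupp.single i 1) (F i) := by
    intro e i hi
    have he : e ≠ 0 := fun h => hi (by rw [h]; rfl)
    have hj := hc e he
    rw [hΩ, if_neg he]
    generalize c e = j at hj
    have hj' : (e j : ℂ) ≠ 0 := by exact_mod_cast hj
    have hi' : (e i : ℂ) ≠ 0 := by exact_mod_cast hi
    by_cases hij : i = j
    · rw [hij, div_mul_cancel₀ _ hj']
    rw [div_mul_eq_mul_div, div_eq_iff hj']
    have h1 := congrArg (MvPowerSeries.coeff (e - Finsupp.single i 1 - Finsupp.single j 1)) (hF i j)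
    rw [MvPowerSeries.coeff_pderiv, MvPowerSeries.coeff_pderiv] at h1
    have hle : Finsupp.single j 1 ≤ e - Finsupp.single i 1 := by
      rw [Finsupp.single_le_iff, Finsupp.tsub_apply, Finsupp.single_eq_of_ne (Ne.symm hij)]
      omega
    have hle' : Finsupp.single i 1 ≤ e - Finsupp.single j 1 := by
      rw [Finsupp.single_le_iff, Finsupp.tsub_apply, Finsupp.single_eq_of_ne hij]
      omega
    rw [tsub_add_cancel_of_le hle, tsub_right_comm, tsub_add_cancel_of_le hle'] at h1
    have e1 : ((e - Finsupp.single j 1 - Finsupp.single i 1 : σ →₀ ℕ) i : ℂ) + 1 = e i := by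
      rw [Finsupp.tsub_apply, Finsupp.tsub_apply, Finsupp.single_eq_same,
        Finsupp.single_eq_of_ne hij]
      exact_mod_cast Nat.succ_pred_eq_of_ne_zero hi
    have e2 : ((e - Finsupp.single j 1 - Finsupp.single i 1 : σ →₀ ℕ) j : ℂ) + 1 = e j := by
      rw [Finsupp.tsub_apply, Finsupp.tsub_apply, Finsupp.single_eq_same,
        Finsupp.single_eq_of_ne (Ne.symm hij)]
      exact_mod_cast Nat.succ_pred_eq_of_ne_zero hj
    rw [e1, e2] at h1
    exact h1
  refine ⟨Ω, fun i => ?_⟩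
  ext d
  have h := key (d + Finsupp.single i 1) i (by simp)
  rw [add_tsub_cancel_right] at h
  rw [MvPowerSeries.coeff_pderiv, ← h]
  simp

theorem eq_C_of_pderiv_eq_zero {σ : Type} {f : MvPowerSeries σ ℂ}
    (h : ∀ i, MvPowerSeries.pderiv ℂ i f = 0) :
    f = MvPowerSeries.C (MvPowerSeries.constantCoeff f) :=
  MvPowerSeries.pderiv.ext (fun i => by rw [h, MvPowerSeries.pderiv_C])
    (by simp)

/-! ### Shifts of the times indexed by integers -/

/-- `timeShift` extended by zero to negative powers of `w`. -/
def intShift (a : Fin 2) (σ : ℂ) (k : ℤ) (f : Times) : Times :=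
  if 0 ≤ k then timeShift a σ k.toNat f else 0

theorem timeShift_map_zero (a : Fin 2) (σ : ℂ) (k : ℕ) : timeShift a σ k 0 = 0 := by
  rw [timeShift_eq, map_zero]

theorem intShift_neg (a : Fin 2) (σ : ℂ) {k : ℤ} (hk : k < 0) (f : Times) :
    intShift a σ k f = 0 := if_neg (by omega)

theorem intShift_natCast (a : Fin 2) (σ : ℂ) (k : ℕ) (f : Times) :
    intShift a σ k f = timeShift a σ k f := by
  rw [intShift, if_pos (by omega), Int.toNat_natCast]

theorem wave_eq (ε : ℂ) (τ : Fn) (j : Fin 2) (s n : ℤ) :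
    wave ε τ j s n = intShift j (-ε) (sgn j * (s - n)) (τ (s + (j : ℕ))) * (τ s)⁻¹ := by
  rw [wave, intShift, ite_mul, zero_mul]

theorem dual_eq (ε : ℂ) (τ : Fn) (j : Fin 2) (s n : ℤ) :
    dual ε τ j s n = intShift j ε (sgn j * (n - s)) (τ (s + 1 - (j : ℕ))) * (τ (s + 1))⁻¹ := by
  rw [dual, wave_eq, neg_neg, show -s - 1 - (-n - 1) = n - s by ring,
    show -(-s - 1 + ((j : ℕ) : ℤ)) = s + 1 - (j : ℕ) by ring,
    show -(-s - 1) = s + 1 by ring]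

/-- Coefficients of `w F` as a function of integers. -/
theorem coeff_X_mul_shifted (a : Fin 2) (σ : ℂ) (f g : Times) (k : ℕ) :
    PowerSeries.coeff k (PowerSeries.X * (shifted a σ f * PowerSeries.C g)) =
      intShift a σ (k - 1) f * g := by
  rcases k with _ | k
  · rw [intShift_neg _ _ (by simp)]
    simp
  · rw [PowerSeries.coeff_succ_X_mul, PowerSeries.coeff_mul_C, coeff_shifted]
    push_cast
    rw [add_sub_cancel_right, intShift_natCast]

/-- Substituting `t - σ [w]_a` for `t` in a relation with coefficients that are shifted or not. -/
theorem intShift_unshift (a : Fin 2) (σ : ℂ) {f₁ f₂ f₃ g₁ g₂ g₃ : Times}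
    (h : ∀ k : ℤ, intShift a (-σ) k f₁ * g₁ =
      intShift a (-σ) k f₂ * g₂ - intShift a (-σ) (k - 1) f₃ * g₃) (k : ℤ) :
    intShift a σ k g₁ * f₁ = intShift a σ k g₂ * f₂ - intShift a σ (k - 1) g₃ * f₃ := by
  rcases lt_or_ge k 0 with hk | hk
  · rw [intShift_neg a σ hk, intShift_neg a σ hk, intShift_neg a σ (by omega)]
    ring
  lift k to ℕ using hk
  have hprev : intShift a σ ((k : ℤ) - 1) g₃ * f₃ =
      ∑ p ∈ Finset.HasAntidiagonal.antidiagonal k,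
        timeShift a σ p.1 (g₃ * intShift a (-σ) ((p.2 : ℤ) - 1) f₃) := by
    rcases k with _ | k
    · simp [intShift_neg, timeShift_eq]
    · rw [Finset.Nat.antidiagonal_succ', Finset.sum_cons, Finset.sum_map]
      simp only [Function.Embedding.prodMap, Function.Embedding.coeFn_mk, Prod.map,
        Function.Embedding.refl_apply, Nat.succ_eq_add_one]
      push_cast
      simp only [add_sub_cancel_right, intShift_natCast]
      rw [sum_timeShift_mul_timeShift_neg, intShift_neg _ _ (by simp), mul_zero,
        timeShift_map_zero, zero_add]
  rw [hprev, intShift_natCast, intShift_natCast, ← sum_timeShift_mul_timeShift_neg a σ g₁ f₁,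
    ← sum_timeShift_mul_timeShift_neg a σ g₂ f₂, ← Finset.sum_sub_distrib]
  refine Finset.sum_congr rfl fun p _ => ?_
  have h1 := h p.2
  rw [intShift_natCast, intShift_natCast] at h1
  rw [mul_comm g₁, h1, timeShift_eq, map_sub, ← timeShift_eq, ← timeShift_eq, mul_comm g₂,
    mul_comm g₃]

/-! ### Eigenfunctions under shifts of the times -/

theorem bandOp_apply_of_subset (a : ℤ →₀ Fn) (f : Fn) (s : ℤ) (t : Finset ℤ)
    (ht : ∀ i, i ∉ t → a i s = 0) : bandOp a f s = ∑ i ∈ t, a i s * f (s + i) := by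
  classical
  rw [bandOp_apply, Finset.sum_subset Finset.subset_union_left (s₂ := a.support ∪ t),
    ← Finset.sum_subset Finset.subset_union_right]
  · intro i _ hi
    rw [ht i hi, zero_mul]
  · intro i _ hi
    rw [Finsupp.notMem_support_iff.mp hi, Pi.zero_apply, zero_mul]

section Core

variable {ε : ℂ} {τ : Fn} {A A' : TimeIdx → FnEnd} {q : Fn}

/-- The first wave bounds the shift operator above by `Λ`, the second below by `Λ ^ 0`. The two
extremal coefficients are all of it: the coefficient of `Λ` comes from the leading `1` of the first
wave, that of `Λ ^ 0` from the leading term `τ(s+1)/τ(s)` of the second. -/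
theorem TodaSys.timeShift_eig_zero (h : TodaSys ε τ A A') (hq : IsEig ε A q) (k : ℕ) (s : ℤ) :
    timeShift 0 (-ε) k (q s) =
      timeShift 0 (-ε) k (τ (s + 1) * (τ s)⁻¹) * (τ s * (τ (s + 1))⁻¹ * q s) -
        if k = 1 then q (s + 1) else 0 := by
  obtain ⟨G, G', ⟨a, rfl, -⟩, hP, hG⟩ := h.exists_band_timeShift 0 k
  have h0 := isTriangular_wave ε h.nonvanishing 0
  have h1 := isTriangular_wave ε h.nonvanishing 1
  have ht0 : ∀ n, 0 < sgn 0 * (n - s - 1) → colAct (bandOp a) (wave ε τ 0) s n = 0 := by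
    intro n hn
    simp only [sgn, if_true] at hn
    rw [hP, rowShift, h0.eq_zero s n (by simp only [sgn, if_true]; omega),
      h0.eq_zero s _ (by simp only [sgn, if_true]; omega)]
    simp [timeShift_eq]
  have ht1 : ∀ n, 0 < sgn 1 * (n - s - 0) → colAct (bandOp a) (wave ε τ 1) s n = 0 := by
    intro n hn
    rw [hP, rowShift, if_neg (by simp), h1.eq_zero s n (by simpa using hn)]
    simp [timeShift_eq]
  have hz0 := coeff_eq_zero_of_colAct (sgn_or 0) h0 a 1 s ht0
  have hz1 := coeff_eq_zero_of_colAct (sgn_or 1) h1 a 0 s ht1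
  have hd0 := coeff_mul_diag_of_colAct (sgn_or 0) h0 a 1 s ht0
  have hd1 := coeff_mul_diag_of_colAct (sgn_or 1) h1 a 0 s ht1
  rw [hP, rowShift, wave_self, h0.eq_zero s (s + 1) (by simp [sgn]), timeShift_eq, map_zero] at hd0
  simp only [sgn, if_true, add_sub_cancel_right, wave_self, Fin.val_zero, Nat.cast_zero, add_zero,
    h.nonvanishing.mul_inv, mul_one, timeShift_one, true_and, zero_sub] at hd0
  rw [hP, rowShift, add_zero, wave_self, if_neg (by simp), sub_zero] at hd1
  simp only [Fin.val_one, Nat.cast_one] at hd1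
  rw [hG q hq, bandOp_apply_of_subset a q s {0, 1}, Finset.sum_pair (by simp), hd0, ← hd1, add_zero]
  · have e1 : a 0 s * (τ (s + 1) * (τ s)⁻¹) * (τ s * (τ (s + 1))⁻¹ * q s) = a 0 s * q s := by
      linear_combination (a 0 s * q s * (τ (s + 1) * (τ (s + 1))⁻¹)) * h.nonvanishing.inv_mul s +
        (a 0 s * q s) * h.nonvanishing.mul_inv (s + 1)
    rw [e1]
    rcases k with _ | _ | k <;> simp [sub_eq_add_neg]
  · intro i hi
    simp only [Finset.mem_insert, Finset.mem_singleton, not_or] at hi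
    rcases lt_or_ge i 0 with hi0 | hi0
    · exact hz1 i (by simp only [sgn]; norm_num; omega)
    · exact hz0 i (by simp only [sgn, if_true]; omega)

/-- For the second set of times the factor `1 - w z⁻¹` sits on the second wave, so the operator is
confined to the powers `Λ ^ 0` and `Λ ^ (-1)`. -/
theorem TodaSys.timeShift_eig_one (h : TodaSys ε τ A A') (hq : IsEig ε A q) (k : ℕ) (s : ℤ) :
    timeShift 1 (-ε) k (q (s + 1)) = (if k = 0 then q (s + 1) else 0) -
      intShift 1 (-ε) (k - 1) (τ (s + 1 + 1) * (τ (s + 1))⁻¹) * (τ s * (τ (s + 1))⁻¹ * q s) := by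
  obtain ⟨G, G', ⟨a, rfl, -⟩, hP, hG⟩ := h.exists_band_timeShift 1 k
  have h0 := isTriangular_wave ε h.nonvanishing 0
  have h1 := isTriangular_wave ε h.nonvanishing 1
  have ht0 : ∀ n, 0 < sgn 0 * (n - (s + 1) - 0) →
      colAct (bandOp a) (wave ε τ 0) (s + 1) n = 0 := by
    intro n hn
    rw [hP, rowShift, if_neg (by simp), h0.eq_zero _ n (by simpa using hn)]
    simp [timeShift_eq]
  have ht1 : ∀ n, 0 < sgn 1 * (n - (s + 1) - (-1)) →
      colAct (bandOp a) (wave ε τ 1) (s + 1) n = 0 := by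
    intro n hn
    simp only [sgn, one_ne_zero, if_false] at hn
    rw [hP, rowShift, h1.eq_zero _ n (by simp only [sgn, one_ne_zero, if_false]; omega),
      h1.eq_zero _ _ (by simp only [sgn, one_ne_zero, if_false]; omega)]
    simp [timeShift_eq]
  have hz0 := coeff_eq_zero_of_colAct (sgn_or 0) h0 a 0 (s + 1) ht0
  have hz1 := coeff_eq_zero_of_colAct (sgn_or 1) h1 a (-1) (s + 1) ht1
  have hd0 := coeff_mul_diag_of_colAct (sgn_or 0) h0 a 0 (s + 1) ht0
  have hd1 := coeff_mul_diag_of_colAct (sgn_or 1) h1 a (-1) (s + 1) ht1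
  rw [hP, rowShift, if_neg (by simp), sub_zero, add_zero, wave_self] at hd0
  simp only [Fin.val_zero, Nat.cast_zero, add_zero, h.nonvanishing.mul_inv, mul_one,
    timeShift_one] at hd0
  rw [hP, rowShift, h1.eq_zero (s + 1) _ (by simp [sgn]), timeShift_eq, map_zero] at hd1
  simp only [sgn, one_ne_zero, if_false, sub_neg_eq_add, true_and, zero_sub,
    show s + 1 + -1 = s by ring, wave_self, Fin.val_one, Nat.cast_one] at hd1
  have hk : intShift 1 (-ε) ((k : ℤ) - 1) (τ (s + 1 + 1) * (τ (s + 1))⁻¹) =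
      -(a (-1) (s + 1) * (τ (s + 1) * (τ s)⁻¹)) := by
    rw [hd1, neg_neg]
    rcases k with _ | k
    · rw [intShift_neg _ _ (by simp)]; simp
    · push_cast
      rw [add_sub_cancel_right, intShift_natCast, if_pos (Nat.succ_ne_zero k)]
  rw [hG q hq, bandOp_apply_of_subset a q (s + 1) {0, -1}, Finset.sum_pair (by simp), hd0, hk,
    show s + 1 + -1 = s by ring, add_zero]
  · have e1 : a (-1) (s + 1) * (τ (s + 1) * (τ s)⁻¹) * (τ s * (τ (s + 1))⁻¹ * q s) =
        a (-1) (s + 1) * q s := by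
      linear_combination (a (-1) (s + 1) * q s * (τ (s + 1) * (τ (s + 1))⁻¹)) *
        h.nonvanishing.inv_mul s + (a (-1) (s + 1) * q s) * h.nonvanishing.mul_inv (s + 1)
    rw [neg_mul, e1, sub_neg_eq_add]
    split_ifs <;> simp
  · intro i hi
    simp only [Finset.mem_insert, Finset.mem_singleton, not_or] at hi
    rcases lt_or_ge i 0 with hi0 | hi0
    · exact hz1 i (by simp only [sgn]; norm_num; omega)
    · exact hz0 i (by simp only [sgn, if_true]; omega)

/-- Multiplying the shifted `q` by the shifted `τ` absorbs the denominator of `τ(s+1)/τ(s)`, because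
shifts are multiplicative. The result is the three-term relation that gives `T_+(q)` on `ψ_1`. -/
theorem TodaSys.intShift_zero_mul (h : TodaSys ε τ A A') (hq : IsEig ε A q) (s k : ℤ) :
    intShift 0 (-ε) k (q s * τ s) * τ (s + 1) =
      intShift 0 (-ε) k (τ (s + 1)) * (q s * τ s) -
        intShift 0 (-ε) (k - 1) (τ s) * (q (s + 1) * τ (s + 1)) := by
  rcases lt_or_ge k 0 with hk | hk
  · rw [intShift_neg _ _ hk, intShift_neg _ _ hk, intShift_neg _ _ (by omega)]
    ring
  lift k to ℕ using hk
  have h1 : shifted 0 (-ε) (q s) = shifted 0 (-ε) (τ (s + 1) * (τ s)⁻¹) *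
      PowerSeries.C (τ s * (τ (s + 1))⁻¹ * q s) - PowerSeries.X * PowerSeries.C (q (s + 1)) := by
    ext k : 1
    rw [coeff_shifted, h.timeShift_eig_zero hq, map_sub, PowerSeries.coeff_mul_C, coeff_shifted,
      PowerSeries.coeff_mul_C, PowerSeries.coeff_X, ite_mul, one_mul, zero_mul]
  have h2 : shifted 0 (-ε) (q s * τ s) = shifted 0 (-ε) (τ (s + 1)) *
      PowerSeries.C (τ s * (τ (s + 1))⁻¹ * q s) -
        PowerSeries.X * (shifted 0 (-ε) (τ s) * PowerSeries.C (q (s + 1))) := by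
    rw [shifted_mul, h1, sub_mul, mul_right_comm, ← shifted_mul, mul_assoc (τ (s + 1)),
      h.nonvanishing.inv_mul, mul_one]
    ring
  have h3 := congrArg (fun F => PowerSeries.coeff k F * τ (s + 1)) h2
  simp only [map_sub, coeff_X_mul_shifted, PowerSeries.coeff_mul_C, coeff_shifted] at h3
  rw [intShift_natCast, intShift_natCast, h3]
  linear_combination (timeShift 0 (-ε) k (τ (s + 1)) * τ s * q s) * h.nonvanishing.mul_inv (s + 1)

/-- The analogous three-term relation for the second set of times, which gives `T_+(q)` on `ψ_2`. -/
theorem TodaSys.intShift_one_mul (h : TodaSys ε τ A A') (hq : IsEig ε A q) (s k : ℤ) :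
    intShift 1 (-ε) k (q (s + 1) * τ (s + 1)) * τ (s + 1) =
      intShift 1 (-ε) k (τ (s + 1)) * (q (s + 1) * τ (s + 1)) -
        intShift 1 (-ε) (k - 1) (τ (s + 1 + 1)) * (q s * τ s) := by
  rcases lt_or_ge k 0 with hk | hk
  · rw [intShift_neg _ _ hk, intShift_neg _ _ hk, intShift_neg _ _ (by omega)]
    ring
  lift k to ℕ using hk
  have h1 : shifted 1 (-ε) (q (s + 1)) = PowerSeries.C (q (s + 1)) -
      PowerSeries.X * (shifted 1 (-ε) (τ (s + 1 + 1) * (τ (s + 1))⁻¹) *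
        PowerSeries.C (τ s * (τ (s + 1))⁻¹ * q s)) := by
    ext k : 1
    rw [coeff_shifted, h.timeShift_eig_one hq, map_sub, coeff_X_mul_shifted, PowerSeries.coeff_C]
  have h2 : shifted 1 (-ε) (q (s + 1) * τ (s + 1)) =
      shifted 1 (-ε) (τ (s + 1)) * PowerSeries.C (q (s + 1)) - PowerSeries.X *
        (shifted 1 (-ε) (τ (s + 1 + 1)) * PowerSeries.C (τ s * (τ (s + 1))⁻¹ * q s)) := by
    have e : shifted 1 (-ε) (τ (s + 1 + 1)) =
        shifted 1 (-ε) (τ (s + 1 + 1) * (τ (s + 1))⁻¹) * shifted 1 (-ε) (τ (s + 1)) := by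
      rw [← shifted_mul, mul_assoc, h.nonvanishing.inv_mul, mul_one]
    rw [shifted_mul, h1, e]
    ring
  have h3 := congrArg (fun F => PowerSeries.coeff k F * τ (s + 1)) h2
  simp only [map_sub, coeff_X_mul_shifted, PowerSeries.coeff_mul_C, coeff_shifted] at h3
  rw [intShift_natCast, intShift_natCast, h3]
  linear_combination (-intShift 1 (-ε) (k - 1) (τ (s + 1 + 1)) * τ s * q s) *
    h.nonvanishing.mul_inv (s + 1)

/-! ### The transformed wave functions -/

theorem intShift_smul (a : Fin 2) (σ : ℂ) (k : ℤ) (c : ℂ) (f : Times) :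
    intShift a σ k (c • f) = c • intShift a σ k f := by
  unfold intShift
  split_ifs
  · rw [timeShift_smul]
  · rw [smul_zero]

theorem tauPlus_nonvanishing (hτ : NonvanishingAtZero τ) (hq : NonvanishingAtZero q) :
    NonvanishingAtZero (tauPlus q τ) := fun s => by
  rw [tauPlus, MvPowerSeries.constantCoeff_smul, map_mul]
  exact smul_ne_zero (zpow_ne_zero _ (by norm_num)) (mul_ne_zero (hq s) (hτ s))

theorem tauPlus_inv (s : ℤ) :
    (tauPlus q τ s)⁻¹ = ((-1 : ℂ) ^ s) • ((q s)⁻¹ * (τ s)⁻¹) := by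
  rw [tauPlus, MvPowerSeries.smul_inv, MvPowerSeries.mul_inv_rev, mul_comm (τ s)⁻¹, ← zpow_neg]
  congr 1
  rw [zpow_neg, ← inv_zpow, inv_neg_one]

theorem neg_one_zpow_mul_self (s : ℤ) : (-1 : ℂ) ^ s * (-1 : ℂ) ^ s = 1 := by
  rw [← mul_zpow]; simp

/-- `T_+(q)` as a linear map. -/
def darbouxOp (q : Fn) : FnEnd :=
  mulOp (fun s => q (s + 1)) * deltaOp * mulOp (fun s => (q s)⁻¹)

theorem darbouxOp_apply (hq : NonvanishingAtZero q) (f : Fn) (s : ℤ) :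
    darbouxOp q f s = f (s + 1) - q (s + 1) * (q s)⁻¹ * f s := by
  simp only [darbouxOp, Module.End.mul_apply, mulOp_apply, deltaOp_apply]
  linear_combination f (s + 1) * hq.mul_inv (s + 1)

theorem colAct_darbouxOp (hq : NonvanishingAtZero q) (P : ℤ → Fn) (s : ℤ) :
    colAct (darbouxOp q) P s = P (s + 1) - (q (s + 1) * (q s)⁻¹) • P s := by
  funext n
  rw [colAct, darbouxOp_apply hq]
  rfl

/-- These are the three-term relations divided by the tau functions. The offset `1 - j` is the
factor `z⁻¹` that only the first wave acquires. -/
theorem TodaSys.wave_tauPlus (h : TodaSys ε τ A A') (hq : IsEig ε A q)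
    (hq0 : NonvanishingAtZero q) (j : Fin 2) (s n : ℤ) : wave ε (tauPlus q τ) j s n =
      colAct (darbouxOp q) (wave ε τ j) s (n + (1 - (j : ℕ))) := by
  rw [colAct_darbouxOp hq0, Pi.sub_apply, Pi.smul_apply, smul_eq_mul]
  simp only [wave_eq, tauPlus_inv]
  simp only [tauPlus, intShift_smul]
  fin_cases j
  · simp only [sgn, Fin.zero_eta, if_true, one_mul, Nat.cast_zero, add_zero, sub_zero,
      smul_mul_smul_comm, neg_one_zpow_mul_self, one_smul]
    have h1 := h.intShift_zero_mul hq s (s - n)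
    rw [show s + 1 - (n + 1) = s - n by ring, show s - (n + 1) = s - n - 1 by ring]
    have e1 := hq0.mul_inv s
    have e2 := h.nonvanishing.mul_inv s
    have e3 := h.nonvanishing.mul_inv (s + 1)
    linear_combination ((q s)⁻¹ * (τ s)⁻¹ * (τ (s + 1))⁻¹) * h1 -
      (intShift 0 (-ε) (s - n) (q s * τ s) * (q s)⁻¹ * (τ s)⁻¹) * e3 +
      (intShift 0 (-ε) (s - n) (τ (s + 1)) * (τ (s + 1))⁻¹ * (τ s * (τ s)⁻¹)) * e1 +
      (intShift 0 (-ε) (s - n) (τ (s + 1)) * (τ (s + 1))⁻¹) * e2 -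
      (intShift 0 (-ε) (s - n - 1) (τ s) * (q (s + 1)) * (q s)⁻¹ * (τ s)⁻¹) * e3
  · simp only [sgn, Fin.mk_one, one_ne_zero, if_false, neg_one_mul, Nat.cast_one,
      sub_self, add_zero, smul_mul_smul_comm]
    -- The second wave compares sites `s + 1` and `s`, so the factor `(-1)^s` of the transformed tau
    -- function leaves a sign here; it cancels for the first wave.
    have hs : (-1 : ℂ) ^ (s + 1) * (-1 : ℂ) ^ s = -1 := by
      rw [zpow_add_one₀ (by norm_num), mul_right_comm, neg_one_zpow_mul_self, one_mul]
    rw [hs, neg_one_smul]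
    have h1 := h.intShift_one_mul hq s (-(s - n))
    rw [show -(s + 1 - n) = -(s - n) - 1 by ring]
    have e1 := hq0.mul_inv s
    have e2 := h.nonvanishing.mul_inv s
    have e3 := h.nonvanishing.mul_inv (s + 1)
    linear_combination (-(q s)⁻¹ * (τ s)⁻¹ * (τ (s + 1))⁻¹) * h1 +
      (intShift 1 (-ε) (-(s - n)) (q (s + 1) * τ (s + 1)) * (q s)⁻¹ * (τ s)⁻¹) * e3 +
      (intShift 1 (-ε) (-(s - n) - 1) (τ (s + 1 + 1)) * (τ (s + 1))⁻¹ * (τ s * (τ s)⁻¹)) * e1 +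
      (intShift 1 (-ε) (-(s - n) - 1) (τ (s + 1 + 1)) * (τ (s + 1))⁻¹) * e2 -
      (intShift 1 (-ε) (-(s - n)) (τ (s + 1)) * (q (s + 1)) * (q s)⁻¹ * (τ s)⁻¹) * e3

/-- This is `Δ^*(Λ(q) ψ^{*[1]}) = q ψ^*` up to a power of `z`: the inverse of `Δ^*` is left
unexpanded, so that no summation is involved yet. -/
theorem TodaSys.dual_tauPlus (h : TodaSys ε τ A A') (hq : IsEig ε A q)
    (hq0 : NonvanishingAtZero q) (j : Fin 2) (s n : ℤ) :
    q s * dual ε (tauPlus q τ) j (s - 1) n - q (s + 1) * dual ε (tauPlus q τ) j s n =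
      q s * dual ε τ j s (n + (1 - (j : ℕ))) := by
  simp only [dual_eq, tauPlus_inv]
  simp only [tauPlus, intShift_smul]
  have e0 := hq0.mul_inv s
  have e1 := hq0.mul_inv (s + 1)
  have e2 := h.nonvanishing.mul_inv s
  have e3 := h.nonvanishing.mul_inv (s + 1)
  fin_cases j
  · simp only [sgn, Fin.zero_eta, if_true, one_mul, Nat.cast_zero, sub_zero,
      smul_mul_smul_comm, neg_one_zpow_mul_self, one_smul, sub_add_cancel]
    -- Adjoint waves contain `t + [w]`; the substitution interchanges the shifted and unshifted
    -- factors of the three-term relation.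
    have h1 := intShift_unshift 0 ε (h.intShift_zero_mul hq s) (n - s + 1)
    rw [show n - (s - 1) = n - s + 1 by ring, show n + 1 - s = n - s + 1 by ring]
    rw [add_sub_cancel_right] at h1
    linear_combination (-(τ s)⁻¹ * (τ (s + 1))⁻¹) * h1 +
      (intShift 0 ε (n - s + 1) (q s * τ s) * (τ s)⁻¹) * (e0 - e3) +
      (-intShift 0 ε (n - s) (q (s + 1) * τ (s + 1)) * (τ (s + 1))⁻¹) * (e1 - e2) +
      (q s * intShift 0 ε (n - s + 1) (τ (s + 1)) * (τ (s + 1))⁻¹) * e2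
  · simp only [sgn, Fin.mk_one, one_ne_zero, if_false, neg_one_mul, Nat.cast_one,
      sub_self, add_zero, smul_mul_smul_comm, sub_add_cancel, add_sub_cancel_right]
    have hs : ∀ s : ℤ, (-1 : ℂ) ^ s * (-1 : ℂ) ^ (s + 1) = -1 := fun s => by
      rw [zpow_add_one₀ (by norm_num), ← mul_assoc, neg_one_zpow_mul_self, one_mul]
    have hs' := hs (s - 1)
    rw [sub_add_cancel] at hs'
    rw [hs, hs', neg_one_smul, neg_one_smul]
    have h1 := intShift_unshift 1 ε (h.intShift_one_mul hq (s - 1)) (-(n - s))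
    rw [sub_add_cancel] at h1
    rw [show -(n - (s - 1)) = -(n - s) - 1 by ring]
    linear_combination (-(τ s)⁻¹ * (τ (s + 1))⁻¹) * h1 -
      (intShift 1 ε (-(n - s) - 1) (q (s - 1) * τ (s - 1)) * (τ s)⁻¹) * (e0 - e3) +
      (intShift 1 ε (-(n - s)) (q s * τ s) * (τ (s + 1))⁻¹) * (e1 - e2) +
      (q s * intShift 1 ε (-(n - s)) (τ s) * (τ (s + 1))⁻¹) * e2

end Core

end Toda
end

noncomputable section

namespace Toda

/-! ### The Darboux transformation of a solution -/

section Darboux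

variable {ε : ℂ} {τ : Fn} {A A' : TimeIdx → FnEnd} {q : Fn}

/-- Solutions of the adjoint linear problem. -/
def IsAdjEig (ε : ℂ) (A' : TimeIdx → FnEnd) (r : Fn) : Prop := ∀ α, derivOp ε α r = -A' α r

theorem mulOp_mul_inv (hq : NonvanishingAtZero q) : mulOp q * mulOp (fun s => (q s)⁻¹) = 1 := by
  rw [← mulOp_mul, ← mulOp_one]
  congr 1
  funext s
  exact hq.mul_inv s

theorem mulOp_inv_mul (hq : NonvanishingAtZero q) : mulOp (fun s => (q s)⁻¹) * mulOp q = 1 := by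
  rw [← mulOp_mul, ← mulOp_one]
  congr 1
  funext s
  exact hq.inv_mul s

/-- `A` is, after conjugation by `q`, of the form `K Δ`. -/
structure IsGauge (ε : ℂ) (q : Fn) (A A' K K' : TimeIdx → FnEnd) : Prop where
  band : ∀ α, IsBand (K α) (K' α)
  conj : ∀ α, (derivOp ε α - A α) * mulOp q = mulOp q * (derivOp ε α - K α * deltaOp)
  conj_adj : ∀ α, mulOp q * (derivOp ε α + A' α) = (derivOp ε α + deltaStarOp * K' α) * mulOp q

/-- The conjugated operator minus `q⁻¹ ∂q` sends `1` to `q⁻¹(A q - ∂q) = 0`, so it is divisible by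
`Δ` on the right. -/
theorem exists_isGauge (hA : ∀ α, IsBand (A α) (A' α)) (hq : IsEig ε A q)
    (hq0 : NonvanishingAtZero q) : ∃ K K', IsGauge ε q A A' K K' := by
  set qi : Fn := fun s => (q s)⁻¹ with hqi
  have h1 : mulOp q * mulOp qi = 1 := mulOp_mul_inv hq0
  have h2 : mulOp qi * mulOp q = 1 := mulOp_inv_mul hq0
  have hband : ∀ α, IsBand (mulOp qi * (A α * mulOp q) - mulOp (qi * derivOp ε α q))
      (mulOp q * A' α * mulOp qi - mulOp (qi * derivOp ε α q)) := fun α =>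
    ((IsBand.mulOp qi).mul ((hA α).mul (IsBand.mulOp q))).sub (IsBand.mulOp _)
  have hex : ∀ α, ∃ K K', IsBand K K' ∧
      mulOp qi * (A α * mulOp q) - mulOp (qi * derivOp ε α q) = K * deltaOp := by
    intro α
    obtain ⟨K, K', hK, h⟩ := exists_mul_deltaOp (hband α)
    refine ⟨K, K', hK, ?_⟩
    have h0 : (mulOp qi * (A α * mulOp q) - mulOp (qi * derivOp ε α q)) 1 = 0 := by
      have hq1 : mulOp q 1 = q := by funext s; simp
      funext s
      rw [LinearMap.sub_apply, Module.End.mul_apply, Module.End.mul_apply, hq1, ← hq α]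
      simp
    rw [h0, map_zero, zero_add] at h
    exact h
  choose K K' hK hKA using hex
  have hc : ∀ α, derivOp ε α * mulOp q = mulOp q * derivOp ε α +
      mulOp q * mulOp (qi * derivOp ε α q) := by
    intro α
    rw [derivOp_mul_mulOp, mulOp_mul, ← mul_assoc, h1, one_mul, add_comm]
  refine ⟨K, K', hK, fun α => ?_, fun α => ?_⟩
  · rw [← hKA, sub_mul, hc, mul_sub, mul_sub, ← mul_assoc (mulOp q) (mulOp qi), h1]
    noncomm_ring
  · have h3 := (hband α).adj_unique (A'' := deltaStarOp * K' α)
      (by rw [hKA]; exact (hK α).mul isBand_deltaOp)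
    have h4 : mulOp q * mulOp (qi * derivOp ε α q) = mulOp (qi * derivOp ε α q) * mulOp q := by
      rw [← mulOp_mul, ← mulOp_mul, mul_comm]
    rw [← h3, add_mul, hc, sub_mul, mul_assoc _ (mulOp qi), h2, h4]
    noncomm_ring

/-- The evolution operators of the transformed solution. -/
def darbouxEvol (ε : ℂ) (q : Fn) (K : TimeIdx → FnEnd) (α : TimeIdx) : FnEnd :=
  mulOp (fun s => q (s + 1)) * deltaOp * K α * mulOp (fun s => (q (s + 1))⁻¹) +
    mulOp ((fun s => (q (s + 1))⁻¹) * derivOp ε α fun s => q (s + 1))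

/-- The adjoint evolution operators of the transformed solution. -/
def darbouxEvolAdj (ε : ℂ) (q : Fn) (K' : TimeIdx → FnEnd) (α : TimeIdx) : FnEnd :=
  mulOp (fun s => (q (s + 1))⁻¹) * K' α * deltaStarOp * mulOp (fun s => q (s + 1)) +
    mulOp ((fun s => (q (s + 1))⁻¹) * derivOp ε α fun s => q (s + 1))

theorem NonvanishingAtZero.succ (hq : NonvanishingAtZero q) :
    NonvanishingAtZero fun s => q (s + 1) := fun s => hq (s + 1)

theorem derivOp_mul_mulOp_of_inv {c ci : Fn} (h : mulOp c * mulOp ci = 1) (α : TimeIdx) :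
    derivOp ε α * mulOp c = mulOp c * derivOp ε α + mulOp (ci * derivOp ε α c) * mulOp c := by
  rw [derivOp_mul_mulOp, mulOp_mul ci, add_comm]
  congr 1
  rw [← mulOp_mul, ← mulOp_mul, mul_assoc, mul_comm _ c, ← mul_assoc, mulOp_mul, mul_comm ci,
    mulOp_mul, h, one_mul]

variable {K K' : TimeIdx → FnEnd}

/-- The second term of `darbouxEvol` is the logarithmic derivative of `Λ(q)`; it cancels what
conjugation by `Λ(q)` produces, leaving `∂ - Δ K`. -/
theorem darbouxEvol_conj (hq0 : NonvanishingAtZero q) (α : TimeIdx) :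
    (derivOp ε α - darbouxEvol ε q K α) * mulOp (fun s => q (s + 1)) =
      mulOp (fun s => q (s + 1)) * (derivOp ε α - deltaOp * K α) := by
  have h1 := mulOp_mul_inv hq0.succ
  have h2 := mulOp_inv_mul hq0.succ
  rw [sub_mul, derivOp_mul_mulOp_of_inv h1, darbouxEvol, add_mul,
    mul_assoc _ (mulOp fun s => (q (s + 1))⁻¹), h2]
  simp only [mul_sub, mul_assoc]
  abel

theorem darbouxEvolAdj_conj (hq0 : NonvanishingAtZero q) (α : TimeIdx) :
    mulOp (fun s => q (s + 1)) * (derivOp ε α + darbouxEvolAdj ε q K' α) =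
      (derivOp ε α + K' α * deltaStarOp) * mulOp (fun s => q (s + 1)) := by
  have h1 := mulOp_mul_inv hq0.succ
  have h3 : mulOp (fun s => q (s + 1)) *
      mulOp ((fun s => (q (s + 1))⁻¹) * derivOp ε α fun s => q (s + 1)) =
      mulOp ((fun s => (q (s + 1))⁻¹) * derivOp ε α fun s => q (s + 1)) *
        mulOp (fun s => q (s + 1)) := by
    rw [← mulOp_mul, ← mulOp_mul, mul_comm]
  rw [add_mul, derivOp_mul_mulOp_of_inv h1, darbouxEvolAdj, mul_add, mul_add, ← h3,
    ← mul_assoc _ (mulOp (fun s => (q (s + 1))⁻¹) * K' α * deltaStarOp),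
    ← mul_assoc _ (mulOp (fun s => (q (s + 1))⁻¹) * K' α),
    ← mul_assoc _ (mulOp (fun s => (q (s + 1))⁻¹)), h1]
  noncomm_ring

theorem IsGauge.isBand_darbouxEvol (hK : IsGauge ε q A A' K K') (α : TimeIdx) :
    IsBand (darbouxEvol ε q K α) (darbouxEvolAdj ε q K' α) := by
  have h := (((IsBand.mulOp fun s => q (s + 1)).mul isBand_deltaOp).mul (hK.band α)).mul
    (IsBand.mulOp fun s => (q (s + 1))⁻¹)
  have h' := h.add (IsBand.mulOp ((fun s => (q (s + 1))⁻¹) * derivOp ε α fun s => q (s + 1)))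
  simpa only [darbouxEvol, darbouxEvolAdj, mul_assoc] using h'

/-- `T_+(q)` intertwines the linear problems. -/
theorem IsGauge.intertwine (hK : IsGauge ε q A A' K K') (hq0 : NonvanishingAtZero q)
    (α : TimeIdx) : (derivOp ε α - darbouxEvol ε q K α) * darbouxOp q =
      darbouxOp q * (derivOp ε α - A α) := by
  have h1 := mulOp_mul_inv hq0
  have h2 := mulOp_inv_mul hq0
  have h3 : mulOp (fun s => (q s)⁻¹) * (derivOp ε α - A α) =
      (derivOp ε α - K α * deltaOp) * mulOp fun s => (q s)⁻¹ := by
    calc _ = mulOp (fun s => (q s)⁻¹) * ((derivOp ε α - A α) * mulOp q) *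
        mulOp (fun s => (q s)⁻¹) := by simp only [mul_assoc, h1, mul_one]
      _ = _ := by rw [hK.conj, ← mul_assoc, h2, one_mul]
  rw [darbouxOp, ← mul_assoc, ← mul_assoc, darbouxEvol_conj hq0,
    mul_assoc (_ * deltaOp), h3, mul_assoc (mulOp _) _ deltaOp, sub_mul, derivOp_mul_deltaOp]
  simp only [mul_sub, sub_mul, mul_assoc]

/-- The evolution follows from the intertwining by `T_+(q)`. For orthogonality, the relation for the
adjoint rows determines `Λ(q)` times each pairing up to a term constant in the second index, and the
supports fix that constant. -/
theorem TodaSys.darboux (h : TodaSys ε τ A A') (hq : IsEig ε A q) (hq0 : NonvanishingAtZero q)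
    (hK : IsGauge ε q A A' K K') :
    TodaSys ε (tauPlus q τ) (darbouxEvol ε q K) (darbouxEvolAdj ε q K') where
  nonvanishing := tauPlus_nonvanishing h.nonvanishing hq0
  band := hK.isBand_darbouxEvol
  evol j α s := by
    have hw : ∀ s, wave ε (tauPlus q τ) j s =
        shiftOp (1 - (j : ℕ)) (colAct (darbouxOp q) (wave ε τ j) s) := fun s =>
      funext fun n => h.wave_tauPlus hq hq0 j s n
    have hcomm : nabla ε j α * shiftOp (1 - (j : ℕ)) = shiftOp (1 - (j : ℕ)) * nabla ε j α := by
      rw [nabla, add_mul, mul_add, derivOp_mul_shiftOp]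
      congr 1
      split_ifs
      · ext f n : 2
        simp only [Module.End.mul_apply, shiftOp_apply]
        congr 1
        ring
      · simp
    have hT : derivOp ε α * darbouxOp q - darbouxOp q * derivOp ε α + darbouxOp q * A α =
        darbouxEvol ε q K α * darbouxOp q := by
      have := hK.intertwine hq0 α
      rw [sub_mul, mul_sub] at this
      rw [sub_eq_iff_eq_add] at this
      rw [this]
      abel
    rw [hw, ← Module.End.mul_apply, hcomm, Module.End.mul_apply, h.nabla_colAct_wave, hT,
      colAct_mul]
    funext n
    exact congrArg (fun f => darbouxEvol ε q K α f s)
      (funext fun t => (h.wave_tauPlus hq hq0 j t n).symm)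
  orth j s s' := by
    have hη := sgn_or j
    have hη' := neg_sgn_or j
    have hτ' := tauPlus_nonvanishing h.nonvanishing hq0
    have hP := fun s => (isTriangular_wave ε h.nonvanishing j).bddSide s
    have hP' := fun s => (isTriangular_wave ε hτ' j).bddSide s
    have hQ' := fun s => (isTriangular_dual ε hτ' j).bddSide s
    have hQ := fun s => (isTriangular_dual ε h.nonvanishing j).bddSide s
    have hrow : ∀ s, wave ε (tauPlus q τ) j s = shiftOp (1 - (j : ℕ))
        (wave ε τ j (s + 1) - (q (s + 1) * (q s)⁻¹) • wave ε τ j s) := by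
      intro s
      rw [← colAct_darbouxOp hq0]
      exact funext fun n => h.wave_tauPlus hq hq0 j s n
    -- The new wave row is a combination of the old rows `s + 1` and `s`; the old orthogonality
    -- evaluates the right side as `Δ^*` of `q(s + 1)` times a Kronecker delta.
    have hstep : ∀ t, q t * pair (wave ε (tauPlus q τ) j s) (dual ε (tauPlus q τ) j (t - 1)) -
        q (t + 1) * pair (wave ε (tauPlus q τ) j s) (dual ε (tauPlus q τ) j t) =
        q (s + 1) * (if s = t - 1 then 1 else 0) - q (s + 1) * (if s = t then 1 else 0) := by
      intro t
      have hd : q t • dual ε (tauPlus q τ) j (t - 1) - q (t + 1) • dual ε (tauPlus q τ) j t =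
          q t • shiftOp (1 - (j : ℕ)) (dual ε τ j t) :=
        funext fun n => h.dual_tauPlus hq hq0 j t n
      have hsh : pair (shiftOp (1 - (j : ℕ)) (dual ε τ j t)) (wave ε (tauPlus q τ) j s) =
          pair (wave ε τ j (s + 1) - (q (s + 1) * (q s)⁻¹) • wave ε τ j s) (dual ε τ j t) := by
        have hinv : shiftOp (-(1 - ((j : ℕ) : ℤ))) * shiftOp (1 - (j : ℕ)) = 1 := by
          ext f n : 2
          simp only [Module.End.mul_apply, shiftOp_apply, Module.End.one_apply]
          congr 1
          ring
        rw [hrow, pair_comm, pair_shiftOp_left, ← Module.End.mul_apply, hinv, Module.End.one_apply]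
      have h1 := congrArg (fun v => pair v (wave ε (tauPlus q τ) j s)) hd
      rw [pair_sub_left hη' ((hQ' _).smul _) ((hQ' _).smul _) (by rw [neg_neg]; exact hP' s),
        pair_smul_left, pair_smul_left, pair_smul_left, pair_comm, pair_comm (dual _ _ _ t), hsh,
        pair_sub_left hη (hP _) ((hP _).smul _) (hQ _), pair_smul_left, h.orth, h.orth] at h1
      rw [h1]
      by_cases hst : s = t
      · subst hst
        rw [if_neg (by omega), if_pos rfl, if_neg (by omega)]
        linear_combination (-q (s + 1)) * hq0.mul_inv s
      · rw [if_neg hst]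
        by_cases hst' : s + 1 = t
        · rw [if_pos hst', if_pos (by omega), hst']
          ring
        · rw [if_neg hst', if_neg (by omega)]
          ring
    have hconst : ∀ t, q (t + 1) * pair (wave ε (tauPlus q τ) j s) (dual ε (tauPlus q τ) j t) -
        q (s + 1) * (if s = t then 1 else 0) = 0 := by
      have hc := eq_const_of_deltaStar (f := fun t =>
        q (t + 1) * pair (wave ε (tauPlus q τ) j s) (dual ε (tauPlus q τ) j t) -
        q (s + 1) * (if s = t then 1 else 0)) fun t => by
          have := hstep t
          rw [sub_add_cancel]
          linear_combination this
      intro t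
      -- At `t = s + sgn j` the two rows have disjoint supports and the Kronecker delta vanishes, so
      -- the constant is zero.
      rw [hc t, ← hc (s + sgn j), pair_eq_zero hη ((isTriangular_wave ε hτ' j).eq_zero s)
        (M := s + sgn j), if_neg]
      · ring
      · rcases hη with h' | h' <;> rw [h'] <;> omega
      · intro n hn
        exact (isTriangular_dual ε hτ' j).eq_zero _ _ (by
          rcases hη with h' | h' <;> rw [h'] at hn ⊢ <;> omega)
      · rcases hη with h' | h' <;> rw [h'] <;> omega
    have h1 := hconst s'
    by_cases hs : s = s'
    · subst hs
      rw [if_pos rfl] at h1 ⊢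
      exact mul_left_cancel₀ (hq0.ne_zero (s + 1)) (sub_eq_zero.mp h1)
    · rw [if_neg hs] at h1 ⊢
      rw [mul_zero, sub_zero] at h1
      exact (mul_eq_zero.mp h1).resolve_left (hq0.ne_zero _)

theorem IsGauge.isEig (hK : IsGauge ε q A A' K K') (hq0 : NonvanishingAtZero q) {q' : Fn}
    (hq' : IsEig ε A q') : IsEig ε (darbouxEvol ε q K) (darbouxOp q q') := by
  intro α
  have h := LinearMap.congr_fun (hK.intertwine hq0 α) q'
  simp only [Module.End.mul_apply, LinearMap.sub_apply, hq' α, sub_self, map_zero] at h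
  exact sub_eq_zero.mp h

/-! ### Adjoint eigenfunctions -/

/-- Multiplication by `q` carries the adjoint linear problem to `∂ + Δ^* K^*`, so the derivatives of
`q r` are differences. This is what allows them to be summed. -/
theorem IsGauge.derivOp_mul_eq (hK : IsGauge ε q A A' K K') {r : Fn} (hr : IsAdjEig ε A' r)
    (α : TimeIdx) : derivOp ε α (q * r) = -deltaStarOp (K' α (q * r)) := by
  have h := LinearMap.congr_fun (hK.conj_adj α) r
  simp only [Module.End.mul_apply, LinearMap.add_apply, hr α, neg_add_cancel, map_zero] at h
  have hm : mulOp q r = q * r := rfl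
  rw [hm] at h
  exact eq_neg_of_add_eq_zero_left h.symm

/-- Conjugation by `Λ(q)` turns the transformed adjoint problem into `∂Ω + K^* Δ^* Ω = 0`, in which
`Δ^* Ω` is already known. -/
theorem isAdjEig_darboux_iff (hq0 : NonvanishingAtZero q) {r Ω : Fn}
    (hΩ : deltaStarOp Ω = q * r) :
    IsAdjEig ε (darbouxEvolAdj ε q K') (fun s => (q (s + 1))⁻¹ * Ω s) ↔
      ∀ α, derivOp ε α Ω = -K' α (q * r) := by
  refine forall_congr' fun α => ?_
  have h2 := LinearMap.congr_fun (mulOp_inv_mul hq0.succ)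
  have h := LinearMap.congr_fun (darbouxEvolAdj_conj (ε := ε) (K' := K') hq0 α)
    (fun s => (q (s + 1))⁻¹ * Ω s)
  have e : mulOp (fun s => q (s + 1)) (fun s => (q (s + 1))⁻¹ * Ω s) = Ω :=
    LinearMap.congr_fun (mulOp_mul_inv hq0.succ) Ω
  simp only [Module.End.mul_apply, LinearMap.add_apply, e, hΩ] at h
  rw [← add_eq_zero_iff_eq_neg, ← add_eq_zero_iff_eq_neg, ← h]
  constructor
  · intro h1
    rw [h1, map_zero]
  · intro h1
    have h3 := congrArg (mulOp fun s => (q (s + 1))⁻¹) h1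
    rw [map_zero, ← Module.End.mul_apply, h2, Module.End.one_apply] at h3
    exact h3

/-! ### Flatness and the summation constant. -/

/-- The operators `nabla` commute on the first wave array, and banded operators are determined by
their action on it. -/
theorem TodaSys.flat (h : TodaSys ε τ A A') (α β : TimeIdx) :
    (derivOp ε α - A α) * (derivOp ε β - A β) = (derivOp ε β - A β) * (derivOp ε α - A α) := by
  have hn : ∀ v, nabla ε 0 α (nabla ε 0 β v) = nabla ε 0 β (nabla ε 0 α v) := by
    intro v
    have hs : ∀ α β : TimeIdx, derivOp ε α *
        (if β.1 = 0 then shiftOp (-(sgn 0 * (β.2 : ℕ))) else 0) =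
        (if β.1 = 0 then shiftOp (-(sgn 0 * (β.2 : ℕ))) else 0) * derivOp ε α := by
      intro α β
      split_ifs
      · exact derivOp_mul_shiftOp _ _ _
      · simp
    have hss : (if α.1 = 0 then shiftOp (-(sgn 0 * (α.2 : ℕ))) else 0) *
        (if β.1 = 0 then shiftOp (-(sgn 0 * (β.2 : ℕ))) else 0) =
        (if β.1 = 0 then shiftOp (-(sgn 0 * (β.2 : ℕ))) else 0) *
        (if α.1 = 0 then shiftOp (-(sgn 0 * (α.2 : ℕ))) else 0) := by
      split_ifs
      · ext f n : 2
        simp only [Module.End.mul_apply, shiftOp_apply]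
        congr 1
        ring
      all_goals simp
    have : nabla ε 0 α * nabla ε 0 β = nabla ε 0 β * nabla ε 0 α := by
      simp only [nabla, add_mul, mul_add, hs, hss, derivOp_comm ε α β]
      abel
    exact LinearMap.congr_fun this v
  have hcol : ∀ α β s, nabla ε 0 α (nabla ε 0 β (wave ε τ 0 s)) =
      colAct (derivOp ε α * A β - A β * derivOp ε α + A β * A α) (wave ε τ 0) s := by
    intro α β s
    rw [h.evol, h.nabla_colAct_wave]
  have hband : ∀ α β, IsBand (derivOp ε α * A β - A β * derivOp ε α + A β * A α) _ :=
    fun α β => ((h.band β).commutator_derivOp ε α).add ((h.band β).mul (h.band α))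
  have := (hband α β).eq_of_colAct (sgn_or 0) (isTriangular_wave ε h.nonvanishing 0) (hband β α)
    (funext fun s => by rw [← hcol, ← hcol, hn])
  rw [sub_mul, mul_sub, mul_sub, sub_mul, mul_sub, mul_sub, derivOp_comm ε α β]
  rw [← sub_eq_zero] at this ⊢
  rw [← neg_eq_zero, ← this]
  abel

/-- Flatness of the operators `∂ - K Δ` equals this identity multiplied on the right by `Δ`, which
can be cancelled. -/
theorem IsGauge.flat (hK : IsGauge ε q A A' K K') (h : TodaSys ε τ A A')
    (hq0 : NonvanishingAtZero q) (α β : TimeIdx) :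
    derivOp ε β * K α - K α * derivOp ε β - (derivOp ε α * K β - K β * derivOp ε α) -
      K β * (deltaOp * K α) + K α * (deltaOp * K β) = 0 := by
  have h2 := mulOp_inv_mul hq0
  have hf : (derivOp ε α - K α * deltaOp) * (derivOp ε β - K β * deltaOp) =
      (derivOp ε β - K β * deltaOp) * (derivOp ε α - K α * deltaOp) := by
    have h3 : ∀ α β, mulOp q * ((derivOp ε α - K α * deltaOp) * (derivOp ε β - K β * deltaOp)) =
        (derivOp ε α - A α) * (derivOp ε β - A β) * mulOp q := by
      intro α β
      rw [← mul_assoc, ← hK.conj, mul_assoc, ← hK.conj, mul_assoc]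
    have h4 := (h3 α β).trans ((congrArg (· * mulOp q) (h.flat α β)).trans (h3 β α).symm)
    have h5 := congrArg (mulOp (fun s => (q s)⁻¹) * ·) h4
    simpa only [← mul_assoc, h2, one_mul] using h5
  refine eq_zero_of_mul_deltaOp ?_
  have hα := derivOp_mul_deltaOp ε α
  have hβ := derivOp_mul_deltaOp ε β
  simp only [sub_mul, mul_sub, add_mul, derivOp_comm ε α β] at hf ⊢
  simp only [mul_assoc, hα, hβ] at hf ⊢
  rw [← sub_eq_zero] at hf
  rw [← hf]
  abel

/-- The adjoint of `IsGauge.flat`, applied to `q r`, is the closedness of `∂Ω = -K^*(q r)`. The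
difference of two solutions is constant in `s` and in all times. -/
theorem TodaSys.exists_deltaStarInv (h : TodaSys ε τ A A') (hε : ε ≠ 0)
    (hq0 : NonvanishingAtZero q) (hK : IsGauge ε q A A' K K') {r : Fn} (hr : IsAdjEig ε A' r) :
    ∃ Ω₀ : Fn, deltaStarOp Ω₀ = q * r ∧ ∀ Ω : Fn, deltaStarOp Ω = q * r →
      (IsAdjEig ε (darbouxEvolAdj ε q K') (fun s => (q (s + 1))⁻¹ * Ω s) ↔
        ∃ c : ℂ, ∀ s, Ω s = Ω₀ s + MvPowerSeries.C c) := by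
  have hclosed : ∀ α β, derivOp ε β (-K' α (q * r)) = derivOp ε α (-K' β (q * r)) := by
    intro α β
    have hb := ((((hK.band α).commutator_derivOp ε β).sub
      ((hK.band β).commutator_derivOp ε α)).sub
        ((hK.band β).mul (isBand_deltaOp.mul (hK.band α)))).add
        ((hK.band α).mul (isBand_deltaOp.mul (hK.band β)))
    have h0 := LinearMap.congr_fun (hb.adj_eq_zero (hK.flat h hq0 α β)) (q * r)
    simp only [LinearMap.add_apply, LinearMap.sub_apply, Module.End.mul_apply,
      hK.derivOp_mul_eq hr, map_neg, LinearMap.zero_apply] at h0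
    rw [map_neg, map_neg, neg_inj, ← sub_eq_zero, ← h0]
    abel
  obtain ⟨ω, hω⟩ := exists_pderiv_eq (fun α => ε⁻¹ • (-K' α (q * r)) 0) fun α β => by
    have := congrFun (hclosed β α) 0
    rw [derivOp_apply, derivOp_apply] at this
    rw [Derivation.map_smul, Derivation.map_smul]
    rw [smul_right_injective _ hε this]
  -- The potential `ω` prescribes `Ω` at `s = 0` only; summation over `s` determines the other
  -- values.
  obtain ⟨f, hf0, hf⟩ := exists_sub_eq (fun s => -(q (s + 1) * r (s + 1))) ω
  have hfd : deltaStarOp f = q * r := by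
    funext s
    have := hf (s - 1)
    rw [sub_add_cancel] at this
    rw [deltaStarOp_apply, ← sub_eq_add_neg, Pi.mul_apply]
    linear_combination -this
  have hfα : ∀ α, derivOp ε α f = -K' α (q * r) := by
    intro α
    -- The defect of the time equation is killed by `Δ^*`, and it vanishes at `s = 0` by the choice
    -- of `ω`.
    have hc := eq_const_of_deltaStar (f := derivOp ε α f - -K' α (q * r)) fun s => by
      have h1 : deltaStarOp (derivOp ε α f - -K' α (q * r)) = 0 := by
        rw [map_sub, ← Module.End.mul_apply, ← derivOp_mul_deltaStarOp, Module.End.mul_apply,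
          hfd, map_neg, hK.derivOp_mul_eq hr, sub_neg_eq_add, neg_add_cancel]
      exact congrFun h1 s
    have h0 : (derivOp ε α f - -K' α (q * r)) 0 = 0 := by
      rw [Pi.sub_apply, derivOp_apply, hf0, hω, smul_inv_smul₀ hε, sub_self]
    funext s
    exact sub_eq_zero.mp ((hc s).trans h0)
  refine ⟨f, hfd, fun Ω hΩ => ?_⟩
  rw [isAdjEig_darboux_iff hq0 hΩ]
  constructor
  · intro hΩα
    have hc := eq_const_of_deltaStar (f := Ω - f) fun s => by
      have h1 : deltaStarOp (Ω - f) = 0 := by rw [map_sub, hΩ, hfd, sub_self]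
      exact congrFun h1 s
    have hd : ∀ α, MvPowerSeries.pderiv ℂ α ((Ω - f) 0) = 0 := by
      intro α
      have h1 : derivOp ε α (Ω - f) = 0 := by rw [map_sub, hΩα, hfα, sub_self]
      exact (smul_eq_zero.mp (congrFun h1 0)).resolve_left hε
    refine ⟨MvPowerSeries.constantCoeff ((Ω - f) 0), fun s => ?_⟩
    rw [← eq_C_of_pderiv_eq_zero hd, ← hc s]
    simp
  · rintro ⟨c, hc⟩ α
    rw [← hfα]
    funext s
    rw [derivOp_apply, derivOp_apply, hc, map_add, MvPowerSeries.pderiv_C, add_zero]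

end Darboux

end Toda
end

noncomputable section

namespace Toda

/-! ### Restriction to the diagonal `t' = t` -/

theorem finite_preimage_elim (α : TimeIdx) :
    ((Sum.elim id id : TimeIdx ⊕ TimeIdx → TimeIdx) ⁻¹' {α}).Finite := by
  refine (Set.toFinite {Sum.inl α, Sum.inr α}).subset ?_
  rintro (β | β) h
  · exact Or.inl (congrArg Sum.inl h)
  · exact Or.inr (congrArg Sum.inr h)

instance : Filter.TendstoCofinite (Sum.elim id id : TimeIdx ⊕ TimeIdx → TimeIdx) :=
  (Filter.tendstoCofinite_iff_finite_preimage_singleton _).mpr finite_preimage_elim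

/-- `F(t, t)` as a function of `t`. -/
def diag : Times₂ →ₐ[ℂ] Times := MvPowerSeries.rename (Sum.elim id id)

theorem diag_atLeft (f : Times) : diag (atLeft f) = f := by
  rw [diag, atLeft, MvPowerSeries.rename_rename]
  exact MvPowerSeries.rename_id_apply f

theorem diag_atRight (f : Times) : diag (atRight f) = f := by
  rw [diag, atRight, MvPowerSeries.rename_rename]
  exact MvPowerSeries.rename_id_apply f

/-- Differentiation with respect to the first set of times. -/
def leftDeriv (α : TimeIdx) : Derivation ℂ Times₂ Times₂ := MvPowerSeries.pderiv ℂ (Sum.inl α)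

theorem mem_range_mapDomain_inl {γ : TimeIdx ⊕ TimeIdx →₀ ℕ} :
    γ ∈ Set.range (Finsupp.mapDomain (Sum.inl : TimeIdx → TimeIdx ⊕ TimeIdx)) ↔
      ∀ β, γ (Sum.inr β) = 0 := by
  constructor
  · rintro ⟨d, rfl⟩ β
    exact Finsupp.mapDomain_of_notMem_range _ _ (by simp)
  · intro h
    refine ⟨γ.comapDomain Sum.inl Sum.inl_injective.injOn,
      Finsupp.mapDomain_comapDomain _ Sum.inl_injective _ fun x hx => ?_⟩
    rcases x with β | β
    · exact ⟨β, rfl⟩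
    · exact absurd (h β) (Finsupp.mem_support_iff.mp hx)

theorem mem_range_mapDomain_inr {γ : TimeIdx ⊕ TimeIdx →₀ ℕ} :
    γ ∈ Set.range (Finsupp.mapDomain (Sum.inr : TimeIdx → TimeIdx ⊕ TimeIdx)) ↔
      ∀ β, γ (Sum.inl β) = 0 := by
  constructor
  · rintro ⟨d, rfl⟩ β
    exact Finsupp.mapDomain_of_notMem_range _ _ (by simp)
  · intro h
    refine ⟨γ.comapDomain Sum.inr Sum.inr_injective.injOn,
      Finsupp.mapDomain_comapDomain _ Sum.inr_injective _ fun x hx => ?_⟩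
    rcases x with β | β
    · exact absurd (h β) (Finsupp.mem_support_iff.mp hx)
    · exact ⟨β, rfl⟩

theorem coeff_mapDomain_atLeft (f : Times) (d : TimeIdx →₀ ℕ) :
    MvPowerSeries.coeff (Finsupp.mapDomain Sum.inl d) (atLeft f) = MvPowerSeries.coeff d f := by
  rw [← MvPowerSeries.coeff_embDomain_rename ⟨Sum.inl, Sum.inl_injective⟩ f d,
    Finsupp.embDomain_eq_mapDomain]
  rfl

theorem leftDeriv_atLeft (α : TimeIdx) (f : Times) :
    leftDeriv α (atLeft f) = atLeft (MvPowerSeries.pderiv ℂ α f) := by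
  ext γ
  rw [leftDeriv, MvPowerSeries.coeff_pderiv]
  by_cases h : γ ∈ Set.range (Finsupp.mapDomain (Sum.inl : TimeIdx → TimeIdx ⊕ TimeIdx))
  · obtain ⟨d, rfl⟩ := h
    rw [← Finsupp.mapDomain_single, ← Finsupp.mapDomain_add, coeff_mapDomain_atLeft,
      coeff_mapDomain_atLeft, MvPowerSeries.coeff_pderiv,
      Finsupp.mapDomain_apply Sum.inl_injective]
  · rw [atLeft, atLeft, MvPowerSeries.coeff_rename_eq_zero _ _ h,
      MvPowerSeries.coeff_rename_eq_zero, zero_mul]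
    rw [mem_range_mapDomain_inl] at h ⊢
    simpa using h

theorem leftDeriv_atRight (α : TimeIdx) (f : Times) : leftDeriv α (atRight f) = 0 := by
  ext γ
  rw [leftDeriv, MvPowerSeries.coeff_pderiv, atRight, MvPowerSeries.coeff_rename_eq_zero, zero_mul,
    map_zero]
  rw [mem_range_mapDomain_inr]
  intro h
  simpa using h α

theorem mapDomain_elim_apply (γ : TimeIdx ⊕ TimeIdx →₀ ℕ) (α : TimeIdx) :
    Finsupp.mapDomain (Sum.elim id id) γ α = γ (Sum.inl α) + γ (Sum.inr α) := by
  classical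
  induction γ using Finsupp.induction_linear with
  | zero => simp
  | add f g hf hg => rw [Finsupp.mapDomain_add, Finsupp.add_apply, hf, hg]; simp; ring
  | single i n =>
    rw [Finsupp.mapDomain_single]
    rcases i with i | i <;> simp [Finsupp.single_apply]

theorem weight_mapDomain_elim (γ : TimeIdx ⊕ TimeIdx →₀ ℕ) :
    Finsupp.weight (fun _ => 1) (Finsupp.mapDomain (Sum.elim id id : _ → TimeIdx) γ) =
      Finsupp.weight (Sum.elim (fun _ => 1) fun _ => 0) γ +
        Finsupp.weight (Sum.elim (fun _ => 0) fun _ => (1 : ℕ)) γ := by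
  induction γ using Finsupp.induction_linear with
  | zero => simp
  | add f g hf hg => rw [Finsupp.mapDomain_add, map_add, hf, hg, map_add, map_add]; ring
  | single i n =>
    rw [Finsupp.mapDomain_single]
    rcases i with i | i <;> simp [Finsupp.weight_single]

/-- A function of `(t, t')` vanishes if all its derivatives in `t` vanish on the diagonal. -/
theorem eq_zero_of_diag_eq_zero {T : Set Times₂} (hT : ∀ F ∈ T, ∀ α, leftDeriv α F ∈ T)
    (hd : ∀ F ∈ T, diag F = 0) : ∀ F ∈ T, F = 0 := by
  classical
  set l : (TimeIdx ⊕ TimeIdx →₀ ℕ) →+ ℕ := Finsupp.weight (Sum.elim (fun _ => 1) fun _ => 0)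
    with hl
  set r : (TimeIdx ⊕ TimeIdx →₀ ℕ) →+ ℕ := Finsupp.weight (Sum.elim (fun _ => 0) fun _ => (1 : ℕ))
    with hr
  -- Outer induction on the degree `n` in `t'`, inner on the degree `m` in `t`. For `m = 0`,
  -- restriction to the diagonal adds up monomials of which all others have smaller degree in `t'`;
  -- for larger `m` a derivative in `t` lowers the degree.
  have key : ∀ n m : ℕ, ∀ γ, r γ = n → l γ = m → ∀ F ∈ T, MvPowerSeries.coeff γ F = 0 := by
    intro n
    induction n using Nat.strong_induction_on with
    | _ n ihn =>
      intro m
      induction m with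
      | zero =>
        intro γ hγ hγ0 F hF
        have h1 := congrArg (MvPowerSeries.coeff (Finsupp.mapDomain (Sum.elim id id) γ)) (hd F hF)
        rw [diag, MvPowerSeries.coeff_rename, map_zero, Finset.sum_eq_single γ] at h1
        · exact h1
        · intro γ' hγ' hne
          have h2 : Finsupp.mapDomain (Sum.elim id id) γ' =
            Finsupp.mapDomain (Sum.elim id id) γ := by simpa using hγ'
          have h3 := weight_mapDomain_elim γ'
          rw [h2, weight_mapDomain_elim γ, ← hl, ← hr, hγ, hγ0] at h3
          by_cases h4 : l γ' = 0
          · refine absurd ?_ hne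
            have h5 : ∀ γ, l γ = 0 → ∀ α, γ (Sum.inl α) = 0 := by
              intro γ h α
              have := Finsupp.le_weight (Sum.elim (fun _ : TimeIdx => 1)
                fun _ : TimeIdx => 0) (s := Sum.inl α) (by simp) γ
              rw [← hl, h] at this
              omega
            ext x
            rcases x with α | α
            · rw [h5 _ h4, h5 _ hγ0]
            · have := DFunLike.congr_fun h2 α
              rwa [mapDomain_elim_apply, mapDomain_elim_apply, h5 _ h4, h5 _ hγ0, zero_add,
                zero_add] at this
          · exact ihn (r γ') (by omega) _ _ rfl rfl F hF
        · intro h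
          exact absurd (by simp) h
      | succ m ih =>
        intro γ hγ hγm F hF
        obtain ⟨α, hα⟩ : ∃ α, γ (Sum.inl α) ≠ 0 := by
          by_contra! h
          have : l γ = 0 := by
            rw [hl, Finsupp.weight_apply, Finsupp.sum]
            refine Finset.sum_eq_zero fun x _ => ?_
            rcases x with α | α <;> simp [h]
          omega
        obtain ⟨γ', rfl⟩ : ∃ γ', γ = γ' + Finsupp.single (Sum.inl α) 1 :=
          ⟨γ - Finsupp.single (Sum.inl α) 1,
            (tsub_add_cancel_of_le (by rw [Finsupp.single_le_iff]; omega)).symm⟩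
        have h1 := ih γ' (by rw [map_add] at hγ; simpa [hr, Finsupp.weight_single] using hγ)
          (by rw [map_add] at hγm; simpa [hl, Finsupp.weight_single] using hγm) _ (hT F hF α)
        rw [leftDeriv, MvPowerSeries.coeff_pderiv] at h1
        exact (mul_eq_zero.mp h1).resolve_right (Nat.cast_add_one_ne_zero _)
  intro F hF
  ext γ
  exact key _ _ γ rfl rfl F hF

end Toda
end

noncomputable section

namespace Toda

/-! ### The coefficients of `exp (ξ(t - t', z))` -/

/-- The coefficients of `exp (ξ(t^{(a)} - t'^{(a)}, w))`, indexed by integers. -/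
def xiCoeff (a : Fin 2) (k : ℤ) : Times₂ := if 0 ≤ k then expXiDiff a k.toNat else 0

/-- `t_n^{(a)} - t'_n^{(a)}`. -/
def timeDiff (a : Fin 2) (n : ℕ+) : Times₂ :=
  MvPowerSeries.X (Sum.inl (a, n)) - MvPowerSeries.X (Sum.inr (a, n))

theorem xiCoeff_of_neg (a : Fin 2) {k : ℤ} (hk : k < 0) : xiCoeff a k = 0 := if_neg (by omega)

theorem xiCoeff_natCast (a : Fin 2) (k : ℕ) : xiCoeff a k = expXiDiff a k := by
  rw [xiCoeff, if_pos (by omega), Int.toNat_natCast]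

theorem xiCoeff_zero (a : Fin 2) : xiCoeff a 0 = 1 := by
  rw [← Nat.cast_zero, xiCoeff_natCast, expXiDiff, expCoeff_zero]

/-- The range `N` may be any bound for `k`, the extra terms being zero; this lets several
coefficients be compared over one range. -/
theorem smul_xiCoeff (a : Fin 2) (N : ℕ) (k : ℤ) (hk : k ≤ N) : (k : ℂ) • xiCoeff a k =
    ∑ j ∈ Finset.range N, ((j : ℂ) + 1) •
      (timeDiff a (Nat.succPNat j) * xiCoeff a (k - 1 - j)) := by
  rcases lt_trichotomy k 0 with h | rfl | h
  · rw [xiCoeff_of_neg a h, smul_zero, Finset.sum_eq_zero]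
    intro j _
    rw [xiCoeff_of_neg a (by omega), mul_zero, smul_zero]
  · rw [Int.cast_zero, zero_smul, Finset.sum_eq_zero]
    intro j _
    rw [xiCoeff_of_neg a (by omega), mul_zero, smul_zero]
  · obtain ⟨m, rfl⟩ : ∃ m : ℕ, k = ((m + 1 : ℕ) : ℤ) := ⟨k.toNat - 1, by omega⟩
    have h1 := expCoeff_succ (timeDiff a) m
    rw [xiCoeff_natCast]
    push_cast
    refine h1.trans ?_
    rw [← Finset.sum_subset (Finset.range_subset_range.mpr (by omega : m + 1 ≤ N))]
    · refine Finset.sum_congr rfl fun j hj => ?_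
      rw [Finset.mem_range] at hj
      rw [show (m : ℤ) + 1 - 1 - j = ((m - j : ℕ) : ℤ) by omega, xiCoeff_natCast]
      rfl
    · intro j _ hj
      rw [Finset.mem_range] at hj
      rw [xiCoeff_of_neg a (by omega), mul_zero, smul_zero]

theorem leftDeriv_timeDiff (α : TimeIdx) (a : Fin 2) (n : ℕ+) :
    leftDeriv α (timeDiff a n) = if α = (a, n) then 1 else 0 := by
  rw [leftDeriv, timeDiff, map_sub,
    MvPowerSeries.pderiv_X_of_ne (i := Sum.inl α) (j := Sum.inr (a, n)) (by simp), sub_zero]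
  split_ifs with h
  · rw [h, MvPowerSeries.pderiv_X_self]
  · rw [MvPowerSeries.pderiv_X_of_ne]
    simpa [eq_comm] using h

/-- Formally `∂ e^ξ = z ^ n e^ξ`. The induction differentiates the recursion: the term hit in
`timeDiff` supplies the missing multiple `n` of the shifted coefficient. -/
theorem leftDeriv_xiCoeff (α : TimeIdx) (a : Fin 2) (k : ℤ) :
    leftDeriv α (xiCoeff a k) = if α.1 = a then xiCoeff a (k - (α.2 : ℕ)) else 0 := by
  have key : ∀ N : ℕ, ∀ k : ℤ, k ≤ N →
      leftDeriv α (xiCoeff a k) = if α.1 = a then xiCoeff a (k - (α.2 : ℕ)) else 0 := by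
    have hp := α.2.pos
    intro N
    induction N with
    | zero =>
      intro k hk
      rw [xiCoeff_of_neg a (k := k - _) (by omega), ite_self]
      rcases lt_or_eq_of_le hk with h | rfl
      · rw [xiCoeff_of_neg a h, map_zero]
      · rw [Nat.cast_zero, xiCoeff_zero, Derivation.map_one_eq_zero]
    | succ N ih =>
      intro k hk
      rcases lt_or_eq_of_le hk with h | hkN
      · exact ih k (by omega)
      have hk0 : (k : ℂ) ≠ 0 := by exact_mod_cast (by omega : k ≠ 0)
      have h1 := congrArg (leftDeriv α) (smul_xiCoeff a (N + 1) k hk)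
      rw [Derivation.map_smul, map_sum] at h1
      refine smul_right_injective _ hk0 (h1.trans ?_)
      have h2 : ∀ j ∈ Finset.range (N + 1), leftDeriv α (((j : ℂ) + 1) •
          (timeDiff a (Nat.succPNat j) * xiCoeff a (k - 1 - j))) =
          (if j = (α.2 : ℕ) - 1 then
            if α.1 = a then ((α.2 : ℕ) : ℂ) • xiCoeff a (k - (α.2 : ℕ)) else 0 else 0) +
          if α.1 = a then ((j : ℂ) + 1) •
            (timeDiff a (Nat.succPNat j) * xiCoeff a (k - (α.2 : ℕ) - 1 - j)) else 0 := by
        intro j hj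
        rw [Derivation.map_smul, Derivation.leibniz, smul_add, add_comm, leftDeriv_timeDiff,
          ih _ (by omega)]
        congr 1
        · by_cases hj' : j = (α.2 : ℕ) - 1
          · rw [if_pos hj']
            have h3 : Nat.succPNat j = α.2 := PNat.eq (by simp only [Nat.succPNat_coe]; omega)
            rw [h3]
            by_cases ha : α.1 = a
            · rw [if_pos (show α = (a, α.2) from Prod.ext ha rfl), if_pos ha, smul_eq_mul, mul_one,
                show k - 1 - j = k - (α.2 : ℕ) by omega,
                show (j : ℂ) + 1 = ((α.2 : ℕ) : ℂ) by exact_mod_cast (by omega)]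
            · rw [if_neg (fun h => ha (congrArg Prod.fst h)), if_neg ha, smul_zero, smul_zero]
          · rw [if_neg hj', if_neg, smul_zero, smul_zero]
            intro h
            have := congrArg (fun x : TimeIdx => (x.2 : ℕ)) h
            simp only [Nat.succPNat_coe] at this
            omega
        · split_ifs
          · rw [smul_eq_mul, show k - 1 - j - ((α.2 : ℕ) : ℤ) = k - (α.2 : ℕ) - 1 - j by ring]
          · rw [smul_zero, smul_zero]
      rw [Finset.sum_congr rfl h2, Finset.sum_add_distrib, Finset.sum_ite_eq']
      by_cases ha : α.1 = a
      · simp only [if_pos ha]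
        rw [← smul_xiCoeff a (N + 1) (k - (α.2 : ℕ)) (by omega)]
        split_ifs with h3
        · rw [← add_smul]
          congr 1
          push_cast
          ring
        · rw [Finset.mem_range] at h3
          rw [xiCoeff_of_neg a (by omega)]
          simp
      · simp only [if_neg ha, ite_self, Finset.sum_const_zero, add_zero, smul_zero]
  exact key k.toNat k (by omega)

theorem diag_xiCoeff (a : Fin 2) (k : ℤ) : diag (xiCoeff a k) = if k = 0 then 1 else 0 := by
  split_ifs with h
  · rw [h, xiCoeff_zero, map_one]
  · have hk : (k : ℂ) ≠ 0 := by exact_mod_cast h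
    have h1 := congrArg diag (smul_xiCoeff a k.toNat k (by omega))
    rw [map_smul, map_sum, Finset.sum_eq_zero] at h1
    · exact (smul_eq_zero.mp h1).resolve_left hk
    · intro j _
      have : diag (timeDiff a (Nat.succPNat j)) = 0 := by
        rw [diag, timeDiff, map_sub, MvPowerSeries.rename_X, MvPowerSeries.rename_X]
        exact sub_self _
      rw [map_smul, map_mul, this, zero_mul, smul_zero]

/-- The weight of a monomial, `t_n` having weight `n`. -/
def timeWeight : (TimeIdx ⊕ TimeIdx →₀ ℕ) →+ ℕ :=
  Finsupp.weight (Sum.elim (fun α : TimeIdx => (α.2 : ℕ)) fun α : TimeIdx => (α.2 : ℕ))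

/-- `F` has only terms of weight at least `k`. -/
def HighWeight (k : ℤ) (F : Times₂) : Prop :=
  ∀ γ, (timeWeight γ : ℤ) < k → MvPowerSeries.coeff γ F = 0

theorem HighWeight.mul {k l : ℤ} {F G : Times₂} (hF : HighWeight k F) (hG : HighWeight l G) :
    HighWeight (k + l) (F * G) := by
  classical
  intro γ hγ
  rw [MvPowerSeries.coeff_mul]
  refine Finset.sum_eq_zero fun p hp => ?_
  rw [Finset.HasAntidiagonal.mem_antidiagonal] at hp
  rw [← hp, map_add] at hγ
  by_cases h : (timeWeight p.1 : ℤ) < k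
  · rw [hF _ h, zero_mul]
  · rw [hG _ (by push_cast at hγ; omega), mul_zero]

theorem highWeight_zero (F : Times₂) : HighWeight 0 F := fun γ hγ => by omega

theorem highWeight_timeDiff (a : Fin 2) (n : ℕ+) : HighWeight n (timeDiff a n) := by
  classical
  intro γ hγ
  have h : ∀ x : TimeIdx ⊕ TimeIdx, timeWeight (Finsupp.single x 1) = (n : ℕ) →
      MvPowerSeries.coeff γ (MvPowerSeries.X x : Times₂) = 0 := by
    intro x hx
    rw [MvPowerSeries.coeff_X, if_neg]
    rintro rfl
    rw [hx] at hγ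
    omega
  rw [timeDiff, map_sub, h, h, sub_zero]
  · simp [timeWeight, Finsupp.weight_single]
  · simp [timeWeight, Finsupp.weight_single]

/-- With `t_n` of weight `n`, a fixed monomial occurs in only finitely many coefficients of the
exponential; this is what makes residues coefficientwise finite. -/
theorem highWeight_xiCoeff (a : Fin 2) (k : ℤ) : HighWeight k (xiCoeff a k) := by
  have key : ∀ N : ℕ, ∀ k : ℤ, k ≤ N → HighWeight k (xiCoeff a k) := by
    intro N
    induction N with
    | zero => intro k hk γ hγ; omega
    | succ N ih =>
      intro k hk γ hγ
      rcases lt_or_eq_of_le hk with h | hkN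
      · exact ih k (by omega) γ hγ
      have hk0 : (k : ℂ) ≠ 0 := by exact_mod_cast (by omega : k ≠ 0)
      have h1 := congrArg (MvPowerSeries.coeff γ) (smul_xiCoeff a (N + 1) k hk)
      rw [MvPowerSeries.coeff_smul, map_sum, Finset.sum_eq_zero] at h1
      · exact (smul_eq_zero.mp h1).resolve_left hk0
      · intro j _
        rw [MvPowerSeries.coeff_smul, (highWeight_timeDiff a _).mul (ih (k - 1 - j) (by omega)),
          mul_zero]
        simp only [Nat.succPNat_coe]
        push_cast
        omega
  exact key k.toNat k (by omega)

/-! ### Residues -/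

/-- The coefficient of `z⁻¹` in `∑ f_n(t) z ^ n ∑ g_m(t') z ^ (-m - 1) e^{ξ(t - t', z^{± 1})}`. -/
def residue (j : Fin 2) (f g : Fn) : Times₂ := fun μ =>
  ∑ᶠ e : ℤ × ℤ, MvPowerSeries.coeff μ
    (atLeft (f e.1) * atRight (g (e.1 + sgn j * e.2)) * xiCoeff j e.2)

theorem coeff_residue (j : Fin 2) (f g : Fn) (μ : TimeIdx ⊕ TimeIdx →₀ ℕ) :
    MvPowerSeries.coeff μ (residue j f g) = ∑ᶠ e : ℤ × ℤ, MvPowerSeries.coeff μ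
      (atLeft (f e.1) * atRight (g (e.1 + sgn j * e.2)) * xiCoeff j e.2) := rfl

/-- The one-sided supports and the weight bound confine both summation indices. The offset `l` is
needed because a derivative shifts the index of the exponential. -/
theorem finite_support_residue (j : Fin 2) {f g : Fn} (hf : BddSide (sgn j) f)
    (hg : BddSide (-sgn j) g) (μ : TimeIdx ⊕ TimeIdx →₀ ℕ) (l : ℤ) :
    (Function.support fun e : ℤ × ℤ => MvPowerSeries.coeff μ
      (atLeft (f e.1) * atRight (g (e.1 + sgn j * e.2)) * xiCoeff j (e.2 - l))).Finite := by
  obtain ⟨N, hN⟩ := hf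
  obtain ⟨M, hM⟩ := hg
  set W : ℤ := timeWeight μ + l with hW
  refine ((Set.finite_Icc (min (-M - W) (-N)) (max N (M + W))).prod (Set.finite_Icc l W)).subset
    fun e he => ?_
  by_contra h
  refine he ?_
  have h0 : ∀ f, atLeft f = 0 ↔ f = 0 := fun f =>
    ⟨fun h => by rw [← diag_atLeft f, h, map_zero], fun h => by rw [h, atLeft, map_zero]⟩
  by_cases h1 : N < sgn j * e.1
  · simp only [hN _ h1, atLeft, map_zero, zero_mul]
  by_cases h2 : M < -sgn j * (e.1 + sgn j * e.2)
  · simp only [hM _ h2, atRight, map_zero, mul_zero, zero_mul]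
  by_cases h3 : e.2 - l < 0
  · simp only [xiCoeff_of_neg j h3, map_zero, mul_zero]
  by_cases h4 : W < e.2
  · refine (highWeight_zero _).mul (highWeight_xiCoeff j (e.2 - l)) _ ?_
    omega
  refine absurd ?_ h
  rw [Set.mem_prod, Set.mem_Icc, Set.mem_Icc]
  rcases sgn_or j with hj | hj <;> rw [hj] at h1 h2 <;> omega

/-- The derivative falls on `f` or on the exponential; reindexing moves the resulting power of `z`
from the exponential to `f`, which gives `nabla`. -/
theorem leftDeriv_residue (j : Fin 2) {f g : Fn} (hf : BddSide (sgn j) f)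
    (hg : BddSide (-sgn j) g) (α : TimeIdx) :
    leftDeriv α (residue j f g) = residue j (nabla 1 j α f) g := by
  ext μ
  have hfin := fun l => finite_support_residue j hf hg μ l
  have hfin1 : ∀ e : ℤ × ℤ, MvPowerSeries.coeff μ (leftDeriv α
      (atLeft (f e.1) * atRight (g (e.1 + sgn j * e.2)) * xiCoeff j e.2)) =
      MvPowerSeries.coeff μ (atLeft (derivOp 1 α f e.1) * atRight (g (e.1 + sgn j * e.2)) *
        xiCoeff j e.2) +
      if α.1 = j then MvPowerSeries.coeff μ (atLeft (f e.1) * atRight (g (e.1 + sgn j * e.2)) *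
        xiCoeff j (e.2 - (α.2 : ℕ))) else 0 := by
    intro e
    rw [Derivation.leibniz, Derivation.leibniz, leftDeriv_atLeft, leftDeriv_atRight,
      leftDeriv_xiCoeff]
    simp only [derivOp_apply, one_smul, smul_eq_mul, mul_zero, zero_add, mul_ite]
    rw [map_add, add_comm]
    congr 1
    · congr 1; ring
    · split_ifs
      · rfl
      · rw [map_zero]
  have h1 : MvPowerSeries.coeff μ (leftDeriv α (residue j f g)) =
      ∑ᶠ e : ℤ × ℤ, MvPowerSeries.coeff μ (leftDeriv α
        (atLeft (f e.1) * atRight (g (e.1 + sgn j * e.2)) * xiCoeff j e.2)) := by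
    rw [leftDeriv, MvPowerSeries.coeff_pderiv, coeff_residue, finsum_mul]
    refine finsum_congr fun e => ?_
    rw [MvPowerSeries.coeff_pderiv]
  rw [h1, coeff_residue, finsum_congr hfin1]
  have h2 := finite_support_residue j (hf.derivOp 1 α) hg μ 0
  simp only [sub_zero] at h2
  by_cases hα : α.1 = j
  · simp only [if_pos hα]
    have h3 : ∀ e : ℤ × ℤ, MvPowerSeries.coeff μ (atLeft (nabla 1 j α f e.1) *
        atRight (g (e.1 + sgn j * e.2)) * xiCoeff j e.2) =
        MvPowerSeries.coeff μ (atLeft (derivOp 1 α f e.1) *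
          atRight (g (e.1 + sgn j * e.2)) * xiCoeff j e.2) +
        MvPowerSeries.coeff μ (atLeft (f (e.1 + -(sgn j * (α.2 : ℕ)))) *
          atRight (g (e.1 + sgn j * e.2)) * xiCoeff j e.2) := by
      intro e
      rw [nabla, if_pos hα, LinearMap.add_apply, Pi.add_apply, shiftOp_apply, atLeft, map_add,
        add_mul, add_mul, map_add]
      rfl
    have h4 := finite_support_residue j (hf.shiftOp (-(sgn j * (α.2 : ℕ)))) hg μ 0
    simp only [sub_zero, shiftOp_apply] at h4
    rw [finsum_congr h3, finsum_add_distrib h2 (hfin _), finsum_add_distrib h2 h4]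
    congr 1
    rw [← finsum_comp_equiv (Equiv.prodCongr (Equiv.addRight (-(sgn j * (α.2 : ℕ))))
      (Equiv.addRight ((α.2 : ℕ) : ℤ)))]
    refine finsum_congr fun e => ?_
    simp only [Equiv.prodCongr_apply, Prod.map, Equiv.coe_addRight, add_sub_cancel_right]
    rw [show e.1 + -(sgn j * ((α.2 : ℕ) : ℤ)) + sgn j * (e.2 + ((α.2 : ℕ) : ℤ)) =
      e.1 + sgn j * e.2 by ring]
  · refine finsum_congr fun e => ?_
    rw [if_neg hα, add_zero, nabla, if_neg hα, add_zero]

theorem finsum_eq_finsum_comp {ι κ M : Type*} [AddCommMonoid M] {F : ι → M} {g : κ → ι}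
    (hg : Function.Injective g) (h : ∀ i, i ∉ Set.range g → F i = 0) :
    ∑ᶠ i, F i = ∑ᶠ k, F (g k) := by
  rw [← finsum_mem_range hg]
  refine finsum_congr fun i => ?_
  by_cases hi : i ∈ Set.range g
  · simp [hi]
  · simp [hi, h i hi]

/-- On the diagonal the exponential is `1`, so only its zeroth coefficient survives. -/
theorem diag_residue (j : Fin 2) {f g : Fn} (hf : BddSide (sgn j) f)
    (hg : BddSide (-sgn j) g) : diag (residue j f g) = pair f g := by
  ext d
  rw [diag, MvPowerSeries.coeff_rename]
  simp only [coeff_residue]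
  rw [← finsum_sum_comm]
  · have h1 : ∀ e : ℤ × ℤ, (∑ μ ∈ (Filter.TendstoCofinite.finite_preimage_singleton
        (Finsupp.mapDomain (Sum.elim id id : TimeIdx ⊕ TimeIdx → TimeIdx)) d).toFinset,
        MvPowerSeries.coeff μ (atLeft (f e.1) * atRight (g (e.1 + sgn j * e.2)) *
          xiCoeff j e.2)) =
        if e.2 = 0 then MvPowerSeries.coeff d (f e.1 * g e.1) else 0 := by
      intro e
      rw [← MvPowerSeries.coeff_rename, ← diag, map_mul diag, map_mul diag, diag_atLeft,
        diag_atRight,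
        diag_xiCoeff]
      split_ifs with h
      · rw [h, mul_zero, add_zero, mul_one]
      · rw [mul_zero, map_zero]
    rw [finsum_congr h1, finsum_eq_finsum_comp (g := fun n : ℤ => ((n, 0) : ℤ × ℤ))
      (fun a b h => (Prod.ext_iff.mp h).1), pair, map_finsum _ (hf.finite_support (sgn_or j) hg)]
    · simp
    · intro e he
      rw [if_neg]
      intro h
      exact he ⟨e.1, Prod.ext rfl h.symm⟩
  · intro μ _
    have := finite_support_residue j hf hg μ 0
    simp only [sub_zero] at this
    exact this

end Toda
end

noncomputable section

namespace Toda

/-! ### The bilinear equation on the level of wave functions -/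

/-- The pairs obtained from `(f₁, f₂)` by the evolution of the two wave functions. -/
inductive Reach (f₁ f₂ : Fn) : Fn → Fn → Prop
  | refl : Reach f₁ f₂ f₁ f₂
  | step (α : TimeIdx) {u v : Fn} : Reach f₁ f₂ u v →
      Reach f₁ f₂ (nabla 1 0 α u) (nabla 1 1 α v)

/-- The bilinear equation for wave functions `f₁, f₂` and adjoint wave functions `g₁, g₂`. -/
def Compat (f₁ f₂ g₁ g₂ : Fn) : Prop := ∀ u v, Reach f₁ f₂ u v → pair u g₁ = pair v g₂

theorem Reach.bddSide {f₁ f₂ u v : Fn} (h : Reach f₁ f₂ u v) (h₁ : BddSide (sgn 0) f₁)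
    (h₂ : BddSide (sgn 1) f₂) : BddSide (sgn 0) u ∧ BddSide (sgn 1) v := by
  induction h with
  | refl => exact ⟨h₁, h₂⟩
  | step α _ ih => exact ⟨bddSide_nabla 1 0 α ih.1, bddSide_nabla 1 1 α ih.2⟩

/-- Taylor expansion in `t` about the diagonal: derivatives of residues are residues of evolved
rows, and their diagonal values are pairings. -/
theorem residue_eq_iff_compat {f₁ f₂ g₁ g₂ : Fn} (hf₁ : BddSide (sgn 0) f₁)
    (hf₂ : BddSide (sgn 1) f₂) (hg₁ : BddSide (-sgn 0) g₁) (hg₂ : BddSide (-sgn 1) g₂) :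
    residue 0 f₁ g₁ = residue 1 f₂ g₂ ↔ Compat f₁ f₂ g₁ g₂ := by
  constructor
  · intro h u v huv
    have key : residue 0 u g₁ = residue 1 v g₂ := by
      induction huv with
      | refl => exact h
      | step α huv ih =>
        obtain ⟨hu, hv⟩ := huv.bddSide hf₁ hf₂
        rw [← leftDeriv_residue 0 hu hg₁, ← leftDeriv_residue 1 hv hg₂, ih]
    obtain ⟨hu, hv⟩ := huv.bddSide hf₁ hf₂
    rw [← diag_residue 0 hu hg₁, ← diag_residue 1 hv hg₂, key]
  · intro h
    rw [← sub_eq_zero]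
    refine eq_zero_of_diag_eq_zero
      (T := {F | ∃ u v, Reach f₁ f₂ u v ∧ F = residue 0 u g₁ - residue 1 v g₂}) ?_ ?_ _
      ⟨f₁, f₂, Reach.refl, rfl⟩
    · rintro F ⟨u, v, huv, rfl⟩ α
      obtain ⟨hu, hv⟩ := huv.bddSide hf₁ hf₂
      exact ⟨_, _, huv.step α, by
        rw [map_sub, leftDeriv_residue 0 hu hg₁, leftDeriv_residue 1 hv hg₂]⟩
    · rintro F ⟨u, v, huv, rfl⟩
      obtain ⟨hu, hv⟩ := huv.bddSide hf₁ hf₂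
      rw [map_sub, diag_residue 0 hu hg₁, diag_residue 1 hv hg₂, h u v huv, sub_self]

theorem nabla_smul (j : Fin 2) (α : TimeIdx) (c : Times) (v : Fn) :
    nabla 1 j α (c • v) = c • nabla 1 j α v + MvPowerSeries.pderiv ℂ α c • v := by
  funext n
  simp only [nabla, LinearMap.add_apply, Pi.add_apply, derivOp_apply, Pi.smul_apply, smul_eq_mul,
    Derivation.leibniz, one_smul]
  split_ifs
  · simp only [shiftOp_apply, Pi.smul_apply, smul_eq_mul]; ring
  · simp only [LinearMap.zero_apply, Pi.zero_apply]; ring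

/-- The linear span of the pairs obtained by evolution. -/
inductive ReachSpan (f₁ f₂ : Fn) : Fn → Fn → Prop
  | of {u v : Fn} : Reach f₁ f₂ u v → ReachSpan f₁ f₂ u v
  | add {u v u' v' : Fn} : ReachSpan f₁ f₂ u v → ReachSpan f₁ f₂ u' v' →
      ReachSpan f₁ f₂ (u + u') (v + v')
  | smul (c : Times) {u v : Fn} : ReachSpan f₁ f₂ u v → ReachSpan f₁ f₂ (c • u) (c • v)

theorem ReachSpan.nabla {f₁ f₂ u v : Fn} (h : ReachSpan f₁ f₂ u v) (α : TimeIdx) :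
    ReachSpan f₁ f₂ (nabla 1 0 α u) (nabla 1 1 α v) := by
  induction h with
  | of h => exact ReachSpan.of (h.step α)
  | add _ _ h h' => rw [map_add, map_add]; exact h.add h'
  | smul c h h' => rw [nabla_smul, nabla_smul]; exact (h'.smul c).add (h.smul _)

/-- By the Leibniz rule the evolution of `c • f` stays in the span of the evolved pairs over
functions of `t`, and the pairing is linear over these functions. This permits division of the
bilinear equation by tau functions. -/
theorem Compat.smul_left {f₁ f₂ g₁ g₂ : Fn} (h : Compat f₁ f₂ g₁ g₂) (hf₁ : BddSide (sgn 0) f₁)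
    (hf₂ : BddSide (sgn 1) f₂) (hg₁ : BddSide (-sgn 0) g₁) (hg₂ : BddSide (-sgn 1) g₂)
    (c : Times) : Compat (c • f₁) (c • f₂) g₁ g₂ := by
  intro u v huv
  have hmem : ReachSpan f₁ f₂ u v := by
    induction huv with
    | refl => exact (ReachSpan.of Reach.refl).smul c
    | step α _ ih => exact ih.nabla α
  have hpair : (BddSide (sgn 0) u ∧ BddSide (sgn 1) v) ∧ pair u g₁ = pair v g₂ := by
    clear huv
    induction hmem with
    | of hx => exact ⟨hx.bddSide hf₁ hf₂, h _ _ hx⟩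
    | add _ _ hx hy =>
      refine ⟨⟨hx.1.1.add hy.1.1, hx.1.2.add hy.1.2⟩, ?_⟩
      rw [pair_add_left (sgn_or 0) hx.1.1 hy.1.1 hg₁, pair_add_left (sgn_or 1) hx.1.2 hy.1.2 hg₂,
        hx.2, hy.2]
    | smul a _ hx =>
      refine ⟨⟨hx.1.1.smul a, hx.1.2.smul a⟩, ?_⟩
      rw [pair_smul_left, pair_smul_left, hx.2]
  exact hpair.2

theorem Compat.smul_right {f₁ f₂ g₁ g₂ : Fn} (h : Compat f₁ f₂ g₁ g₂) (c : Times) :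
    Compat f₁ f₂ (c • g₁) (c • g₂) := fun u v huv => by
  rw [pair_smul_right, pair_smul_right, h u v huv]

theorem compat_smul_smul_iff {f₁ f₂ g₁ g₂ : Fn} (hf₁ : BddSide (sgn 0) f₁)
    (hf₂ : BddSide (sgn 1) f₂) (hg₁ : BddSide (-sgn 0) g₁) (hg₂ : BddSide (-sgn 1) g₂)
    {c c' d d' : Times} (hc : c' * c = 1) (hd : d' * d = 1) :
    Compat (c • f₁) (c • f₂) (d • g₁) (d • g₂) ↔ Compat f₁ f₂ g₁ g₂ := by
  refine ⟨fun h => ?_, fun h => (h.smul_left hf₁ hf₂ hg₁ hg₂ c).smul_right d⟩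
  have := (h.smul_left (hf₁.smul c) (hf₂.smul c) (hg₁.smul d) (hg₂.smul d) c').smul_right d'
  simpa only [smul_smul, hc, hd, one_smul] using this

/-! ### The residues of the tau function -/

/-- `τ(s + j, t - [z^{∓ 1}])`, as a series in `z`, times `z ^ s`. -/
def tauRow (τ : Fn) (j : Fin 2) (s : ℤ) : Fn := fun n =>
  intShift j (-1) (sgn j * (s - n)) (τ (s + (j : ℕ)))

/-- `τ(s + 1 - j, t + [z^{∓ 1}])`, as a series in `z⁻¹`, times `z ^ (-s)`. -/
def tauDualRow (τ : Fn) (j : Fin 2) (s : ℤ) : Fn := fun n =>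
  intShift j 1 (sgn j * (n - s)) (τ (s + 1 - (j : ℕ)))

theorem tauRow_eq {τ : Fn} (hτ : NonvanishingAtZero τ) (j : Fin 2) (s : ℤ) :
    tauRow τ j s = τ s • wave 1 τ j s := by
  funext n
  rw [Pi.smul_apply, smul_eq_mul, wave_eq, tauRow]
  linear_combination -intShift j (-1) (sgn j * (s - n)) (τ (s + (j : ℕ))) * hτ.mul_inv s

theorem tauDualRow_eq {τ : Fn} (hτ : NonvanishingAtZero τ) (j : Fin 2) (s : ℤ) :
    tauDualRow τ j s = τ (s + 1) • dual 1 τ j s := by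
  funext n
  rw [Pi.smul_apply, smul_eq_mul, dual_eq, tauDualRow]
  linear_combination -intShift j 1 (sgn j * (n - s)) (τ (s + 1 - (j : ℕ))) * hτ.mul_inv (s + 1)

/-- The residue condition determines the second exponent from the other two, so the triples are
parametrized by the power of `z` in the first factor and the order in the exponential. -/
theorem coeff_residue_intShift (j : Fin 2) (u v : Times) (s S : ℤ)
    (μ : TimeIdx ⊕ TimeIdx →₀ ℕ) :
    ∑ᶠ (e : ℕ × ℕ × ℕ) (_ : s - (S + 1) - sgn j * e.1 - sgn j * e.2.1 + sgn j * e.2.2 = -1),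
      MvPowerSeries.coeff μ (atLeft (timeShift j (-1) e.1 u) *
        atRight (timeShift j 1 e.2.1 v) * expXiDiff j e.2.2) =
    MvPowerSeries.coeff μ (residue j (fun n => intShift j (-1) (sgn j * (s - n)) u)
      fun n => intShift j 1 (sgn j * (n - S)) v) := by
  have hj := sgn_or j
  rw [coeff_residue, ← finsum_subtype_eq_finsum_cond
      (fun e : ℕ × ℕ × ℕ => s - (S + 1) - sgn j * e.1 - sgn j * e.2.1 + sgn j * e.2.2 = -1)
      (f := fun e : ℕ × ℕ × ℕ => MvPowerSeries.coeff μ (atLeft (timeShift j (-1) e.1 u) *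
        atRight (timeShift j 1 e.2.1 v) * expXiDiff j e.2.2)),
    finsum_eq_finsum_comp (g := fun e : {e : ℕ × ℕ × ℕ // s - (S + 1) - sgn j * e.1 -
      sgn j * e.2.1 + sgn j * e.2.2 = -1} => (s - sgn j * e.1.1, (e.1.2.2 : ℤ)))]
  · refine finsum_congr fun e => ?_
    obtain ⟨⟨a, b, c⟩, he⟩ := e
    simp only at he ⊢
    rw [show sgn j * (s - (s - sgn j * (a : ℤ))) = (a : ℤ) by
        rcases hj with h | h <;> rw [h] <;> ring,
      show sgn j * (s - sgn j * (a : ℤ) + sgn j * (c : ℤ) - S) = (b : ℤ) by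
        rcases hj with h | h <;> rw [h] at he ⊢ <;> omega,
      intShift_natCast, intShift_natCast, xiCoeff_natCast]
  · rintro ⟨⟨a, b, c⟩, he⟩ ⟨⟨a', b', c'⟩, he'⟩ h
    simp only [Prod.mk.injEq] at h he he'
    simp only [Subtype.mk.injEq, Prod.mk.injEq]
    rcases hj with hj | hj <;> rw [hj] at h he he' <;> omega
  · intro e he
    by_cases h1 : sgn j * (s - e.1) < 0
    · simp only [intShift_neg _ _ h1, atLeft, map_zero, zero_mul]
    by_cases h2 : sgn j * (e.1 + sgn j * e.2 - S) < 0
    · simp only [intShift_neg _ _ h2, atRight, map_zero, mul_zero, zero_mul]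
    by_cases h3 : e.2 < 0
    · rw [xiCoeff_of_neg j h3, mul_zero, map_zero]
    refine absurd ?_ he
    refine ⟨⟨((sgn j * (s - e.1)).toNat, (sgn j * (e.1 + sgn j * e.2 - S)).toNat, e.2.toNat), ?_⟩,
      ?_⟩
    · rcases hj with hj | hj <;> simp only [hj] at h1 h2 ⊢ <;> omega
    · refine Prod.ext ?_ ?_
      · rcases hj with hj | hj <;> simp only [hj] at h1 h2 ⊢ <;> omega
      · simp only; omega

theorem residueInfty_eq (τ : Fn) (s S : ℤ) :
    residueInfty τ s (S + 1) = residue 0 (tauRow τ 0 s) (tauDualRow τ 0 S) := by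
  ext μ
  have h1 : tauRow τ 0 s = fun n => intShift 0 (-1) (sgn 0 * (s - n)) (τ s) := by
    funext n; simp [tauRow]
  have h2 : tauDualRow τ 0 S = fun n => intShift 0 1 (sgn 0 * (n - S)) (τ (S + 1)) := by
    funext n; simp [tauDualRow]
  rw [h1, h2, ← coeff_residue_intShift]
  simp only [sgn, if_true, one_mul]
  rfl

theorem residueZero_eq (τ : Fn) (s S : ℤ) :
    residueZero τ s (S + 1) = residue 1 (tauRow τ 1 s) (tauDualRow τ 1 S) := by
  ext μ
  have h1 : tauRow τ 1 s = fun n => intShift 1 (-1) (sgn 1 * (s - n)) (τ (s + 1)) := by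
    funext n; simp [tauRow]
  have h2 : tauDualRow τ 1 S = fun n => intShift 1 1 (sgn 1 * (n - S)) (τ (S + 1 - 1)) := by
    funext n; simp [tauDualRow]
  rw [h1, h2, ← coeff_residue_intShift]
  simp only [sgn, one_ne_zero, if_false, neg_one_mul, sub_neg_eq_add, ← sub_eq_add_neg]
  rfl

theorem isTau_iff (τ : Fn) : IsTau τ ↔ NonvanishingAtZero τ ∧
    ∀ s S, Compat (wave 1 τ 0 s) (wave 1 τ 1 s) (dual 1 τ 0 S) (dual 1 τ 1 S) := by
  have key : ∀ hτ : NonvanishingAtZero τ, ∀ s S,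
      residueInfty τ s (S + 1) = residueZero τ s (S + 1) ↔
      Compat (wave 1 τ 0 s) (wave 1 τ 1 s) (dual 1 τ 0 S) (dual 1 τ 1 S) := by
    intro hτ s S
    have hP := fun j => (isTriangular_wave 1 hτ j).bddSide s
    have hQ := fun j => (isTriangular_dual 1 hτ j).bddSide S
    rw [residueInfty_eq, residueZero_eq]
    simp only [tauRow_eq hτ, tauDualRow_eq hτ]
    rw [residue_eq_iff_compat ((hP 0).smul _) ((hP 1).smul _) ((hQ 0).smul _) ((hQ 1).smul _)]
    exact compat_smul_smul_iff (hP 0) (hP 1) (hQ 0) (hQ 1) (hτ.inv_mul s) (hτ.inv_mul (S + 1))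
  constructor
  · exact fun h => ⟨h.nonvanishing, fun s S => (key h.nonvanishing s S).mp (h.bilinear s (S + 1))⟩
  · rintro ⟨hτ, h⟩
    refine ⟨hτ, fun s s' => ?_⟩
    have := (key hτ s (s' - 1)).mpr (h s (s' - 1))
    rwa [sub_add_cancel] at this

/-- Every pair reached from the waves is the image of both under one banded operator. By
orthogonality its pairings are coefficients of that operator, the same for both waves. -/
theorem TodaSys.isTau {τ : Fn} {A A' : TimeIdx → FnEnd} (h : TodaSys 1 τ A A') : IsTau τ := by
  refine (isTau_iff τ).mpr ⟨h.nonvanishing, fun s S u v huv => ?_⟩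
  have hP := fun j => (isTriangular_wave 1 h.nonvanishing j).bddSide
  have hQ := fun j => (isTriangular_dual 1 h.nonvanishing j).bddSide
  have key : ∃ G G', IsBand G G' ∧ u = colAct G (wave 1 τ 0) s ∧ v = colAct G (wave 1 τ 1) s := by
    induction huv with
    | refl => exact ⟨1, 1, IsBand.one, rfl, rfl⟩
    | step α _ ih =>
      obtain ⟨G, G', hG, rfl, rfl⟩ := ih
      exact ⟨_, _, (hG.commutator_derivOp 1 α).add (hG.mul (h.band α)),
        h.nabla_colAct_wave 0 α G s, h.nabla_colAct_wave 1 α G s⟩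
  obtain ⟨G, G', ⟨a, rfl, rfl⟩, rfl, rfl⟩ := key
  have h1 : ∀ j, pair (colAct (bandOp a) (wave 1 τ j) s) (dual 1 τ j S) =
      ∑ i ∈ a.support, a i s * if s + i = S then 1 else 0 := by
    intro j
    rw [colAct_bandOp, pair_sum_left (sgn_or j) _ (fun i _ => (hP j _).smul _) (hQ j S)]
    simp only [pair_smul_left, h.orth]
  rw [h1, h1]

end Toda
end

noncomputable section

namespace Toda

/-! ### The algebra of one-sided difference operators -/

namespace DiffOp

theorem mul_coeff (X Y : DiffOp) (n s : ℤ) :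
    (X * Y).coeff n s = ∑ᶠ i : ℤ, X.coeff i s * Y.coeff (n - i) (s + i) := rfl

theorem one_coeff (n s : ℤ) : (1 : DiffOp).coeff n s = if n = 0 then 1 else 0 := rfl

theorem mul_shift_coeff (X : DiffOp) (k n s : ℤ) : (X * shift k).coeff n s = X.coeff (n - k) s := by
  rw [mul_coeff, finsum_eq_single _ (n - k)]
  · simp [shift]
  · intro i hi
    simp only [shift]
    rw [if_neg (by omega), mul_zero]

theorem mul_ofFun_coeff (X : DiffOp) (f : Fn) (n s : ℤ) :
    (X * ofFun f).coeff n s = X.coeff n s * f (s + n) := by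
  rw [mul_coeff, finsum_eq_single _ n]
  · simp [ofFun]
  · intro i hi
    simp only [ofFun]
    rw [if_neg (by omega), mul_zero]

theorem ofFun_mul_coeff (X : DiffOp) (f : Fn) (n s : ℤ) :
    (ofFun f * X).coeff n s = f s * X.coeff n s := by
  rw [mul_coeff, finsum_eq_single _ 0]
  · simp [ofFun]
  · intro i hi
    simp only [ofFun]
    rw [if_neg hi, zero_mul]

theorem mul_one (X : DiffOp) : X * 1 = X := by
  ext n s : 3
  refine (mul_ofFun_coeff X 1 n s).trans ?_
  rw [Pi.one_apply, _root_.mul_one]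

theorem one_mul (X : DiffOp) : 1 * X = X := by
  ext n s : 3
  refine (ofFun_mul_coeff X 1 n s).trans ?_
  rw [Pi.one_apply, _root_.one_mul]

/-- Only the powers `Λ ^ n` with `η n ≤ d` occur. -/
def OneSided (η d : ℤ) (X : DiffOp) : Prop := ∀ n s, d < η * n → X.coeff n s = 0

theorem OneSided.mul {η d e : ℤ} {X Y : DiffOp} (hX : OneSided η d X) (hY : OneSided η e Y) :
    OneSided η (d + e) (X * Y) := by
  intro n s hn
  rw [mul_coeff]
  refine finsum_eq_zero_of_forall_eq_zero fun i => ?_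
  by_cases h : d < η * i
  · rw [hX i s h, zero_mul]
  · rw [hY (n - i) _ (by rw [mul_sub]; omega), mul_zero]

theorem oneSided_shift (η k : ℤ) : OneSided η (η * k) (shift k) := by
  intro n s hn
  exact if_neg (by rintro rfl; omega)

theorem oneSided_one (η : ℤ) : OneSided η 0 1 := by
  intro n s hn
  exact if_neg (by rintro rfl; omega)

/-- Three bounds on the same side leave finitely many nonzero terms in each coefficient, which
justifies exchanging the sums. -/
theorem mul_assoc_of_oneSided {η : ℤ} (hη : η = 1 ∨ η = -1) {a b c : ℤ} {X Y Z : DiffOp}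
    (hX : OneSided η a X) (hY : OneSided η b Y) (hZ : OneSided η c Z) :
    X * Y * Z = X * (Y * Z) := by
  ext n s : 3
  have hfin : (Function.support fun e : ℤ × ℤ =>
      X.coeff e.1 s * Y.coeff (e.2 - e.1) (s + e.1) * Z.coeff (n - e.2) (s + e.2)).Finite := by
    set B : ℤ := |a| + |b| + |c| + |n| with hB
    have := le_abs_self a
    have := le_abs_self b
    have := le_abs_self c
    have := le_abs_self n
    have := neg_abs_le n
    have := abs_nonneg a
    have := abs_nonneg b
    have := abs_nonneg c
    refine ((Set.finite_Icc (-(3 * B)) (3 * B)).prod (Set.finite_Icc (-(3 * B)) (3 * B))).subset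
      fun e he => ?_
    by_contra h
    refine he ?_
    by_cases h1 : a < η * e.1
    · simp only [hX _ s h1, zero_mul]
    by_cases h2 : b < η * (e.2 - e.1)
    · simp only [hY _ _ h2, mul_zero, zero_mul]
    by_cases h3 : c < η * (n - e.2)
    · simp only [hZ _ _ h3, mul_zero]
    refine absurd ?_ h
    rw [Set.mem_prod, Set.mem_Icc, Set.mem_Icc]
    rcases hη with rfl | rfl <;> omega
  have h1 : (X * Y * Z).coeff n s = ∑ᶠ k : ℤ, ∑ᶠ i : ℤ,
      X.coeff i s * Y.coeff (k - i) (s + i) * Z.coeff (n - k) (s + k) := by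
    rw [mul_coeff]
    refine finsum_congr fun k => ?_
    rw [mul_coeff, finsum_mul]
  have h2 : (X * (Y * Z)).coeff n s = ∑ᶠ i : ℤ, ∑ᶠ k : ℤ,
      X.coeff i s * Y.coeff (k - i) (s + i) * Z.coeff (n - k) (s + k) := by
    rw [mul_coeff]
    refine finsum_congr fun i => ?_
    rw [mul_coeff, mul_finsum, ← finsum_comp_equiv (Equiv.subRight i)]
    refine finsum_congr fun k => ?_
    simp only [Equiv.subRight_apply]
    rw [show n - i - (k - i) = n - k by ring, show s + i + (k - i) = s + k by ring, mul_assoc]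
  rw [h1, h2, ← finsum_curry (fun e : ℤ × ℤ =>
      X.coeff e.1 s * Y.coeff (e.2 - e.1) (s + e.1) * Z.coeff (n - e.2) (s + e.2)) hfin,
    ← finsum_comp_equiv (Equiv.prodComm ℤ ℤ), finsum_curry]
  · rfl
  · exact hfin.preimage (Equiv.prodComm ℤ ℤ).injective.injOn

/-- The inverse of `∑_{n ≥ 0} a_n Λ ^ (ε n)`. -/
def triInv (ε : ℤ) (A : DiffOp) : DiffOp :=
  ⟨fun n s => if 0 ≤ ε * n then invCoeff ε A (ε * n).toNat s else 0⟩

theorem invMinus_eq (A : DiffOp) : A.invMinus = A.triInv (-1) := by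
  ext n s : 3
  simp only [invMinus, triInv, neg_one_mul, Int.neg_nonneg]

theorem invPlus_eq (A : DiffOp) : A.invPlus = A.triInv 1 := by
  ext n s : 3
  simp only [invPlus, triInv, _root_.one_mul]

/-- `A` has the form `∑_{n ≥ 0} a_n Λ ^ (ε n)` with `a_0` invertible. -/
structure IsTri (ε : ℤ) (A : DiffOp) : Prop where
  oneSided : OneSided (-ε) 0 A
  nonvanishing : NonvanishingAtZero (A.coeff 0)

theorem invCoeff_zero (ε : ℤ) (A : DiffOp) (s : ℤ) : invCoeff ε A 0 s = (A.coeff 0 s)⁻¹ := by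
  rw [invCoeff]

theorem mul_invCoeff_succ {ε : ℤ} {A : DiffOp} (hA : NonvanishingAtZero (A.coeff 0)) (m : ℕ)
    (s : ℤ) : A.coeff 0 s * invCoeff ε A (m + 1) s = -∑ i ∈ Finset.range (m + 1),
      A.coeff (ε * (i + 1)) s * invCoeff ε A (m - i) (s + ε * (i + 1)) := by
  rw [invCoeff]
  dsimp only
  rw [Fin.sum_univ_eq_sum_range (fun i : ℕ =>
    A.coeff (ε * (i + 1)) s * invCoeff ε A (m - i) (s + ε * (i + 1)))]
  linear_combination -(∑ i ∈ Finset.range (m + 1),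
    A.coeff (ε * (i + 1)) s * invCoeff ε A (m - i) (s + ε * (i + 1))) * hA.mul_inv s

theorem IsTri.triInv {ε : ℤ} {A : DiffOp} (hA : IsTri ε A) : IsTri ε (A.triInv ε) where
  oneSided n s hn := if_neg (by rw [neg_mul] at hn; omega)
  nonvanishing s := by
    have : (A.triInv ε).coeff 0 s = (A.coeff 0 s)⁻¹ := by
      simp [DiffOp.triInv, invCoeff_zero]
    rw [this, MvPowerSeries.constantCoeff_inv]
    exact inv_ne_zero (hA.nonvanishing s)

theorem IsTri.mul_triInv {ε : ℤ} (hε : ε = 1 ∨ ε = -1) {A : DiffOp} (hA : IsTri ε A) :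
    A * A.triInv ε = 1 := by
  ext n s : 3
  have hε2 : ∀ x : ℤ, ε * (ε * x) = x := fun x => by
    rcases hε with rfl | rfl <;> ring
  have hinj : Function.Injective fun k : ℕ => ε * (k : ℤ) := fun a b h => by
    have := congrArg (ε * ·) h
    simp only [hε2] at this
    exact_mod_cast this
  rw [mul_coeff, finsum_eq_finsum_comp hinj, one_coeff]
  · have h1 : ∀ k : ℕ, A.coeff (ε * k) s * (A.triInv ε).coeff (n - ε * k) (s + ε * k) =
        if (k : ℤ) ≤ ε * n then A.coeff (ε * k) s *
          invCoeff ε A ((ε * n).toNat - k) (s + ε * k) else 0 := by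
      intro k
      simp only [DiffOp.triInv, mul_sub, hε2, Int.sub_nonneg, mul_ite, mul_zero]
      rw [show (ε * n - k).toNat = (ε * n).toNat - k by omega]
    rw [finsum_congr h1]
    rcases lt_or_ge (ε * n) 0 with hn | hn
    · rw [if_neg (by rintro rfl; simp at hn)]
      exact finsum_eq_zero_of_forall_eq_zero fun k => if_neg (by omega)
    · obtain ⟨m, hm⟩ := Int.eq_ofNat_of_zero_le hn
      rw [finsum_eq_sum_of_support_subset _ (s := Finset.range (m + 1))]
      · have h2 : ∀ k ∈ Finset.range (m + 1), (if (k : ℤ) ≤ ε * n then A.coeff (ε * k) s *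
            invCoeff ε A ((ε * n).toNat - k) (s + ε * k) else 0) =
            A.coeff (ε * k) s * invCoeff ε A (m - k) (s + ε * k) := by
          intro k hk
          rw [Finset.mem_range] at hk
          rw [if_pos (by omega), hm, Int.toNat_natCast]
        rw [Finset.sum_congr rfl h2]
        rcases m with _ | m
        · have : n = 0 := by have := hε2 n; rw [hm] at this; simpa using this.symm
          rw [if_pos this]
          simp [invCoeff_zero, hA.nonvanishing.mul_inv s]
        · rw [if_neg (by rintro rfl; simp at hm; omega), Finset.sum_range_succ']
          have := mul_invCoeff_succ (ε := ε) hA.nonvanishing m s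
          simp only [Nat.cast_zero, mul_zero, add_zero, Nat.sub_zero, this, Nat.cast_add,
            Nat.cast_one, Nat.add_sub_add_right]
          exact add_neg_cancel _
      · intro k hk
        rw [Function.mem_support] at hk
        rw [Finset.coe_range, Set.mem_Iio]
        by_contra h
        exact hk (if_neg (by omega))
  · intro i hi
    rw [hA.oneSided, zero_mul]
    by_contra h
    exact hi ⟨(ε * i).toNat, by
      change ε * ((ε * i).toNat : ℤ) = i
      rw [Int.toNat_of_nonneg (by rw [neg_mul] at h; omega), hε2]⟩

/-- A right inverse that itself has a right inverse is two-sided; associativity holds because all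
factors are one-sided in the same direction. -/
theorem IsTri.triInv_mul {ε : ℤ} (hε : ε = 1 ∨ ε = -1) {A : DiffOp} (hA : IsTri ε A) :
    A.triInv ε * A = 1 := by
  have hε' : -ε = 1 ∨ -ε = -1 := by omega
  have h1 := hA.mul_triInv hε
  have h2 := hA.triInv.mul_triInv hε
  have h3 : A = (A.triInv ε).triInv ε := by
    have := mul_assoc_of_oneSided hε' hA.oneSided hA.triInv.oneSided hA.triInv.triInv.oneSided
    rwa [h1, h2, one_mul, mul_one, eq_comm] at this
  nth_rw 2 [h3]
  exact h2

theorem OneSided.pow {η d : ℤ} {X : DiffOp} (hX : OneSided η d X) (p : ℕ) :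
    OneSided η (p * d) (X.pow p) := by
  induction p with
  | zero => rw [Nat.cast_zero, zero_mul]; exact oneSided_one η
  | succ p ih =>
    have := ih.mul hX
    rw [show ((p : ℤ) * d + d) = ((p + 1 : ℕ) : ℤ) * d by push_cast; ring] at this
    exact this

/-- The Lax operator `S Λ ^ k S⁻¹` satisfies `L ^ p S = S Λ ^ (k p)`. -/
theorem IsTri.lax_pow_mul {ε : ℤ} (hε : ε = 1 ∨ ε = -1) {S : DiffOp} (hS : IsTri ε S) (k : ℤ)
    (p : ℕ) : (S * shift k * S.triInv ε).pow p * S = S * shift (p * k) := by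
  have hε' : -ε = 1 ∨ -ε = -1 := by omega
  have hsh := oneSided_shift (-ε) k
  have hSs := hS.oneSided.mul hsh
  have hL := hSs.mul hS.triInv.oneSided
  induction p with
  | zero =>
    ext n s : 3
    rw [pow, one_mul, mul_shift_coeff]
    simp
  | succ p ih =>
    rw [pow, mul_assoc_of_oneSided hε' (hL.pow p) hL hS.oneSided,
      mul_assoc_of_oneSided hε' hSs hS.triInv.oneSided hS.oneSided, hS.triInv_mul hε, mul_one,
      ← mul_assoc_of_oneSided hε' (hL.pow p) hS.oneSided hsh, ih]
    ext n s : 3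
    simp only [mul_shift_coeff]
    congr 1
    push_cast
    ring

end DiffOp

end Toda
end

noncomputable section

namespace Toda

/-! ### Wave operators and Lax operators -/

theorem psi₁_amp (τ : Fn) : (psi₁ τ).amp = wave 1 τ 0 := by
  funext s n
  simp only [psi₁, descending, wave, sgn, if_true, one_mul, Int.sub_nonneg,
    Fin.coe_ofNat_eq_mod, Nat.zero_mod, Nat.cast_zero, add_zero]

theorem psi₂_amp (τ : Fn) : (psi₂ τ).amp = wave 1 τ 1 := by
  funext s n
  simp only [psi₂, ascending, wave, sgn, one_ne_zero, if_false, neg_one_mul, neg_sub,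
    Int.sub_nonneg, Fin.coe_ofNat_eq_mod, Nat.one_mod, Nat.cast_one]

theorem psiStar₁_amp (τ : Fn) (s n : ℤ) : (psiStar₁ τ).amp s n = dual 1 τ 0 s (-n) := by
  rw [dual_eq]
  simp only [psiStar₁, descending, intShift, sgn, if_true, one_mul, Int.sub_nonneg,
    Fin.coe_ofNat_eq_mod, Nat.zero_mod, Nat.cast_zero, sub_zero, ite_mul, zero_mul]
  rw [show -n - s = -s - n by ring]
  exact if_congr (by omega) rfl rfl

theorem psiStar₂_amp (τ : Fn) (s n : ℤ) : (psiStar₂ τ).amp s n = dual 1 τ 1 s (-n) := by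
  rw [dual_eq]
  simp only [psiStar₂, ascending, intShift, sgn, one_ne_zero, if_false, neg_one_mul, neg_sub,
    Int.sub_nonneg, Fin.coe_ofNat_eq_mod, Nat.one_mod, Nat.cast_one, add_sub_cancel_right, ite_mul,
    zero_mul]
  rw [show s - -n = n - -s by ring]
  exact if_congr (by omega) rfl rfl

/-- The `j`-th wave operator. -/
def waveDiff (τ : Fn) (j : Fin 2) : DiffOp := ⟨fun n s => wave 1 τ j s (s + n)⟩

/-- The `j`-th Lax operator. -/
def laxDiff (τ : Fn) (j : Fin 2) : DiffOp :=
  waveDiff τ j * DiffOp.shift (sgn j) * (waveDiff τ j).triInv (-sgn j)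

theorem lax₁_eq (τ : Fn) : lax₁ τ = laxDiff τ 0 := by
  rw [lax₁, waveOp₁, waveOp, psi₁_amp, DiffOp.invMinus_eq]
  rfl

theorem lax₂_eq (τ : Fn) : lax₂ τ = laxDiff τ 1 := by
  rw [lax₂, waveOp₂, waveOp, psi₂_amp, DiffOp.invPlus_eq]
  rfl

variable {τ : Fn}

theorem isTri_waveDiff (hτ : NonvanishingAtZero τ) (j : Fin 2) :
    DiffOp.IsTri (-sgn j) (waveDiff τ j) where
  oneSided n s hn := (isTriangular_wave 1 hτ j).eq_zero _ _ (by
    rw [neg_neg] at hn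
    rwa [add_sub_cancel_left])
  nonvanishing s := by
    rw [waveDiff]
    simp only [add_zero, wave_self, map_mul, MvPowerSeries.constantCoeff_inv]
    exact mul_ne_zero (hτ _) (inv_ne_zero (hτ _))

theorem oneSided_laxDiff_pow (hτ : NonvanishingAtZero τ) (j : Fin 2) (p : ℕ) :
    DiffOp.OneSided (sgn j) p ((laxDiff τ j).pow p) := by
  have h := isTri_waveDiff hτ j
  have h1 := h.oneSided
  have h2 := h.triInv.oneSided
  rw [neg_neg] at h1 h2
  have h3 := ((h1.mul (DiffOp.oneSided_shift (sgn j) (sgn j))).mul h2).pow p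
  have h4 : (p : ℤ) * (0 + sgn j * sgn j + 0) = p := by
    rcases sgn_or j with hj | hj <;> rw [hj] <;> ring
  rw [h4] at h3
  exact h3

/-- `L_j ^ p` acts on the `j`-th wave function as multiplication by `z ^ (± p)`. -/
theorem finsum_laxDiff_pow_mul_wave (hτ : NonvanishingAtZero τ) (j : Fin 2) (p : ℕ) (s n : ℤ) :
    ∑ᶠ i : ℤ, ((laxDiff τ j).pow p).coeff i s * wave 1 τ j (s + i) n =
      wave 1 τ j s (n + -(sgn j * p)) := by
  have h := (isTri_waveDiff hτ j).lax_pow_mul (neg_sgn_or j) (sgn j) p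
  have h1 := congrFun (congrFun (congrArg DiffOp.coeff h) (n - s)) s
  rw [DiffOp.mul_shift_coeff, DiffOp.mul_coeff] at h1
  simp only [waveDiff] at h1
  rw [show s + (n - s - p * sgn j) = n + -(sgn j * p) by ring] at h1
  rw [← h1]
  refine finsum_congr fun i => ?_
  rw [show s + i + (n - s - i) = n by ring]
  rfl

/-- The evolution operators `(L_1 ^ p)_{≥ 0}` and `(L_2 ^ p)_{< 0}`. -/
def evolDiff (τ : Fn) (α : TimeIdx) : DiffOp :=
  ⟨fun i s => if (0 ≤ i ↔ α.1 = 0) then ((laxDiff τ α.1).pow α.2).coeff i s else 0⟩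

theorem evolDiff_zero (τ : Fn) (p : ℕ+) :
    evolDiff τ (0, p) = ((lax₁ τ).pow p).nonnegPart := by
  ext i s : 3
  simp only [evolDiff, DiffOp.nonnegPart, lax₁_eq, iff_true]

theorem evolDiff_one (τ : Fn) (p : ℕ+) :
    evolDiff τ (1, p) = ((lax₂ τ).pow p).negPart := by
  ext i s : 3
  simp only [evolDiff, DiffOp.negPart, lax₂_eq, one_ne_zero, iff_false, not_le]

/-- A Lax power is bounded on one side, and the truncation bounds it on the other. -/
theorem exists_finsupp_evolDiff (hτ : NonvanishingAtZero τ) (α : TimeIdx) :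
    ∃ a : ℤ →₀ Fn, ∀ i s, a i s = (evolDiff τ α).coeff i s := by
  refine ⟨Finsupp.ofSupportFinite (evolDiff τ α).coeff ?_, fun i s => rfl⟩
  refine (Set.finite_Icc (-((α.2 : ℕ) : ℤ)) (α.2 : ℕ)).subset fun i hi => ?_
  by_contra h
  refine hi ?_
  funext s
  simp only [evolDiff]
  split_ifs with h1
  · refine oneSided_laxDiff_pow hτ α.1 α.2 i s ?_
    rw [Set.mem_Icc] at h
    by_cases h2 : α.1 = 0
    · simp only [sgn, h2, if_true, iff_true] at h1 ⊢
      omega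
    · simp only [sgn, h2, if_false, iff_false] at h1 ⊢
      omega
  · rfl

theorem act_eq_bandOp {a : ℤ →₀ Fn} {X : DiffOp} (h : ∀ i s, a i s = X.coeff i s) (f : Fn) :
    X.act f = bandOp a f := by
  funext s
  rw [bandOp_apply, DiffOp.act]
  simp only [← h]
  refine finsum_eq_sum_of_support_subset _ fun i hi => ?_
  rw [Finset.mem_coe, Finsupp.mem_support_iff]
  intro h0
  exact hi (by simp only [h0, Pi.zero_apply, zero_mul])

theorem adjoint_act_eq_bandAdj {a : ℤ →₀ Fn} {X : DiffOp} (h : ∀ i s, a i s = X.coeff i s)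
    (f : Fn) : X.adjoint.act f = bandAdj a f := by
  funext s
  rw [bandAdj_apply, DiffOp.act, ← finsum_comp_equiv (Equiv.neg ℤ)]
  simp only [DiffOp.adjoint, ← h, Equiv.neg_apply, neg_neg, ← sub_eq_add_neg]
  refine finsum_eq_sum_of_support_subset _ fun i hi => ?_
  rw [Finset.mem_coe, Finsupp.mem_support_iff]
  intro h0
  exact hi (by simp only [h0, Pi.zero_apply, zero_mul])

/-! ### From the bilinear equation to the evolution of the waves. -/

/-- In the columns `n ≥ s` for the first wave, and `n < s` for the second, the discarded part of the
Lax power meets only zero amplitudes. -/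
theorem wave_eq_zero_of_iff (hτ : NonvanishingAtZero τ) {k : Fin 2} {s n i : ℤ}
    (hi : ¬(0 ≤ i ↔ k = 0)) (hn : s ≤ n ↔ k = 0) : wave 1 τ k (s + i) n = 0 := by
  refine (isTriangular_wave 1 hτ k).eq_zero _ _ ?_
  by_cases hk : k = 0
  · simp only [sgn, hk, if_true, iff_true] at hi hn ⊢
    omega
  · simp only [sgn, hk, if_false, iff_false] at hi hn ⊢
    omega

theorem pderiv_wave_eq_zero (hτ : NonvanishingAtZero τ) (α : TimeIdx) {k : Fin 2} {s n : ℤ}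
    (hn : s ≤ n ↔ k = 0) : MvPowerSeries.pderiv ℂ α (wave 1 τ k s n) = 0 := by
  by_cases h : 0 < sgn k * (n - s)
  · rw [(isTriangular_wave 1 hτ k).eq_zero _ _ h, map_zero]
  · by_cases hk : k = 0
    · simp only [sgn, hk, if_true, iff_true] at hn h
      have : n = s := by omega
      rw [this, hk, wave_self]
      simp only [Fin.coe_ofNat_eq_mod, Nat.zero_mod, Nat.cast_zero, add_zero, hτ.mul_inv]
      exact MvPowerSeries.pderiv_one
    · simp only [sgn, hk, if_false, iff_false] at hn h
      omega

/-- In these columns the amplitude is `0` or `1`, so its derivative vanishes. If the time belongs to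
wave `k`, the truncation acts like the full power, that is, as a power of `z`; if not, it acts as
zero. -/
theorem evol_defect_eq_zero (hτ : NonvanishingAtZero τ) (α : TimeIdx) {a : ℤ →₀ Fn}
    (ha : ∀ i s, a i s = (evolDiff τ α).coeff i s) {k : Fin 2} {s n : ℤ} (hn : s ≤ n ↔ k = 0) :
    (nabla 1 k α (wave 1 τ k s) - colAct (bandOp a) (wave 1 τ k) s) n = 0 := by
  have hact : colAct (bandOp a) (wave 1 τ k) s n =
      ∑ᶠ i : ℤ, (evolDiff τ α).coeff i s * wave 1 τ k (s + i) n := by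
    rw [colAct, ← act_eq_bandOp ha]
    rfl
  rw [Pi.sub_apply, hact, nabla, LinearMap.add_apply, Pi.add_apply, derivOp_apply, one_smul,
    pderiv_wave_eq_zero hτ α hn, zero_add, sub_eq_zero]
  by_cases hk : α.1 = k
  · rw [if_pos hk, shiftOp_apply, ← finsum_laxDiff_pow_mul_wave hτ]
    refine finsum_congr fun i => ?_
    simp only [evolDiff, hk]
    split_ifs with hi
    · rfl
    · rw [wave_eq_zero_of_iff hτ hi hn, mul_zero, zero_mul]
  · rw [if_neg hk, LinearMap.zero_apply, Pi.zero_apply, eq_comm]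
    refine finsum_eq_zero_of_forall_eq_zero fun i => ?_
    simp only [evolDiff]
    split_ifs with hi
    · rw [wave_eq_zero_of_iff hτ _ hn, mul_zero]
      rw [hi]
      omega
    · rw [zero_mul]

/-- The supports decide the pairing of the first waves for `s ≤ S` and that of the second for `S <
s`; the bilinear equation on the diagonal transfers each value to the other wave. -/
theorem IsTau.orth (h : IsTau τ) (j : Fin 2) (s S : ℤ) :
    pair (wave 1 τ j s) (dual 1 τ j S) = if s = S then 1 else 0 := by
  have hτ := h.nonvanishing
  have hP := fun j => isTriangular_wave 1 hτ j
  have hQ := fun j => isTriangular_dual 1 hτ j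
  have h0 : s ≤ S → pair (wave 1 τ 0 s) (dual 1 τ 0 S) = if s = S then 1 else 0 := by
    intro hs
    rw [pair_eq_single (sgn_or 0) ((hP 0).eq_zero s) (M := S)
      (fun n hn => (hQ 0).eq_zero S n (by rw [neg_mul, ← mul_neg, neg_sub]; exact hn))
      (by simp only [sgn, if_true]; omega)]
    split_ifs with hsS
    · rw [← hsS, wave_self, dual_self]
      simp only [Fin.coe_ofNat_eq_mod, Nat.zero_mod, Nat.cast_zero, add_zero, sub_zero,
        hτ.mul_inv, mul_one]
    · rw [(hQ 0).eq_zero S s (by simp only [sgn, if_true]; omega), mul_zero]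
  have h1 : S < s → pair (wave 1 τ 1 s) (dual 1 τ 1 S) = if s = S then 1 else 0 := by
    intro hs
    rw [if_neg (by omega), pair_eq_zero (sgn_or 1) ((hP 1).eq_zero s) (M := S)
      (fun n hn => (hQ 1).eq_zero S n (by rw [neg_mul, ← mul_neg, neg_sub]; exact hn))
      (by simp only [sgn, one_ne_zero, if_false]; omega)]
  have h2 := ((isTau_iff τ).mp h).2 s S _ _ Reach.refl
  rcases le_or_gt s S with hs | hs
  · by_cases hj : j = 0
    · rw [hj, h0 hs]
    · rw [show j = 1 by omega, ← h2, h0 hs]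
  · by_cases hj : j = 0
    · rw [hj, h2, h1 hs]
    · rw [show j = 1 by omega, h1 hs]

/-- The two defects have equal pairings with the adjoint rows, by one derivative of the bilinear
equation. Their half-line supports make one of these pairings vanish for each `S`, hence both, and
the adjoint rows are triangular. -/
theorem IsTau.exists_todaSys (h : IsTau τ) : ∃ A A', TodaSys 1 τ A A' ∧
    (∀ α f, A α f = (evolDiff τ α).act f) ∧ ∀ α f, A' α f = (evolDiff τ α).adjoint.act f := by
  have hτ := h.nonvanishing
  choose a ha using exists_finsupp_evolDiff hτ
  refine ⟨fun α => bandOp (a α), fun α => bandAdj (a α), ⟨hτ, fun α => ⟨a α, rfl, rfl⟩, ?_, h.orth⟩,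
    fun α f => (act_eq_bandOp (ha α) f).symm, fun α f => (adjoint_act_eq_bandAdj (ha α) f).symm⟩
  intro k α s
  have hP := fun j => (isTriangular_wave 1 hτ j).bddSide
  have hQ := fun j => (isTriangular_dual 1 hτ j).bddSide
  have hband : ∀ j s, BddSide (sgn j) (colAct (bandOp (a α)) (wave 1 τ j) s) := fun j s =>
    bddSide_colAct ⟨a α, rfl, rfl⟩ (hP j) s
  set W : Fin 2 → Fn := fun k =>
    nabla 1 k α (wave 1 τ k s) - colAct (bandOp (a α)) (wave 1 τ k) s with hW
  have hWb : ∀ k, BddSide (sgn k) (W k) := fun k =>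
    (bddSide_nabla 1 k α (hP k s)).sub (hband k s)
  have hWz : ∀ k n, (s ≤ n ↔ k = 0) → W k n = 0 := fun k n hn =>
    evol_defect_eq_zero hτ α (ha α) hn
  have hpair : ∀ S, pair (W 0) (dual 1 τ 0 S) = pair (W 1) (dual 1 τ 1 S) := by
    intro S
    have h1 : ∀ j, pair (colAct (bandOp (a α)) (wave 1 τ j) s) (dual 1 τ j S) =
        ∑ i ∈ (a α).support, a α i s * if s + i = S then 1 else 0 := by
      intro j
      rw [colAct_bandOp, pair_sum_left (sgn_or j) _ (fun i _ => (hP j _).smul _) (hQ j S)]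
      simp only [pair_smul_left, h.orth]
    rw [pair_sub_left (sgn_or 0) (bddSide_nabla 1 0 α (hP 0 s)) (hband 0 s) (hQ 0 S),
      pair_sub_left (sgn_or 1) (bddSide_nabla 1 1 α (hP 1 s)) (hband 1 s) (hQ 1 S), h1, h1,
      ((isTau_iff τ).mp h).2 s S _ _ (Reach.refl.step α)]
  have hzero : ∀ k S, pair (W k) (dual 1 τ k S) = 0 := by
    intro k S
    have h0 : s ≤ S → pair (W 0) (dual 1 τ 0 S) = 0 := by
      intro hs
      refine finsum_eq_zero_of_forall_eq_zero fun n => ?_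
      by_cases hn : s ≤ n
      · rw [hWz _ n (by simpa using hn), zero_mul]
      · rw [(isTriangular_dual 1 hτ 0).eq_zero S n (by simp only [sgn, if_true]; omega), mul_zero]
    have h1 : S < s → pair (W 1) (dual 1 τ 1 S) = 0 := by
      intro hs
      refine finsum_eq_zero_of_forall_eq_zero fun n => ?_
      by_cases hn : s ≤ n
      · rw [(isTriangular_dual 1 hτ 1).eq_zero S n
          (by simp only [sgn, one_ne_zero, if_false]; omega), mul_zero]
      · rw [hWz _ n (by simpa using hn), zero_mul]
    rcases le_or_gt s S with hs | hs
    · by_cases hk : k = 0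
      · rw [hk, h0 hs]
      · rw [show k = 1 by omega, ← hpair, h0 hs]
    · by_cases hk : k = 0
      · rw [hk, hpair, h1 hs]
      · rw [show k = 1 by omega, h1 hs]
  refine sub_eq_zero.mp (eq_zero_of_pair (neg_sgn_or k) (isTriangular_dual 1 hτ k)
    (by rw [neg_neg]; exact hWb k) fun S => ?_)
  rw [pair_comm]
  exact hzero k S

/-- The evolution operators of a tau function are determined by it. -/
theorem TodaSys.unique {A A' B B' : TimeIdx → FnEnd} (h : TodaSys 1 τ A A')
    (h' : TodaSys 1 τ B B') : A = B ∧ A' = B' := by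
  have hA : A = B := by
    funext α
    refine (h.band α).eq_of_colAct (sgn_or 0) (isTriangular_wave 1 h.nonvanishing 0) (h'.band α) ?_
    funext s
    rw [← h.evol, ← h'.evol]
  refine ⟨hA, funext fun α => ?_⟩
  subst hA
  exact (h.band α).adj_unique (h'.band α)

theorem forall_timeIdx {p : TimeIdx → Prop} :
    (∀ α, p α) ↔ ∀ n : ℕ+, p (0, n) ∧ p (1, n) := by
  refine ⟨fun h n => ⟨h _, h _⟩, ?_⟩
  rintro h ⟨j, n⟩
  fin_cases j
  · exact (h n).1
  · exact (h n).2

theorem isEigenfunction_iff' (τ q : Fn) : IsEigenfunction τ q ↔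
    ∀ α s, MvPowerSeries.pderiv ℂ α (q s) = (evolDiff τ α).act q s := by
  rw [forall_timeIdx]
  simp only [evolDiff_zero, evolDiff_one, ← forall_and]
  rfl

theorem isAdjointEigenfunction_iff' (τ r : Fn) : IsAdjointEigenfunction τ r ↔
    ∀ α s, MvPowerSeries.pderiv ℂ α (r s) = -(evolDiff τ α).adjoint.act r s := by
  rw [forall_timeIdx]
  simp only [evolDiff_zero, evolDiff_one, ← forall_and]
  rfl

/-- By uniqueness any evolution operators of `τ` are the truncated Lax powers; so the Lax operators
of a transformed tau function never have to be computed. -/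
theorem TodaSys.isEigenfunction_iff {A A' : TimeIdx → FnEnd} (h : TodaSys 1 τ A A') (q : Fn) :
    IsEigenfunction τ q ↔ IsEig 1 A q := by
  obtain ⟨B, B', hB, h1, h2⟩ := h.isTau.exists_todaSys
  obtain ⟨rfl, rfl⟩ := h.unique hB
  rw [isEigenfunction_iff', IsEig]
  simp only [funext_iff, derivOp_apply, one_smul, h1]

theorem TodaSys.isAdjointEigenfunction_iff {A A' : TimeIdx → FnEnd} (h : TodaSys 1 τ A A')
    (r : Fn) : IsAdjointEigenfunction τ r ↔ IsAdjEig 1 A' r := by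
  obtain ⟨B, B', hB, h1, h2⟩ := h.isTau.exists_todaSys
  obtain ⟨rfl, rfl⟩ := h.unique hB
  rw [isAdjointEigenfunction_iff', IsAdjEig]
  simp only [funext_iff, derivOp_apply, one_smul, Pi.neg_apply, h2]

end Toda
end

noncomputable section

namespace Toda

/-! ### Summation -/

/-- Among the primitives of `g` the vanishing for large `s` selects this one, and the formal sum
becomes finite. The support of the wave thus dictates the expansion of `Δ⁻¹`. -/
theorem eq_finsum_deltaInvPlus {h g : Fn} (hg : ∀ s, h (s + 1) - h s = g s) {N : ℤ}
    (hN : ∀ s, N < s → h s = 0) (s : ℤ) :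
    h s = ∑ᶠ i : ℤ, DiffOp.deltaInvPlus.coeff i s * g (s + i) := by
  have h1 : ∀ k : ℕ, h s = h (s + k) - ∑ i ∈ Finset.range k, g (s + i) := by
    intro k
    induction k with
    | zero => simp
    | succ k ih =>
      rw [ih, Finset.sum_range_succ, ← hg (s + k)]
      push_cast
      rw [add_assoc]
      ring
  rw [finsum_eq_finsum_comp (g := fun k : ℕ => (k : ℤ)) Nat.cast_injective,
    finsum_eq_sum_of_support_subset _ (s := Finset.range (N + 1 - s).toNat)]
  · rw [h1 (N + 1 - s).toNat, hN _ (by omega)]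
    simp [DiffOp.deltaInvPlus]
  · intro k hk
    rw [Finset.coe_range, Set.mem_Iio]
    by_contra hk'
    refine hk ?_
    simp only
    rw [← hg, hN _ (by omega), hN _ (by omega), sub_zero, mul_zero]
  · intro i hi
    have : ¬0 ≤ i := fun h => hi ⟨i.toNat, Int.toNat_of_nonneg h⟩
    simp [DiffOp.deltaInvPlus, this]

theorem eq_finsum_deltaInvMinus {h g : Fn} (hg : ∀ s, h (s + 1) - h s = g s) {N : ℤ}
    (hN : ∀ s, s < N → h s = 0) (s : ℤ) :
    h s = ∑ᶠ i : ℤ, DiffOp.deltaInvMinus.coeff i s * g (s + i) := by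
  have h1 := eq_finsum_deltaInvPlus (h := fun s => h (1 - s)) (g := fun s => -g (-s)) (N := 1 - N)
    (fun s => by rw [← hg (-s)]; ring_nf) (fun s hs => hN _ (by omega)) (1 - s)
  simp only [sub_sub_cancel] at h1
  rw [h1, ← finsum_comp_equiv (Equiv.subLeft (-1 : ℤ))]
  refine finsum_congr fun i => ?_
  simp only [DiffOp.deltaInvPlus, DiffOp.deltaInvMinus, Equiv.subLeft_apply]
  rw [show -(1 - s + (-1 - i)) = s + i by ring]
  by_cases hi : i < 0
  · rw [if_pos (by omega), if_pos hi]; ring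
  · rw [if_neg (by omega), if_neg hi]; ring

/-- Taking adjoints reverses powers of `Λ`, so expansion of `(Δ^*)⁻¹` in positive powers uses the
coefficients of the negative expansion of `Δ⁻¹`. -/
theorem eq_finsum_deltaStarInvPlus {h g : Fn} (hg : ∀ s, h (s - 1) - h s = g s) {N : ℤ}
    (hN : ∀ s, N < s → h s = 0) (s : ℤ) :
    h s = ∑ᶠ i : ℤ, DiffOp.deltaInvMinus.coeff (-i) (s + i) * g (s + i) := by
  have h1 := eq_finsum_deltaInvMinus (h := fun s => h (-s)) (g := fun s => g (-s)) (N := -N)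
    (fun s => by rw [← hg (-s)]; ring_nf) (fun s hs => hN _ (by omega)) (-s)
  simp only [neg_neg] at h1
  rw [h1, ← finsum_comp_equiv (Equiv.neg ℤ)]
  refine finsum_congr fun i => ?_
  rw [Equiv.neg_apply, show -(-s + -i) = s + i by ring]
  rfl

theorem eq_finsum_deltaStarInvMinus {h g : Fn} (hg : ∀ s, h (s - 1) - h s = g s) {N : ℤ}
    (hN : ∀ s, s < N → h s = 0) (s : ℤ) :
    h s = ∑ᶠ i : ℤ, DiffOp.deltaInvPlus.coeff (-i) (s + i) * g (s + i) := by
  have h1 := eq_finsum_deltaInvPlus (h := fun s => h (-s)) (g := fun s => g (-s)) (N := -N)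
    (fun s => by rw [← hg (-s)]; ring_nf) (fun s hs => hN _ (by omega)) (-s)
  simp only [neg_neg] at h1
  rw [h1, ← finsum_comp_equiv (Equiv.neg ℤ)]
  refine finsum_congr fun i => ?_
  rw [Equiv.neg_apply, show -(-s + -i) = s + i by ring]
  rfl

/-! ### The elementary Darboux operators -/

theorem mul_waveOp (X : DiffOp) (ψ : Osc) : X * waveOp ψ = waveOp (X.actOsc ψ) := by
  ext n s : 3
  rw [DiffOp.mul_coeff]
  refine finsum_congr fun i => ?_
  simp only [waveOp]
  rw [show s + i + (n - i) = s + n by ring]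

theorem waveOp_mul_shift (ψ : Osc) (k : ℤ) : waveOp ψ * DiffOp.shift k = waveOp (ψ.zMul k) := by
  ext n s : 3
  rw [DiffOp.mul_shift_coeff]
  simp only [waveOp, Osc.zMul, add_sub_assoc]

theorem finsum_delta_mul (F : ℤ → Times) (s : ℤ) :
    ∑ᶠ i : ℤ, DiffOp.delta.coeff i s * F i = F 1 - F 0 := by
  rw [finsum_eq_sum_of_support_subset _ (s := {1, 0})]
  · simp [DiffOp.delta, sub_eq_add_neg]
  · intro i hi
    by_contra h
    refine hi ?_
    rw [Finset.coe_insert, Finset.coe_singleton, Set.mem_insert_iff, Set.mem_singleton_iff,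
      not_or] at h
    simp only [DiffOp.delta, if_neg h.1, if_neg h.2, zero_mul]

theorem TPlus_coeff (q : Fn) (n s : ℤ) : (TPlus q).coeff n s =
    q (s + 1) * DiffOp.delta.coeff n s * (q (s + n))⁻¹ := by
  rw [TPlus, DiffOp.mul_ofFun_coeff, DiffOp.ofFun_mul_coeff]

theorem TPlus_act (q f : Fn) : (TPlus q).act f = darbouxOp q f := by
  funext s
  have h := finsum_delta_mul (fun i => q (s + 1) * (q (s + i))⁻¹ * f (s + i)) s
  simp only [add_zero] at h
  rw [DiffOp.act]
  simp only [TPlus_coeff, darbouxOp, Module.End.mul_apply, mulOp_apply, deltaOp_apply]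
  refine Eq.trans (finsum_congr fun i => ?_) (h.trans ?_) <;> ring

theorem TMinusInv_adjoint_coeff (r : Fn) (n s : ℤ) : (TMinusInv r).adjoint.coeff n s =
    (r (s + n))⁻¹ * DiffOp.delta.coeff (-n) s * r (s - 1) := by
  simp only [DiffOp.adjoint]
  rw [TMinusInv, DiffOp.mul_ofFun_coeff, DiffOp.ofFun_mul_coeff, add_neg_cancel_right]
  rfl

theorem TMinusInv_adjoint_act (r f : Fn) : (TMinusInv r).adjoint.act f =
    flipOp (darbouxOp (flipOp r) (flipOp f)) := by
  funext s
  have h := finsum_delta_mul (fun i => (r (s + -i))⁻¹ * r (s - 1) * f (s + -i)) s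
  simp only [neg_zero, add_zero] at h
  rw [DiffOp.act, ← finsum_comp_equiv (Equiv.neg ℤ)]
  simp only [TMinusInv_adjoint_coeff, darbouxOp, Module.End.mul_apply, mulOp_apply, deltaOp_apply,
    flipOp_apply, Equiv.neg_apply, neg_neg]
  refine Eq.trans (finsum_congr fun i => ?_) (h.trans ?_)
  · ring
  · ring_nf

theorem TPlusInv_adjoint_coeff (D : DiffOp) (q : Fn) (n s : ℤ) :
    (TPlusInv D q).adjoint.coeff n s =
      (q (s + 1))⁻¹ * (D.coeff (-n) (s + n) * q (s + n)) := by
  simp only [DiffOp.adjoint]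
  rw [TPlusInv, DiffOp.mul_ofFun_coeff, DiffOp.ofFun_mul_coeff, add_neg_cancel_right]
  ring

theorem TMinus_coeff (D : DiffOp) (r : Fn) (n s : ℤ) : (TMinus D r).coeff n s =
    (r (s - 1))⁻¹ * (D.coeff n s * r (s + n)) := by
  rw [TMinus, DiffOp.mul_ofFun_coeff, DiffOp.ofFun_mul_coeff, mul_assoc]

theorem actOsc_amp (X : DiffOp) (ψ : Osc) (s n : ℤ) :
    (X.actOsc ψ).amp s n = X.act (fun s => ψ.amp s n) s := rfl

/-! ### The action of `T_+(q)` -/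

section Plus

variable {τ q : Fn} {A A' : TimeIdx → FnEnd}

theorem TodaSys.psi₁_tauPlus (h : TodaSys 1 τ A A') (hq : IsEig 1 A q)
    (hq0 : NonvanishingAtZero q) :
    psi₁ (tauPlus q τ) = ((TPlus q).actOsc (psi₁ τ)).zMul (-1) := by
  ext s n : 3
  · rw [psi₁_amp, h.wave_tauPlus hq hq0, colAct, ← TPlus_act]
    simp only [Osc.zMul, actOsc_amp, psi₁_amp, Fin.coe_ofNat_eq_mod, Nat.zero_mod, Nat.cast_zero,
      sub_zero, sub_neg_eq_add]
  · rfl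

theorem TodaSys.psi₂_tauPlus (h : TodaSys 1 τ A A') (hq : IsEig 1 A q)
    (hq0 : NonvanishingAtZero q) : psi₂ (tauPlus q τ) = (TPlus q).actOsc (psi₂ τ) := by
  ext s n : 3
  · rw [psi₂_amp, h.wave_tauPlus hq hq0, colAct, ← TPlus_act]
    simp only [actOsc_amp, psi₂_amp, Fin.coe_ofNat_eq_mod, Nat.one_mod, Nat.cast_one,
      sub_self, add_zero]
  · rfl

/-- For a fixed power of `z` the transformed adjoint amplitude vanishes for large `s`, so the
unexpanded relation `dual_tauPlus` is inverted in positive powers of `Λ`. -/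
theorem TodaSys.psiStar₁_tauPlus (h : TodaSys 1 τ A A') (hq : IsEig 1 A q)
    (hq0 : NonvanishingAtZero q) : psiStar₁ (tauPlus q τ) =
      ((TPlusInv DiffOp.deltaInvMinus q).adjoint.actOsc (psiStar₁ τ)).zMul 1 := by
  have hτ' := tauPlus_nonvanishing h.nonvanishing hq0
  ext s n : 3
  · have h1 := eq_finsum_deltaStarInvPlus
      (h := fun s => q (s + 1) * dual 1 (tauPlus q τ) 0 s (-n))
      (g := fun s => q s * (psiStar₁ τ).amp s (n - 1)) (N := -n)
      (fun s => by
        have := h.dual_tauPlus hq hq0 0 s (-n)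
        simp only [Fin.coe_ofNat_eq_mod, Nat.zero_mod, Nat.cast_zero, sub_zero] at this
        rw [sub_add_cancel, this, psiStar₁_amp, show -(n - 1) = -n + 1 by ring])
      (fun s hs => by
        rw [(isTriangular_dual 1 hτ' 0).eq_zero _ _ (by simp only [sgn, if_true]; omega),
          mul_zero]) s
    simp only [Osc.zMul, actOsc_amp, DiffOp.act, TPlusInv_adjoint_coeff]
    simp only [mul_assoc]
    rw [← mul_finsum, ← h1, psiStar₁_amp, ← mul_assoc, hq0.inv_mul, one_mul]
  · rfl

theorem TodaSys.psiStar₂_tauPlus (h : TodaSys 1 τ A A') (hq : IsEig 1 A q)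
    (hq0 : NonvanishingAtZero q) : psiStar₂ (tauPlus q τ) =
      (TPlusInv DiffOp.deltaInvPlus q).adjoint.actOsc (psiStar₂ τ) := by
  have hτ' := tauPlus_nonvanishing h.nonvanishing hq0
  ext s n : 3
  · have h1 := eq_finsum_deltaStarInvMinus
      (h := fun s => q (s + 1) * dual 1 (tauPlus q τ) 1 s (-n))
      (g := fun s => q s * (psiStar₂ τ).amp s n) (N := -n)
      (fun s => by
        have := h.dual_tauPlus hq hq0 1 s (-n)
        simp only [Fin.coe_ofNat_eq_mod, Nat.one_mod, Nat.cast_one, sub_self, add_zero] at this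
        rw [sub_add_cancel, this, psiStar₂_amp])
      (fun s hs => by
        rw [(isTriangular_dual 1 hτ' 1).eq_zero _ _
          (by simp only [sgn, one_ne_zero, if_false]; omega), mul_zero]) s
    simp only [actOsc_amp, DiffOp.act, TPlusInv_adjoint_coeff]
    simp only [mul_assoc]
    rw [← mul_finsum, ← h1, psiStar₂_amp, ← mul_assoc, hq0.inv_mul, one_mul]
  · rfl

end Plus

/-! ### The action of `T_-(r)`, by the adjoint symmetry -/

theorem isEig_flip_iff (ε : ℂ) (B : TimeIdx → FnEnd) (f : Fn) :
    IsEig ε (fun α => flipOp * B α * flipOp) f ↔ IsAdjEig (-ε) B (flipOp f) := by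
  refine forall_congr' fun α => ?_
  have h1 : derivOp (-ε) α (flipOp f) = -flipOp (derivOp ε α f) := by
    rw [derivOp_neg]; rfl
  rw [h1, neg_inj, Module.End.mul_apply, Module.End.mul_apply]
  constructor
  · intro h; rw [h, flipOp_flipOp]
  · intro h; rw [← h, flipOp_flipOp]

theorem isAdjEig_flip_iff (ε : ℂ) (B : TimeIdx → FnEnd) (f : Fn) :
    IsAdjEig ε (fun α => flipOp * B α * flipOp) f ↔ IsEig (-ε) B (flipOp f) := by
  refine forall_congr' fun α => ?_
  have h1 : derivOp (-ε) α (flipOp f) = -flipOp (derivOp ε α f) := by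
    rw [derivOp_neg]; rfl
  rw [h1, Module.End.mul_apply, Module.End.mul_apply]
  constructor
  · intro h; rw [h, map_neg, neg_neg, flipOp_flipOp]
  · intro h; rw [← h, map_neg, neg_neg, flipOp_flipOp]

/-- The factor `(-1)^s` is even in `s`, and `r(s - 1)` is the reflected `r` at `-s`. Hence `T_-(r)`
is the reflection of a transformation of type `T_+`. -/
theorem tauMinus_eq (r τ : Fn) :
    tauMinus r τ = fun s => tauPlus (flipOp r) (fun s => τ (-s)) (-s) := by
  funext s
  simp only [tauMinus, tauPlus, flipOp_apply, neg_neg]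
  congr 1
  rw [zpow_neg, ← inv_zpow, inv_neg_one]

theorem NonvanishingAtZero.flip {r : Fn} (hr : NonvanishingAtZero r) :
    NonvanishingAtZero (flipOp r) := fun s => hr (-s - 1)

section Minus

variable {τ r : Fn} {A A' : TimeIdx → FnEnd}

theorem IsAdjEig.flip (hr : IsAdjEig 1 A' r) :
    IsEig (-1) (fun α => flipOp * A' α * flipOp) (flipOp r) := by
  rwa [isEig_flip_iff, neg_neg, flipOp_flipOp]

theorem tauMinus_nonvanishing (hτ : NonvanishingAtZero τ) (hr : NonvanishingAtZero r) :
    NonvanishingAtZero (tauMinus r τ) := by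
  rw [tauMinus_eq]
  exact (tauPlus_nonvanishing hτ.comp_neg hr.flip).comp_neg

theorem dual_neg_one_comp_neg (τ : Fn) (j : Fin 2) (s n : ℤ) :
    dual (-1) (fun s => τ (-s)) j s n = wave 1 τ j (-s - 1) (-n - 1) := by
  simp only [dual, neg_neg]

theorem TodaSys.wave_tauMinus (h : TodaSys 1 τ A A') (hr : IsAdjEig 1 A' r)
    (hr0 : NonvanishingAtZero r) (j : Fin 2) (s n : ℤ) :
    r s * wave 1 (tauMinus r τ) j (s + 1) n - r (s - 1) * wave 1 (tauMinus r τ) j s n =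
      r s * wave 1 τ j s (n - (1 - (j : ℕ))) := by
  have h1 := h.dagger.dual_tauPlus hr.flip hr0.flip j (-s - 1) (-n - 1)
  have h2 : tauPlus (flipOp r) (fun s => τ (-s)) = fun s => tauMinus r τ (-s) := by
    simp only [tauMinus_eq, neg_neg]
  rw [h2] at h1
  simp only [dual_neg_one_comp_neg, flipOp_apply] at h1
  simp only [show -(-s - 1) - 1 = s by ring, show -(-s - 1 - 1) - 1 = s + 1 by ring,
    show -(-s - 1 + 1) - 1 = s - 1 by ring, show -(-n - 1) - 1 = n by ring,
    show ∀ c : ℤ, -(-n - 1 + c) - 1 = n - c from fun c => by ring] at h1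
  exact h1

theorem TodaSys.dual_tauMinus (h : TodaSys 1 τ A A') (hr : IsAdjEig 1 A' r)
    (hr0 : NonvanishingAtZero r) (j : Fin 2) (s n : ℤ) : dual 1 (tauMinus r τ) j s n =
      (TMinusInv r).adjoint.act (fun s => dual 1 τ j s (n - (1 - (j : ℕ)))) s := by
  rw [TMinusInv_adjoint_act, dual, flipOp_apply]
  have h1 := h.dagger.wave_tauPlus hr.flip hr0.flip j (-s - 1) (-n - 1)
  have h2 : tauPlus (flipOp r) (fun s => τ (-s)) = fun s => tauMinus r τ (-s) := by
    simp only [tauMinus_eq, neg_neg]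
  rw [h2] at h1
  have h3 : (fun s => wave (-1) (fun s => τ (-s)) j s (-n - 1 + (1 - (j : ℕ)))) =
      flipOp fun s => dual 1 τ j s (n - (1 - (j : ℕ))) := by
    funext s
    rw [flipOp_apply, dual]
    congr 1 <;> ring
  rw [h1, colAct, h3]

theorem TodaSys.psi₁_tauMinus (h : TodaSys 1 τ A A') (hr : IsAdjEig 1 A' r)
    (hr0 : NonvanishingAtZero r) :
    psi₁ (tauMinus r τ) = ((TMinus DiffOp.deltaInvMinus r).actOsc (psi₁ τ)).zMul 1 := by
  have hτ' := tauMinus_nonvanishing h.nonvanishing hr0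
  ext s n : 3
  · have h1 := eq_finsum_deltaInvMinus
      (h := fun s => r (s - 1) * wave 1 (tauMinus r τ) 0 s n)
      (g := fun s => r s * (psi₁ τ).amp s (n - 1)) (N := n)
      (fun s => by
        have := h.wave_tauMinus hr hr0 0 s n
        simp only [Fin.coe_ofNat_eq_mod, Nat.zero_mod, Nat.cast_zero, sub_zero] at this
        rw [add_sub_cancel_right, this, psi₁_amp])
      (fun s hs => by
        rw [(isTriangular_wave 1 hτ' 0).eq_zero _ _ (by simp only [sgn, if_true]; omega),
          mul_zero]) s
    simp only [Osc.zMul, actOsc_amp, DiffOp.act, TMinus_coeff]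
    simp only [mul_assoc]
    rw [← mul_finsum, ← h1, psi₁_amp, ← mul_assoc, hr0.inv_mul, one_mul]
  · rfl

theorem TodaSys.psi₂_tauMinus (h : TodaSys 1 τ A A') (hr : IsAdjEig 1 A' r)
    (hr0 : NonvanishingAtZero r) :
    psi₂ (tauMinus r τ) = (TMinus DiffOp.deltaInvPlus r).actOsc (psi₂ τ) := by
  have hτ' := tauMinus_nonvanishing h.nonvanishing hr0
  ext s n : 3
  · have h1 := eq_finsum_deltaInvPlus
      (h := fun s => r (s - 1) * wave 1 (tauMinus r τ) 1 s n)
      (g := fun s => r s * (psi₂ τ).amp s n) (N := n)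
      (fun s => by
        have := h.wave_tauMinus hr hr0 1 s n
        simp only [Fin.coe_ofNat_eq_mod, Nat.one_mod, Nat.cast_one, sub_self, sub_zero] at this
        rw [add_sub_cancel_right, this, psi₂_amp])
      (fun s hs => by
        rw [(isTriangular_wave 1 hτ' 1).eq_zero _ _
          (by simp only [sgn, one_ne_zero, if_false]; omega), mul_zero]) s
    simp only [actOsc_amp, DiffOp.act, TMinus_coeff]
    simp only [mul_assoc]
    rw [← mul_finsum, ← h1, psi₂_amp, ← mul_assoc, hr0.inv_mul, one_mul]
  · rfl

theorem TodaSys.psiStar₁_tauMinus (h : TodaSys 1 τ A A') (hr : IsAdjEig 1 A' r)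
    (hr0 : NonvanishingAtZero r) :
    psiStar₁ (tauMinus r τ) = ((TMinusInv r).adjoint.actOsc (psiStar₁ τ)).zMul (-1) := by
  ext s n : 3
  · rw [psiStar₁_amp, h.dual_tauMinus hr hr0]
    simp only [Osc.zMul, actOsc_amp, psiStar₁_amp, Fin.coe_ofNat_eq_mod, Nat.zero_mod,
      Nat.cast_zero, sub_zero, show -(n - -1) = -n - 1 by ring]
  · rfl

theorem TodaSys.psiStar₂_tauMinus (h : TodaSys 1 τ A A') (hr : IsAdjEig 1 A' r)
    (hr0 : NonvanishingAtZero r) :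
    psiStar₂ (tauMinus r τ) = (TMinusInv r).adjoint.actOsc (psiStar₂ τ) := by
  ext s n : 3
  · rw [psiStar₂_amp, h.dual_tauMinus hr hr0]
    simp only [actOsc_amp, psiStar₂_amp, Fin.coe_ofNat_eq_mod, Nat.one_mod, Nat.cast_one,
      sub_self, sub_zero]
  · rfl

theorem deltaStarOp_flipOp_iff (r q Ω : Fn) :
    deltaStarOp (flipOp Ω) = flipOp r * flipOp q ↔ IsDeltaInv (fun s => r s * q s) Ω := by
  rw [funext_iff, IsDeltaInv, ← (Equiv.subLeft (-1 : ℤ)).forall_congr_right]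
  refine forall_congr' fun s => ?_
  simp only [deltaStarOp_apply, flipOp_apply, Pi.mul_apply, Equiv.subLeft_apply]
  rw [show -(-1 - s + -1) - 1 = s + 1 by ring, show -(-1 - s) - 1 = s by ring]

end Minus

end Toda

end

/-! ### Both transformations on the level of tau functions. -/

theorem mainTheorem3 (τ : ℤ → Times) (hτ : IsTau τ) :
    -- the action of `T_+(q)`
    (∀ q : ℤ → Times, IsEigenfunction τ q → NonvanishingAtZero q →
      IsTau (tauPlus q τ) ∧
      waveOp₁ (tauPlus q τ) = TPlus q * waveOp₁ τ * DiffOp.shift (-1) ∧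
      waveOp₂ (tauPlus q τ) = TPlus q * waveOp₂ τ ∧
      psi₁ (tauPlus q τ) = ((TPlus q).actOsc (psi₁ τ)).zMul (-1) ∧
      psi₂ (tauPlus q τ) = (TPlus q).actOsc (psi₂ τ) ∧
      psiStar₁ (tauPlus q τ) =
        ((TPlusInv DiffOp.deltaInvMinus q).adjoint.actOsc (psiStar₁ τ)).zMul 1 ∧
      psiStar₂ (tauPlus q τ) =
        (TPlusInv DiffOp.deltaInvPlus q).adjoint.actOsc (psiStar₂ τ) ∧
      (∀ q' : ℤ → Times, IsEigenfunction τ q' →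
        IsEigenfunction (tauPlus q τ) ((TPlus q).act q')) ∧
      -- `(T_+(q)⁻¹)^* = Λ(q)⁻¹ · (Δ^*)⁻¹ · q`, with `(Δ^*)⁻¹` unique up to a complex constant
      (∀ r' : ℤ → Times, IsAdjointEigenfunction τ r' →
        ∃ Ω₀ : ℤ → Times, IsDeltaStarInv (fun s => q s * r' s) Ω₀ ∧
          ∀ Ω : ℤ → Times, IsDeltaStarInv (fun s => q s * r' s) Ω →
            (IsAdjointEigenfunction (tauPlus q τ) (fun s => (q (s + 1))⁻¹ * Ω s) ↔
              ∃ c : ℂ, ∀ s, Ω s = Ω₀ s + MvPowerSeries.C c))) ∧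
    -- the action of `T_-(r)`
    (∀ r : ℤ → Times, IsAdjointEigenfunction τ r → NonvanishingAtZero r →
      IsTau (tauMinus r τ) ∧
      waveOp₁ (tauMinus r τ) = TMinus DiffOp.deltaInvMinus r * waveOp₁ τ * DiffOp.shift 1 ∧
      waveOp₂ (tauMinus r τ) = TMinus DiffOp.deltaInvPlus r * waveOp₂ τ ∧
      psi₁ (tauMinus r τ) = ((TMinus DiffOp.deltaInvMinus r).actOsc (psi₁ τ)).zMul 1 ∧
      psi₂ (tauMinus r τ) = (TMinus DiffOp.deltaInvPlus r).actOsc (psi₂ τ) ∧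
      psiStar₁ (tauMinus r τ) = ((TMinusInv r).adjoint.actOsc (psiStar₁ τ)).zMul (-1) ∧
      psiStar₂ (tauMinus r τ) = (TMinusInv r).adjoint.actOsc (psiStar₂ τ) ∧
      -- `T_-(r) = Λ⁻¹(r)⁻¹ · Δ⁻¹ · r`, with `Δ⁻¹` unique up to a complex constant
      (∀ q' : ℤ → Times, IsEigenfunction τ q' →
        ∃ Ω₀ : ℤ → Times, IsDeltaInv (fun s => r s * q' s) Ω₀ ∧
          ∀ Ω : ℤ → Times, IsDeltaInv (fun s => r s * q' s) Ω →
            (IsEigenfunction (tauMinus r τ) (fun s => (r (s - 1))⁻¹ * Ω s) ↔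
              ∃ c : ℂ, ∀ s, Ω s = Ω₀ s + MvPowerSeries.C c)) ∧
      (∀ r' : ℤ → Times, IsAdjointEigenfunction τ r' →
        IsAdjointEigenfunction (tauMinus r τ) ((TMinusInv r).adjoint.act r'))) := by
  obtain ⟨A, A', hT, -, -⟩ := hτ.exists_todaSys
  refine ⟨fun q hq hq0 => ?_, fun r hr hr0 => ?_⟩
  · rw [hT.isEigenfunction_iff] at hq
    obtain ⟨K, K', hK⟩ := exists_isGauge hT.band hq hq0
    have hT' := hT.darboux hq hq0 hK
    have h1 := hT.psi₁_tauPlus hq hq0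
    have h2 := hT.psi₂_tauPlus hq hq0
    refine ⟨hT'.isTau, ?_, ?_, h1, h2, hT.psiStar₁_tauPlus hq hq0, hT.psiStar₂_tauPlus hq hq0,
      fun q' hq' => ?_, fun r' hr' => ?_⟩
    · rw [waveOp₁, waveOp₁, h1, mul_waveOp, waveOp_mul_shift]
    · rw [waveOp₂, waveOp₂, h2, mul_waveOp]
    · rw [hT.isEigenfunction_iff] at hq'
      rw [hT'.isEigenfunction_iff, TPlus_act]
      exact hK.isEig hq0 hq'
    · rw [hT.isAdjointEigenfunction_iff] at hr'
      obtain ⟨Ω₀, hΩ₀, h⟩ := hT.exists_deltaStarInv one_ne_zero hq0 hK hr'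
      refine ⟨Ω₀, congrFun hΩ₀, fun Ω hΩ => ?_⟩
      rw [hT'.isAdjointEigenfunction_iff]
      exact h Ω (funext hΩ)
  · rw [hT.isAdjointEigenfunction_iff] at hr
    have hD := hT.dagger
    obtain ⟨K, K', hK⟩ := exists_isGauge hD.band hr.flip hr0.flip
    -- Reflect, apply `T_+` with the reflected `r`, which is an eigenfunction of the reflected
    -- system, and reflect back.
    have hT' := (hD.darboux hr.flip hr0.flip hK).dagger
    rw [neg_neg, ← tauMinus_eq] at hT'
    have h1 := hT.psi₁_tauMinus hr hr0
    have h2 := hT.psi₂_tauMinus hr hr0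
    refine ⟨hT'.isTau, ?_, ?_, h1, h2, hT.psiStar₁_tauMinus hr hr0, hT.psiStar₂_tauMinus hr hr0,
      fun q' hq' => ?_, fun r' hr' => ?_⟩
    · rw [waveOp₁, waveOp₁, h1, mul_waveOp, waveOp_mul_shift]
    · rw [waveOp₂, waveOp₂, h2, mul_waveOp]
    · rw [hT.isEigenfunction_iff] at hq'
      have hq'' : IsAdjEig (-1) (fun α => flipOp * A α * flipOp) (flipOp q') := by
        rwa [isAdjEig_flip_iff, neg_neg, flipOp_flipOp]
      obtain ⟨Ω₀, hΩ₀, h⟩ := hD.exists_deltaStarInv (by norm_num) hr0.flip hK hq''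
      refine ⟨flipOp Ω₀, ?_, fun Ω hΩ => ?_⟩
      · rw [← deltaStarOp_flipOp_iff, flipOp_flipOp]
        exact hΩ₀
      · rw [hT'.isEigenfunction_iff, isEig_flip_iff]
        have h3 : (flipOp fun s => (r (s - 1))⁻¹ * Ω s) =
            fun s => (flipOp r (s + 1))⁻¹ * flipOp Ω s := by
          funext s
          simp only [flipOp_apply]
          rw [show -s - 1 - 1 = -(s + 1) - 1 by ring]
        -- The reflection only permutes the sites, so the freedom in the choice of `Ω` is again one
        -- complex constant.
        rw [h3, h (flipOp Ω) ((deltaStarOp_flipOp_iff r q' Ω).mpr hΩ)]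
        refine exists_congr fun c => ?_
        constructor
        · intro hc s
          have := hc (-s - 1)
          rw [flipOp_apply, show -(-s - 1) - 1 = s by ring] at this
          exact this
        · intro hc s
          have := hc (-s - 1)
          rw [flipOp_apply, show -(-s - 1) - 1 = s by ring] at this
          exact this
    · rw [hT.isAdjointEigenfunction_iff] at hr'
      rw [hT'.isAdjointEigenfunction_iff, TMinusInv_adjoint_act, isAdjEig_flip_iff, flipOp_flipOp]
      exact hK.isEig hr0.flip (IsAdjEig.flip hr')
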